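/- Let $M\subset\mathbb{R}^2$ be an $n$-connected polygon, that is, a compact connected region which is the closure of its interior and whose boundary is the disjoint union of $n$ simple closed polygonal curves. Assume that $M$ is in general position: distinct vertices have distinct heights, where the height is $h(x,y)=y$. A fiber is a connected component of a level set of $h$ on $M$. The Reeb graph $G$ of $M$ is the quotient space of $M$ obtained by collapsing each fiber to a point. Its vertices are the fibers through vertices of $M$. Its edges are the connected components of the complement of the set of vertices in the quotient space, oriented in the direction of increasing $h$. Assume that $G$ is optimal: no Reeb graph of a polygon in general position (of any connectivity) that is homotopy equivalent to $G$ has fewer vertices than $G$. Then: 1. $G$ is a finite oriented graph that is planar and $n$-connected, where $n$-connected means connected with first Betti number $|E|-|V|+1=n-1$. 2. Exactly $n$ vertices of $G$ have degree $2$, exactly two have degree $1$, and all other vertices have degree $3$. 3. The sources and sinks of $G$ are exactly its vertices of degree $1$. -/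

import Mathlib

open Set

/-- A closed polygonal curve in the plane is simple if it has at least three vertices and its
parametrization by the half-open edges (edge `i` at time `t ∈ [0, 1)`) is injective, i.e. the
curve does not meet itself. -/
def Polygon.IsSimple {m : ℕ} (L : Polygon (ℝ × ℝ) m) : Prop :=
  3 ≤ m ∧ ∀ i j : Fin m, ∀ s ∈ Ico (0 : ℝ) 1, ∀ t ∈ Ico (0 : ℝ) 1,
    L.edgePath ℝ i s = L.edgePath ℝ j t → i = j ∧ s = t

/-- An `n`-connected polygon: a compact connected region of the plane, equal to the closure of its
interior, whose topological boundary is the disjoint union of `n` simple closed polygonal curves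
(these curves are the connected components of the boundary).  The vertices of these curves are the
vertices of the polygon. -/
structure PolygonalRegion (n : ℕ) where
  /-- the underlying set of points -/
  carrier : Set (ℝ × ℝ)
  /-- the number of vertices of each boundary component -/
  size : Fin n → ℕ
  /-- the boundary components -/
  bdry : (i : Fin n) → Polygon (ℝ × ℝ) (size i)
  isCompact : IsCompact carrier
  isConnected : IsConnected carrier
  closure_interior : closure (interior carrier) = carrier
  isSimple : ∀ i, (bdry i).IsSimple
  disjoint : ∀ i j, i ≠ j → Disjoint ((bdry i).boundary ℝ) ((bdry j).boundary ℝ)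
  frontier_eq : frontier carrier = ⋃ i, (bdry i).boundary ℝ

namespace PolygonalRegion

variable {n : ℕ} (P : PolygonalRegion n)

/-- The set of vertices of the polygon. -/
def vertexSet : Set (ℝ × ℝ) := {p | ∃ i a, p = (P.bdry i).vertices a}

/-- General position with respect to the height function `(x, y) ↦ y`: different vertices have
different heights. -/
def InGeneralPosition : Prop :=
  ∀ p ∈ P.vertexSet, ∀ q ∈ P.vertexSet, p ≠ q → p.2 ≠ q.2

/-- The fiber through a point: the connected component of this point in the level set of the
height function on the polygon. -/
def fiber (x : P.carrier) : Set (ℝ × ℝ) :=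
  connectedComponentIn (P.carrier ∩ {p | p.2 = (x : ℝ × ℝ).2}) x

/-- Two points of the polygon are equivalent if they lie in one fiber. -/
def fiberSetoid : Setoid P.carrier := Setoid.ker P.fiber

/-- The Reeb graph as a topological space: the quotient of the polygon by the fibers, with the
quotient topology. -/
abbrev Reeb : Type := Quotient P.fiberSetoid

theorem snd_eq_of_fiber_eq (x y : P.carrier) (h : P.fiber x = P.fiber y) :
    (x : ℝ × ℝ).2 = (y : ℝ × ℝ).2 := by
  have hx : (x : ℝ × ℝ) ∈ P.fiber x := mem_connectedComponentIn ⟨x.2, rfl⟩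
  rw [h] at hx
  exact (connectedComponentIn_subset _ _ hx).2

/-- The height function on the Reeb graph. -/
def reebHeight : P.Reeb → ℝ :=
  Quotient.lift (fun x : P.carrier => (x : ℝ × ℝ).2) P.snd_eq_of_fiber_eq

/-- The vertices of the Reeb graph: the fibers through the vertices of the polygon. -/
def reebVertices : Set P.Reeb :=
  Quotient.mk P.fiberSetoid '' {x | (x : ℝ × ℝ) ∈ P.vertexSet}

/-- The (open) edges of the Reeb graph: the connected components of the complement of the set of
its vertices. -/
def reebEdges : Set (Set P.Reeb) :=
  {e | ∃ x ∈ P.reebVerticesᶜ, e = connectedComponentIn P.reebVerticesᶜ x}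

/-- The edge `e` starts at the vertex `v`, edges being oriented by increasing height. -/
def StartsAt (e : Set P.Reeb) (v : P.Reeb) : Prop :=
  v ∈ closure e ∧ ∀ x ∈ e, P.reebHeight v < P.reebHeight x

/-- The edge `e` ends at the vertex `v`, edges being oriented by increasing height. -/
def EndsAt (e : Set P.Reeb) (v : P.Reeb) : Prop :=
  v ∈ closure e ∧ ∀ x ∈ e, P.reebHeight x < P.reebHeight v

/-- The number of edges that start at `v`. -/
noncomputable def outDegree (v : P.Reeb) : ℕ := {e ∈ P.reebEdges | P.StartsAt e v}.ncard

/-- The number of edges that end at `v`. -/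
noncomputable def inDegree (v : P.Reeb) : ℕ := {e ∈ P.reebEdges | P.EndsAt e v}.ncard

/-- The degree of a vertex. -/
noncomputable def degree (v : P.Reeb) : ℕ := P.inDegree v + P.outDegree v

/-- A source is a vertex at which no edge ends. -/
def IsSource (v : P.Reeb) : Prop := P.inDegree v = 0

/-- A sink is a vertex at which no edge starts. -/
def IsSink (v : P.Reeb) : Prop := P.outDegree v = 0

/-- The vertices and edges above make the Reeb space a finite oriented graph: there are finitely
many of them, and every open edge is an arc that the height function maps bijectively onto the
open interval between the heights of its two ends, which are vertices. -/
def IsFiniteOrientedGraph : Prop :=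
  P.reebVertices.Finite ∧ P.reebEdges.Finite ∧
    ∀ e ∈ P.reebEdges, ∃ u ∈ P.reebVertices, ∃ w ∈ P.reebVertices,
      closure e = e ∪ {u, w} ∧ BijOn P.reebHeight e (Ioo (P.reebHeight u) (P.reebHeight w))

/-- The Reeb graph is `k`-connected in the sense in which a planar domain is: it is connected and
has first Betti number `|E| - |V| + 1 = k - 1` (just as a `k`-connected domain). -/
def ReebIsNConnected (k : ℕ) : Prop :=
  ConnectedSpace P.Reeb ∧ (P.reebEdges.ncard : ℤ) - P.reebVertices.ncard + 1 = k - 1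

/-- The Reeb graph is planar: it embeds topologically into the plane. -/
def ReebIsPlanar : Prop := ∃ f : P.Reeb → ℝ × ℝ, Topology.IsEmbedding f

/-- The Reeb graph is optimal: among the Reeb graphs of all polygons in general position (of any
connectivity) that are homotopy equivalent to it, none has fewer vertices. -/
def ReebIsOptimal : Prop :=
  ∀ (k : ℕ) (Q : PolygonalRegion k), Q.InGeneralPosition →
    Nonempty (ContinuousMap.HomotopyEquiv Q.Reeb P.Reeb) →
      P.reebVertices.ncard ≤ Q.reebVertices.ncard

end PolygonalRegion

/-!
# Optimal Reeb graphs of polygons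

Let `P` be a polygon in general position with `n` boundary curves and `V` vertices. In general
position no side is horizontal, and a fiber is a maximal horizontal segment of `P` (`proj_eq_iff`).
Apart from the fibers through vertices, `P` decomposes into open trapezoids between two consecutive
sides, each of which extends from the fiber of one vertex to the fiber of another one (`Trap`,
`exists_trap`). So the Reeb graph is the graph with the vertices of `P` as vertices and the `E`
trapezoids as edges; drawing every edge as the segment that joins its two vertices inside the closed
trapezoid gives a plane drawing that meets each fiber once (`reebHomeomorph`, `reebIsPlanar`).

*Degrees.* The edges that start at a vertex correspond to the sides with the region to their right
that run upwards from its fiber (`image_left_eq_above`). Hence a vertex has degree 2, with one edge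
coming in and one going out, if the boundary curve passes it from below to above (`Reg`). At a local
extremum of the boundary curve the degree is 3 if the fiber extends to the left of the vertex
(`Lft`), with edges going both up and down, and otherwise 1, the vertex being a source or a sink.
The handshake lemma expresses `E` by the numbers of vertices of these kinds (`two_mul_card_trap`).

*The Betti number `b = E - V + 1` is at most `n - 1`.* For a cycle modulo 2 and a point of a side,
count the edges of the cycle to the left of this point. The parity does not change along a side, nor
at the vertices (`sideCount_next`), so it is constant on each boundary curve. It vanishes on a
leftmost curve, and these `n` parities determine the cycle. So the space of cycles has dimension at
most `n - 1` (`card_trap_add_two_le`).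

*Comparison.* A triangle with `b` triangular holes on top of each other has `3 (b + 1)` vertices, and
its Reeb graph has first Betti number `b`: at most `b` by the bound above, and at least `b` since all
the lowest and highest vertices of the holes have degree 3 (`HoledTriangle.card_trap_region`).
Connected finite graphs with the same Betti number are homotopy equivalent, since collapsing edges
reduces both to bouquets of circles (`Multigraph.nonempty_homotopyEquiv`). So if the Reeb graph of
`P` is optimal, then `V ≤ 3 (b + 1)`. But `3 n ≤ V`, as every boundary curve has at least three
vertices, and `b + 1 ≤ n`. Therefore `b = n - 1` and all boundary curves are triangles
(`ReebIsOptimal.size_eq_three`). Every triangle has exactly one regular vertex, so there are `n`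
vertices of degree 2, and the handshake lemma leaves exactly two vertices of degree 1.
-/

open Filter Topology

/-- A compact plane region that is the closure of its interior and whose frontier is a finite union
of closed polygonal curves without horizontal sides.  The index type `S` is used for vertices and
for sides alike: the side `s` joins the vertex `pt s` to the vertex `pt (next s)`. Different
vertices have different heights, and different sides meet at most in a common end. -/
structure SegRegion (S : Type) where
  /-- the underlying set of points -/
  M : Set (ℝ × ℝ)
  isCompact : IsCompact M
  nonempty : M.Nonempty
  closure_interior : closure (interior M) = M
  /-- the cyclic successor on each boundary curve -/
  next : Equiv.Perm S
  /-- the vertices -/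
  pt : S → ℝ × ℝ
  height_injective : Function.Injective fun s => (pt s).2
  next_ne : ∀ s, next s ≠ s
  frontier_eq : frontier M = ⋃ s, segment ℝ (pt s) (pt (next s))
  eq_of_mem_segment : ∀ s t, s ≠ t → ∀ p ∈ segment ℝ (pt s) (pt (next s)),
    p ∈ segment ℝ (pt t) (pt (next t)) → p = pt s ∧ next t = s ∨ p = pt t ∧ next s = t

namespace SegRegion

variable {S : Type} (D : SegRegion S)

/-- The height of a vertex. -/
def η (s : S) : ℝ := (D.pt s).2

/-- The abscissa of a vertex. -/
def c (s : S) : ℝ := (D.pt s).1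

/-- The height of the lower end of a side. -/
def lo (s : S) : ℝ := min (D.η s) (D.η (D.next s))

/-- The height of the upper end of a side. -/
def hi (s : S) : ℝ := max (D.η s) (D.η (D.next s))

/-- The inverse slope of a side. -/
noncomputable def slope (s : S) : ℝ := (D.c (D.next s) - D.c s) / (D.η (D.next s) - D.η s)

/-- The abscissa at height `y` of the line that carries a side. -/
noncomputable def xs (s : S) (y : ℝ) : ℝ := D.c s + D.slope s * (y - D.η s)

/-- The vertex `v` is an end of the side `s`. -/
def Inc (s v : S) : Prop := s = v ∨ D.next s = v

/-- The points `(x, y)` and `(x', y)` are joined by a horizontal segment in the region. -/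
def Horiz (x x' y : ℝ) : Prop := ∀ z ∈ uIcc x x', (z, y) ∈ D.M

/-- Near `(x, y)`, the horizontal slice of the region is the half-line to the right of `x`. -/
def HL (x y : ℝ) : Prop := ∃ r > 0, ∀ z, |z - x| < r → ((z, y) ∈ D.M ↔ x ≤ z)

/-- Near `(x, y)`, the horizontal slice of the region is the half-line to the left of `x`. -/
def HR (x y : ℝ) : Prop := ∃ r > 0, ∀ z, |z - x| < r → ((z, y) ∈ D.M ↔ z ≤ x)

/-- The region lies to the right of the side. -/
def IsL (s : S) : Prop := ∀ y ∈ Ioo (D.lo s) (D.hi s), D.HL (D.xs s y) y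

/-- The region lies to the left of the side. -/
def IsR (s : S) : Prop := ∀ y ∈ Ioo (D.lo s) (D.hi s), D.HR (D.xs s y) y

/-! ### Sides and vertices -/

variable {D}

theorem η_injective : Function.Injective D.η := D.height_injective

theorem η_next_ne (s : S) : D.η (D.next s) ≠ D.η s := fun h => D.next_ne s (η_injective h)

theorem lo_lt_hi (s : S) : D.lo s < D.hi s := by
  unfold lo hi
  rcases lt_or_gt_of_ne (η_next_ne (D := D) s) with h | h <;> simp [h, h.le]

@[simp] theorem xs_η (s : S) : D.xs s (D.η s) = D.c s := by simp [xs]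

@[simp] theorem xs_η_next (s : S) : D.xs s (D.η (D.next s)) = D.c (D.next s) := by
  have := sub_ne_zero.2 (η_next_ne (D := D) s)
  simp only [xs, slope]; field_simp; ring

theorem continuous_xs (s : S) : Continuous (D.xs s) := by unfold xs; fun_prop

theorem pt_eq (s : S) : D.pt s = (D.c s, D.η s) := rfl

theorem mem_segment {s : S} {x y : ℝ} :
    (x, y) ∈ segment ℝ (D.pt s) (D.pt (D.next s)) ↔
      y ∈ Icc (D.lo s) (D.hi s) ∧ x = D.xs s y := by
  have hne := sub_ne_zero.2 (η_next_ne (D := D) s)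
  rw [segment_eq_image', pt_eq, pt_eq]
  constructor
  · rintro ⟨θ, ⟨h0, h1⟩, h⟩
    simp only [Prod.mk_sub_mk, Prod.smul_mk, smul_eq_mul, Prod.mk_add_mk, Prod.mk.injEq] at h
    obtain ⟨rfl, rfl⟩ := h
    refine ⟨?_, ?_⟩
    · unfold lo hi
      rcases lt_or_gt_of_ne (η_next_ne (D := D) s) with h | h
      · rw [min_eq_right h.le, max_eq_left h.le]; constructor <;> nlinarith
      · rw [min_eq_left h.le, max_eq_right h.le]; constructor <;> nlinarith
    · simp only [xs, slope]; field_simp; ring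
  · rintro ⟨⟨h0, h1⟩, rfl⟩
    refine ⟨(y - D.η s) / (D.η (D.next s) - D.η s), ?_, ?_⟩
    · unfold lo at h0; unfold hi at h1
      rcases lt_or_gt_of_ne (η_next_ne (D := D) s) with h | h
      · rw [min_eq_right h.le] at h0; rw [max_eq_left h.le] at h1
        constructor
        · apply div_nonneg_of_nonpos <;> linarith
        · rw [div_le_one_of_neg (by linarith)]; linarith
      · rw [min_eq_left h.le] at h0; rw [max_eq_right h.le] at h1
        constructor
        · apply div_nonneg <;> linarith
        · rw [div_le_one (by linarith)]; linarith
    · simp only [Prod.mk_sub_mk, Prod.smul_mk, smul_eq_mul, Prod.mk_add_mk, Prod.mk.injEq]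
      constructor
      · simp only [xs, slope]; field_simp
      · field_simp; ring

theorem mem_frontier {x y : ℝ} :
    (x, y) ∈ frontier D.M ↔ ∃ s, y ∈ Icc (D.lo s) (D.hi s) ∧ x = D.xs s y := by
  rw [D.frontier_eq, mem_iUnion]; simp only [mem_segment]

theorem isClosed : IsClosed D.M := D.isCompact.isClosed

theorem side_mem {s : S} {y : ℝ} (h : y ∈ Icc (D.lo s) (D.hi s)) : (D.xs s y, y) ∈ D.M :=
  isClosed.frontier_subset (mem_frontier.2 ⟨s, h, rfl⟩)

namespace Inc

variable {s v : S} (h : D.Inc s v)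
include h

theorem xs_eq : D.xs s (D.η v) = D.c v := by
  rcases h with rfl | rfl <;> simp

theorem eq_lo_or_hi : D.η v = D.lo s ∨ D.η v = D.hi s := by
  unfold lo hi
  rcases h with rfl | rfl
  · rcases le_total (D.η s) (D.η (D.next s)) with h | h <;> simp [h]
  · rcases le_total (D.η s) (D.η (D.next s)) with h | h <;> simp [h]

theorem mem_Icc : D.η v ∈ Icc (D.lo s) (D.hi s) := by
  have := lo_lt_hi (D := D) s
  rcases h.eq_lo_or_hi with h | h <;> rw [h] <;> simp [this.le]

theorem notMem_Ioo : D.η v ∉ Ioo (D.lo s) (D.hi s) := by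
  rcases h.eq_lo_or_hi with h | h <;> rw [h] <;> simp

end Inc

theorem exists_inc_lo (s : S) : ∃ v, D.Inc s v ∧ D.η v = D.lo s := by
  unfold lo
  rcases le_total (D.η s) (D.η (D.next s)) with h | h
  · exact ⟨s, Or.inl rfl, by simp [h]⟩
  · exact ⟨D.next s, Or.inr rfl, by simp [h]⟩

theorem exists_inc_hi (s : S) : ∃ v, D.Inc s v ∧ D.η v = D.hi s := by
  unfold hi
  rcases le_total (D.η s) (D.η (D.next s)) with h | h
  · exact ⟨D.next s, Or.inr rfl, by simp [h]⟩
  · exact ⟨s, Or.inl rfl, by simp [h]⟩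

theorem pt_mem (v : S) : (D.c v, D.η v) ∈ D.M := by
  have h : D.Inc v v := Or.inl rfl
  have := side_mem h.mem_Icc
  rwa [h.xs_eq] at this

/-- Two different sides can only meet in a common end. -/
theorem exists_inc_of_xs_eq {s t : S} (hst : s ≠ t) {y : ℝ} (hs : y ∈ Icc (D.lo s) (D.hi s))
    (ht : y ∈ Icc (D.lo t) (D.hi t)) (h : D.xs s y = D.xs t y) :
    ∃ v, D.η v = y ∧ D.c v = D.xs s y ∧ D.Inc s v ∧ D.Inc t v := by
  rcases D.eq_of_mem_segment s t hst (D.xs s y, y) (mem_segment.2 ⟨hs, rfl⟩)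
    (mem_segment.2 ⟨ht, h⟩) with ⟨h1, h2⟩ | ⟨h1, h2⟩
  · rw [pt_eq, Prod.mk.injEq] at h1
    exact ⟨s, h1.2.symm, h1.1.symm, Or.inl rfl, Or.inr h2⟩
  · rw [pt_eq, Prod.mk.injEq] at h1
    exact ⟨t, h1.2.symm, h1.1.symm, Or.inr h2, Or.inl rfl⟩

theorem eq_of_xs_eq {s t : S} {y : ℝ} (hs : y ∈ Ioo (D.lo s) (D.hi s))
    (ht : y ∈ Icc (D.lo t) (D.hi t)) (h : D.xs s y = D.xs t y) : s = t := by
  by_contra hst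
  obtain ⟨v, rfl, -, h1, -⟩ := exists_inc_of_xs_eq hst (Ioo_subset_Icc_self hs) ht h
  exact h1.notMem_Ioo hs

theorem inc_of_xs_eq {s v : S} (hs : D.η v ∈ Icc (D.lo s) (D.hi s))
    (h : D.xs s (D.η v) = D.c v) : D.Inc s v := by
  have hv : D.Inc v v := Or.inl rfl
  by_cases hst : s = v
  · exact Or.inl hst
  obtain ⟨w, hw, -, h1, -⟩ := exists_inc_of_xs_eq hst hs hv.mem_Icc (h.trans hv.xs_eq.symm)
  rwa [η_injective hw] at h1

theorem xs_ne_of_mem_Ioo {s v : S} (hs : D.η v ∈ Ioo (D.lo s) (D.hi s)) :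
    D.xs s (D.η v) ≠ D.c v := fun h =>
  (inc_of_xs_eq (Ioo_subset_Icc_self hs) h).notMem_Ioo hs

/-- Sides do not cross. -/
theorem xs_lt_of_xs_lt {s t : S} {y z : ℝ} (hs : y ∈ Icc (D.lo s) (D.hi s))
    (ht : y ∈ Icc (D.lo t) (D.hi t)) (hs' : z ∈ Icc (D.lo s) (D.hi s))
    (ht' : z ∈ Icc (D.lo t) (D.hi t)) (h : D.xs s y < D.xs t y)
    (hz : z ∈ Ioo (D.lo s) (D.hi s) ∨ z ∈ Ioo (D.lo t) (D.hi t)) : D.xs s z < D.xs t z := by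
  by_contra hle
  rw [not_lt] at hle
  have hst : s ≠ t := by rintro rfl; exact lt_irrefl _ h
  have hc : ContinuousOn (fun u => D.xs t u - D.xs s u) (uIcc y z) :=
    ((continuous_xs t).sub (continuous_xs s)).continuousOn
  obtain ⟨u, hu, hu0⟩ := intermediate_value_uIcc hc
    (show (0 : ℝ) ∈ _ from mem_uIcc.2 (Or.inr ⟨by linarith, by linarith⟩))
  have hu0 : D.xs s u = D.xs t u := by simp only at hu0; linarith
  have huy : u ≠ y := by rintro rfl; exact h.ne hu0
  obtain ⟨v, rfl, -, h1, h2⟩ := exists_inc_of_xs_eq hst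
    (Set.uIcc_subset_Icc hs hs' hu) (Set.uIcc_subset_Icc ht ht' hu) hu0
  have n1 := h1.notMem_Ioo
  have n2 := h2.notMem_Ioo
  simp only [mem_Ioo, mem_Icc] at *
  rcases mem_uIcc.1 hu with ⟨a, b⟩ | ⟨a, b⟩
  · have := lt_of_le_of_ne a huy.symm
    rcases hz with hz | hz
    · exact n1 ⟨by linarith, by linarith⟩
    · exact n2 ⟨by linarith, by linarith⟩
  · have := lt_of_le_of_ne b huy
    rcases hz with hz | hz
    · exact n1 ⟨by linarith, by linarith⟩
    · exact n2 ⟨by linarith, by linarith⟩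

theorem xs_le_of_xs_lt {s t : S} {y z : ℝ} (hs : y ∈ Icc (D.lo s) (D.hi s))
    (ht : y ∈ Icc (D.lo t) (D.hi t)) (hs' : z ∈ Icc (D.lo s) (D.hi s))
    (ht' : z ∈ Icc (D.lo t) (D.hi t)) (h : D.xs s y < D.xs t y) : D.xs s z ≤ D.xs t z := by
  by_contra hlt
  rw [not_le] at hlt
  have hst : s ≠ t := by rintro rfl; exact lt_irrefl _ h
  have hc : ContinuousOn (fun u => D.xs t u - D.xs s u) (uIcc y z) :=
    ((continuous_xs t).sub (continuous_xs s)).continuousOn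
  obtain ⟨u, hu, hu0⟩ := intermediate_value_uIcc hc
    (show (0 : ℝ) ∈ _ from mem_uIcc.2 (Or.inr ⟨by linarith, by linarith⟩))
  have hu0 : D.xs s u = D.xs t u := by simp only at hu0; linarith
  have huy : u ≠ y := by rintro rfl; exact h.ne hu0
  have huz : u ≠ z := by rintro rfl; exact hlt.ne hu0.symm
  obtain ⟨v, rfl, -, h1, h2⟩ := exists_inc_of_xs_eq hst
    (Set.uIcc_subset_Icc hs hs' hu) (Set.uIcc_subset_Icc ht ht' hu) hu0
  have n1 := h1.notMem_Ioo
  simp only [mem_Ioo, mem_Icc] at *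
  rcases mem_uIcc.1 hu with ⟨a, b⟩ | ⟨a, b⟩
  · have := lt_of_le_of_ne a huy.symm
    have := lt_of_le_of_ne b huz
    exact n1 ⟨by linarith, by linarith⟩
  · have := lt_of_le_of_ne b huy
    have := lt_of_le_of_ne a huz.symm
    exact n1 ⟨by linarith, by linarith⟩

/-! ### Reflection -/

variable (D) in
/-- The mirror image of the region in the horizontal axis. -/
def flip : SegRegion S where
  M := {p | (p.1, -p.2) ∈ D.M}
  isCompact := by
    have : {p : ℝ × ℝ | (p.1, -p.2) ∈ D.M} =
        ((Homeomorph.refl ℝ).prodCongr (Homeomorph.neg ℝ)) ⁻¹' D.M := rfl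
    rw [this, Homeomorph.isCompact_preimage]; exact D.isCompact
  nonempty := by
    obtain ⟨p, hp⟩ := D.nonempty
    exact ⟨(p.1, -p.2), by simpa using hp⟩
  closure_interior := by
    have : {p : ℝ × ℝ | (p.1, -p.2) ∈ D.M} =
        ((Homeomorph.refl ℝ).prodCongr (Homeomorph.neg ℝ)) ⁻¹' D.M := rfl
    rw [this, ← Homeomorph.preimage_interior, ← Homeomorph.preimage_closure, D.closure_interior]
  next := D.next
  pt s := ((D.pt s).1, -(D.pt s).2)
  height_injective s t h := D.height_injective (neg_injective h)
  next_ne := D.next_ne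
  frontier_eq := by
    have : {p : ℝ × ℝ | (p.1, -p.2) ∈ D.M} =
        ((Homeomorph.refl ℝ).prodCongr (Homeomorph.neg ℝ)) ⁻¹' D.M := rfl
    rw [this, ← Homeomorph.preimage_frontier, D.frontier_eq, preimage_iUnion]
    refine iUnion_congr fun s => ?_
    let f : (ℝ × ℝ) →ₗ[ℝ] ℝ × ℝ := LinearMap.prodMap LinearMap.id (-LinearMap.id)
    have h2 : (fun p => f (f p)) = id := by ext p <;> simp [f]
    have h3 := image_segment ℝ f.toAffineMap (D.pt s) (D.pt (D.next s))
    ext p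
    constructor
    · intro hp
      have : f p ∈ segment ℝ (D.pt s) (D.pt (D.next s)) := hp
      have h4 := mem_image_of_mem f.toAffineMap this
      rw [h3] at h4
      have h5 : f.toAffineMap (f p) = p := congrFun h2 p
      rw [h5] at h4; exact h4
    · intro hp
      have h3' := image_segment ℝ f.toAffineMap (f (D.pt s)) (f (D.pt (D.next s)))
      have h4 := mem_image_of_mem f.toAffineMap (show p ∈ segment ℝ (f (D.pt s))
        (f (D.pt (D.next s))) from hp)
      rw [h3'] at h4
      have h5 : ∀ q, f.toAffineMap (f q) = q := fun q => congrFun h2 q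
      rw [h5, h5] at h4; exact h4
  eq_of_mem_segment := by
    intro s t hst p hs ht
    let f : (ℝ × ℝ) →ₗ[ℝ] ℝ × ℝ := LinearMap.prodMap LinearMap.id (-LinearMap.id)
    have h5 : ∀ q, f.toAffineMap (f q) = q := by intro q; ext <;> simp [f]
    have key : ∀ s, p ∈ segment ℝ (f (D.pt s)) (f (D.pt (D.next s))) →
        f p ∈ segment ℝ (D.pt s) (D.pt (D.next s)) := by
      intro s hs
      have h3' := image_segment ℝ f.toAffineMap (f (D.pt s)) (f (D.pt (D.next s)))
      have h4 := mem_image_of_mem f.toAffineMap hs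
      rw [h3', h5, h5] at h4; exact h4
    have back : ∀ v, f p = D.pt v → p = f (D.pt v) := by
      intro v h; rw [← h]; exact (h5 p).symm
    rcases D.eq_of_mem_segment s t hst (f p) (key s hs) (key t ht) with ⟨h1, h2⟩ | ⟨h1, h2⟩
    · exact Or.inl ⟨back _ h1, h2⟩
    · exact Or.inr ⟨back _ h1, h2⟩

@[simp] theorem flip_η (s : S) : D.flip.η s = -D.η s := rfl
@[simp] theorem flip_c (s : S) : D.flip.c s = D.c s := rfl
@[simp] theorem flip_next : D.flip.next = D.next := rfl
theorem flip_mem {x y : ℝ} : (x, y) ∈ D.flip.M ↔ (x, -y) ∈ D.M := Iff.rfl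
@[simp] theorem flip_lo (s : S) : D.flip.lo s = -D.hi s := by simp [lo, hi, min_neg_neg]
@[simp] theorem flip_hi (s : S) : D.flip.hi s = -D.lo s := by simp [lo, hi, max_neg_neg]
@[simp] theorem flip_xs (s : S) (y : ℝ) : D.flip.xs s y = D.xs s (-y) := by
  have := sub_ne_zero.2 (η_next_ne (D := D) s)
  have h2 : -D.η (D.next s) - -D.η s ≠ 0 := by contrapose! this; linarith
  simp only [xs, slope, flip_η, flip_c, flip_next]
  have h3 : -D.η (D.next s) - -D.η s = -(D.η (D.next s) - D.η s) := by ring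
  rw [h3, div_neg]; ring
@[simp] theorem flip_inc {s v : S} : D.flip.Inc s v ↔ D.Inc s v := Iff.rfl
@[simp] theorem flip_horiz {x x' y : ℝ} : D.flip.Horiz x x' y ↔ D.Horiz x x' (-y) := Iff.rfl
@[simp] theorem flip_HL {x y : ℝ} : D.flip.HL x y ↔ D.HL x (-y) := Iff.rfl
@[simp] theorem flip_HR {x y : ℝ} : D.flip.HR x y ↔ D.HR x (-y) := Iff.rfl

@[simp] theorem flip_isL {s : S} : D.flip.IsL s ↔ D.IsL s := by
  simp only [IsL, flip_lo, flip_hi, flip_xs, flip_HL]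
  constructor <;> intro h y hy
  · simpa using h (-y) ⟨by linarith [hy.2], by linarith [hy.1]⟩
  · exact h (-y) ⟨by linarith [hy.2], by linarith [hy.1]⟩

@[simp] theorem flip_isR {s : S} : D.flip.IsR s ↔ D.IsR s := by
  simp only [IsR, flip_lo, flip_hi, flip_xs, flip_HR]
  constructor <;> intro h y hy
  · simpa using h (-y) ⟨by linarith [hy.2], by linarith [hy.1]⟩
  · exact h (-y) ⟨by linarith [hy.2], by linarith [hy.1]⟩

theorem flip_frontier {x y : ℝ} : (x, y) ∈ frontier D.flip.M ↔ (x, -y) ∈ frontier D.M := by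
  rw [mem_frontier, mem_frontier]
  simp only [flip_lo, flip_hi, flip_xs, mem_Icc, neg_le, le_neg, and_comm]

/-! ### The region near a frontier point -/

theorem HL.not_HR {x y : ℝ} (h : D.HL x y) : ¬ D.HR x y := by
  rintro ⟨r', hr', h'⟩
  obtain ⟨r, hr, h⟩ := h
  have hm : 0 < min r r' := lt_min hr hr'
  have hx : |x + min r r' / 2 - x| < min r r' := by
    rw [add_sub_cancel_left, abs_of_pos (by linarith)]; linarith
  have := ((h _ (hx.trans_le (min_le_left _ _))).symm.trans
    (h' _ (hx.trans_le (min_le_right _ _)))).1 (by linarith)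
  linarith

theorem HL.not_horiz {x x' y : ℝ} (h : D.HL x y) (hx : x' < x) : ¬ D.Horiz x' x y := by
  intro hh
  obtain ⟨r, hr, h⟩ := h
  have h1 : max x' (x - r / 2) < x := max_lt hx (by linarith)
  have := (h (max x' (x - r / 2)) (by
    rw [abs_sub_comm, abs_of_pos (by linarith)]; linarith [le_max_right x' (x - r / 2)])).1
    (hh _ (mem_uIcc.2 (Or.inl ⟨le_max_left _ _, h1.le⟩)))
  linarith

theorem HR.not_horiz {x x' y : ℝ} (h : D.HR x y) (hx : x < x') : ¬ D.Horiz x x' y := by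
  intro hh
  obtain ⟨r, hr, h⟩ := h
  have h1 : x < min x' (x + r / 2) := lt_min hx (by linarith)
  have := (h (min x' (x + r / 2)) (by
    rw [abs_of_pos (by linarith)]; linarith [min_le_right x' (x + r / 2)])).1
    (hh _ (mem_uIcc.2 (Or.inl ⟨h1.le, min_le_left _ _⟩)))
  linarith

/-- A connected set that does not meet the frontier lies inside or outside the region. -/
theorem subset_or_disjoint {C : Set (ℝ × ℝ)} (hC : IsPreconnected C)
    (h : ∀ p ∈ C, p ∉ frontier D.M) : (∀ p ∈ C, p ∈ D.M) ∨ ∀ p ∈ C, p ∉ D.M := by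
  have hint : ∀ p ∈ C, p ∈ D.M → p ∈ interior D.M := by
    intro p hp hM
    by_contra hi
    exact h p hp (by rw [isClosed.frontier_eq]; exact ⟨hM, hi⟩)
  rcases hC.subset_or_subset isOpen_interior isClosed.isOpen_compl
    (disjoint_compl_right.mono_left interior_subset) (fun p hp => by
      by_cases hM : p ∈ D.M
      · exact Or.inl (hint p hp hM)
      · exact Or.inr hM) with h | h
  · exact Or.inl fun p hp => interior_subset (h hp)
  · exact Or.inr fun p hp => h hp

theorem convex_right (s : S) : Convex ℝ {p : ℝ × ℝ | D.xs s p.2 < p.1} := by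
  have : {p : ℝ × ℝ | D.xs s p.2 < p.1} = {p | (D.slope s • LinearMap.snd ℝ ℝ ℝ -
      LinearMap.fst ℝ ℝ ℝ) p < D.slope s * D.η s - D.c s} := by
    ext p; simp [xs]; constructor <;> intro <;> linarith
  rw [this]; exact convex_halfSpace_lt (LinearMap.isLinear _) _

theorem convex_left (s : S) : Convex ℝ {p : ℝ × ℝ | p.1 < D.xs s p.2} := by
  have : {p : ℝ × ℝ | p.1 < D.xs s p.2} = {p | D.slope s * D.η s - D.c s <
      (D.slope s • LinearMap.snd ℝ ℝ ℝ - LinearMap.fst ℝ ℝ ℝ) p} := by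
    ext p; simp [xs]; constructor <;> intro <;> linarith
  rw [this]; exact convex_halfSpace_gt (LinearMap.isLinear _) _

theorem convex_below (y : ℝ) : Convex ℝ {p : ℝ × ℝ | p.2 ≤ y} :=
  convex_halfSpace_le (LinearMap.snd ℝ ℝ ℝ).isLinear y

theorem convex_above (y : ℝ) : Convex ℝ {p : ℝ × ℝ | y ≤ p.2} :=
  convex_halfSpace_ge (LinearMap.snd ℝ ℝ ℝ).isLinear y

/-- The open square box of radius `r` around a point. -/
def box (x y r : ℝ) : Set (ℝ × ℝ) := {p | |p.1 - x| < r ∧ |p.2 - y| < r}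

theorem box_eq (x y r : ℝ) : box x y r = Metric.ball (x, y) r := by
  ext p; simp [box, Prod.dist_eq, Real.dist_eq]

theorem convex_box (x y r : ℝ) : Convex ℝ (box x y r) := by rw [box_eq]; exact convex_ball _ _

/-- All sides that come close enough to a point contain this point. -/
theorem exists_box [Finite S] (x y : ℝ) : ∃ r > 0, ∀ p ∈ box x y r, ∀ s,
    p.2 ∈ Icc (D.lo s) (D.hi s) → p.1 = D.xs s p.2 → y ∈ Icc (D.lo s) (D.hi s) ∧ x = D.xs s y := by
  have h : ∀ s, ∀ᶠ p : ℝ × ℝ in 𝓝 (x, y), p.2 ∈ Icc (D.lo s) (D.hi s) → p.1 = D.xs s p.2 →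
      y ∈ Icc (D.lo s) (D.hi s) ∧ x = D.xs s y := by
    intro s
    by_cases hs : y ∈ Icc (D.lo s) (D.hi s) ∧ x = D.xs s y
    · exact Eventually.of_forall fun _ _ _ => hs
    · have hcl : IsClosed {p : ℝ × ℝ | p.2 ∈ Icc (D.lo s) (D.hi s) ∧ p.1 = D.xs s p.2} :=
        (isClosed_Icc.preimage continuous_snd).inter
          (isClosed_eq continuous_fst ((continuous_xs s).comp continuous_snd))
      filter_upwards [hcl.isOpen_compl.mem_nhds (show (x, y) ∈ _ from hs)] with p hp h1 h2
      exact absurd ⟨h1, h2⟩ hp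
  obtain ⟨r, hr, hb⟩ := Metric.eventually_nhds_iff_ball.1 (eventually_all.2 h)
  exact ⟨r, hr, fun p hp => hb p (by rwa [← box_eq])⟩

/-- The abscissa of the curve that follows the side `s₁` below height `y₀` and `s₂` above it. -/
noncomputable def bend (D : SegRegion S) (s₁ s₂ : S) (y₀ y : ℝ) : ℝ :=
  if y ≤ y₀ then D.xs s₁ y else D.xs s₂ y

/-- At a point where a boundary curve passes from below to above (an inner point of a side or a
vertex between a lower and an upper side), the region is locally one side of the curve: it cannot
be both sides, since the point is on the frontier, nor none, since the region is the closure of its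
interior. -/
theorem passing [Finite S] {s₁ s₂ : S} {x₀ y₀ : ℝ} (h1 : y₀ ∈ Ioc (D.lo s₁) (D.hi s₁))
    (h2 : y₀ ∈ Ico (D.lo s₂) (D.hi s₂)) (hx1 : D.xs s₁ y₀ = x₀) (hx2 : D.xs s₂ y₀ = x₀)
    (hc : s₁ = s₂ ∨ D.hi s₁ = y₀ ∧ D.lo s₂ = y₀)
    (hall : ∀ t, y₀ ∈ Icc (D.lo t) (D.hi t) → D.xs t y₀ = x₀ → t = s₁ ∨ t = s₂) :
    ∃ r > 0, (∀ p ∈ box x₀ y₀ r, p ∈ D.M ↔ D.bend s₁ s₂ y₀ p.2 ≤ p.1) ∨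
      (∀ p ∈ box x₀ y₀ r, p ∈ D.M ↔ p.1 ≤ D.bend s₁ s₂ y₀ p.2) := by
  obtain ⟨r₀, hr₀, hbox⟩ := exists_box (D := D) x₀ y₀
  set r := min r₀ (min (y₀ - D.lo s₁) (D.hi s₂ - y₀)) with hr
  have hr0 : 0 < r := lt_min hr₀ (lt_min (by linarith [h1.1]) (by linarith [h2.2]))
  have hrr : r ≤ r₀ := min_le_left _ _
  have hra : r ≤ y₀ - D.lo s₁ := (min_le_right _ _).trans (min_le_left _ _)
  have hrb : r ≤ D.hi s₂ - y₀ := (min_le_right _ _).trans (min_le_right _ _)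
  set γ := D.bend s₁ s₂ y₀ with hγ
  have hle : ∀ y, y ≤ y₀ → γ y = D.xs s₁ y := fun y hy => if_pos hy
  have hge : ∀ y, y₀ ≤ y → γ y = D.xs s₂ y := by
    intro y hy
    rcases hy.eq_or_lt with rfl | hy
    · rw [hle _ le_rfl, hx1, hx2]
    · exact if_neg hy.not_ge
  -- in the box the frontier is exactly the graph of `γ`
  have hgraph : ∀ p ∈ box x₀ y₀ r, p.1 = γ p.2 → p ∈ frontier D.M := by
    intro p hp h
    have hp2 := abs_lt.1 hp.2
    refine mem_frontier.2 ?_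
    rcases le_total p.2 y₀ with hy | hy
    · exact ⟨s₁, ⟨by linarith, hy.trans h1.2⟩, by rw [h, hle _ hy]⟩
    · exact ⟨s₂, ⟨h2.1.trans hy, by linarith⟩, by rw [h, hge _ hy]⟩
  have hfr : ∀ p ∈ box x₀ y₀ r, p.1 ≠ γ p.2 → p ∉ frontier D.M := by
    intro p hp hne hf
    obtain ⟨s, hs, hsx⟩ := mem_frontier.1 hf
    obtain ⟨ha, hb⟩ := hbox p ⟨hp.1.trans_le hrr, hp.2.trans_le hrr⟩ s hs hsx
    apply hne
    rcases hall s ha hb.symm with rfl | rfl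
    · rcases le_or_gt p.2 y₀ with hy | hy
      · rw [hle _ hy, hsx]
      · rcases hc with rfl | ⟨hc, -⟩
        · rw [hge _ hy.le, hsx]
        · exact absurd hs.2 (by rw [hc]; exact not_le.2 hy)
    · rcases le_or_gt y₀ p.2 with hy | hy
      · rw [hge _ hy, hsx]
      · rcases hc with rfl | ⟨-, hc⟩
        · rw [hle _ hy.le, hsx]
        · exact absurd hs.1 (by rw [hc]; exact not_le.2 hy)
  have hright : IsPreconnected {p | p ∈ box x₀ y₀ r ∧ γ p.2 < p.1} := by
    have : {p | p ∈ box x₀ y₀ r ∧ γ p.2 < p.1} =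
        (box x₀ y₀ r ∩ {p | p.2 ≤ y₀} ∩ {p | D.xs s₁ p.2 < p.1}) ∪
        (box x₀ y₀ r ∩ {p | y₀ ≤ p.2} ∩ {p | D.xs s₂ p.2 < p.1}) := by
      ext p
      simp only [mem_ofPred_eq, mem_union, mem_inter_iff]
      constructor
      · rintro ⟨hp, h⟩
        rcases le_total p.2 y₀ with hy | hy
        · rw [hle _ hy] at h; exact Or.inl ⟨⟨hp, hy⟩, h⟩
        · rw [hge _ hy] at h; exact Or.inr ⟨⟨hp, hy⟩, h⟩
      · rintro (⟨⟨hp, hy⟩, h⟩ | ⟨⟨hp, hy⟩, h⟩)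
        · rw [hle _ hy]; exact ⟨hp, h⟩
        · rw [hge _ hy]; exact ⟨hp, h⟩
    rw [this]
    have hpt : (x₀ + r / 2, y₀) ∈ box x₀ y₀ r :=
      ⟨by simp [abs_of_pos, hr0], by simpa using hr0⟩
    refine IsPreconnected.union (x₀ + r / 2, y₀) ⟨⟨hpt, le_refl y₀⟩, ?_⟩ ⟨⟨hpt, le_refl y₀⟩, ?_⟩
      (((convex_box _ _ _).inter (convex_below _)).inter (convex_right _)).isPreconnected
      (((convex_box _ _ _).inter (convex_above _)).inter (convex_right _)).isPreconnected
    · show D.xs s₁ y₀ < _; rw [hx1]; linarith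
    · show D.xs s₂ y₀ < _; rw [hx2]; linarith
  have hleft : IsPreconnected {p | p ∈ box x₀ y₀ r ∧ p.1 < γ p.2} := by
    have : {p | p ∈ box x₀ y₀ r ∧ p.1 < γ p.2} =
        (box x₀ y₀ r ∩ {p | p.2 ≤ y₀} ∩ {p | p.1 < D.xs s₁ p.2}) ∪
        (box x₀ y₀ r ∩ {p | y₀ ≤ p.2} ∩ {p | p.1 < D.xs s₂ p.2}) := by
      ext p
      simp only [mem_ofPred_eq, mem_union, mem_inter_iff]
      constructor
      · rintro ⟨hp, h⟩
        rcases le_total p.2 y₀ with hy | hy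
        · rw [hle _ hy] at h; exact Or.inl ⟨⟨hp, hy⟩, h⟩
        · rw [hge _ hy] at h; exact Or.inr ⟨⟨hp, hy⟩, h⟩
      · rintro (⟨⟨hp, hy⟩, h⟩ | ⟨⟨hp, hy⟩, h⟩)
        · rw [hle _ hy]; exact ⟨hp, h⟩
        · rw [hge _ hy]; exact ⟨hp, h⟩
    rw [this]
    have hpt : (x₀ - r / 2, y₀) ∈ box x₀ y₀ r :=
      ⟨by rw [abs_lt]; constructor <;> simp <;> linarith, by simpa using hr0⟩
    refine IsPreconnected.union (x₀ - r / 2, y₀) ⟨⟨hpt, le_refl y₀⟩, ?_⟩ ⟨⟨hpt, le_refl y₀⟩, ?_⟩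
      (((convex_box _ _ _).inter (convex_below _)).inter (convex_left _)).isPreconnected
      (((convex_box _ _ _).inter (convex_above _)).inter (convex_left _)).isPreconnected
    · show _ < D.xs s₁ y₀; rw [hx1]; linarith
    · show _ < D.xs s₂ y₀; rw [hx2]; linarith
  have hp0 : (x₀, y₀) ∈ box x₀ y₀ r := ⟨by simpa using hr0, by simpa using hr0⟩
  have hp0γ : x₀ = γ y₀ := by rw [hle _ le_rfl, hx1]
  have hp0f := hgraph _ hp0 hp0γ
  have hopen : IsOpen (box x₀ y₀ r) := by rw [box_eq]; exact Metric.isOpen_ball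
  have hgM : ∀ p ∈ box x₀ y₀ r, p.1 = γ p.2 → p ∈ D.M := fun p hp h =>
    isClosed.frontier_subset (hgraph p hp h)
  refine ⟨r, hr0, ?_⟩
  rcases subset_or_disjoint hright fun p hp => hfr p hp.1 hp.2.ne' with hR | hR <;>
    rcases subset_or_disjoint hleft fun p hp => hfr p hp.1 hp.2.ne with hL | hL
  · exfalso
    have hsub : box x₀ y₀ r ⊆ D.M := by
      intro p hp
      rcases lt_trichotomy p.1 (γ p.2) with h | h | h
      exacts [hL p ⟨hp, h⟩, hgM p hp h, hR p ⟨hp, h⟩]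
    rw [isClosed.frontier_eq] at hp0f
    exact hp0f.2 (interior_mono hsub (by rwa [hopen.interior_eq]))
  · left; intro p hp
    rcases lt_trichotomy p.1 (γ p.2) with h | h | h
    · exact ⟨fun hm => absurd hm (hL p ⟨hp, h⟩), fun hm => absurd hm (not_le.2 h)⟩
    · exact ⟨fun _ => h.ge, fun _ => hgM p hp h⟩
    · exact ⟨fun _ => h.le, fun _ => hR p ⟨hp, h⟩⟩
  · right; intro p hp
    rcases lt_trichotomy p.1 (γ p.2) with h | h | h
    · exact ⟨fun _ => h.le, fun _ => hL p ⟨hp, h⟩⟩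
    · exact ⟨fun _ => h.le, fun _ => hgM p hp h⟩
    · exact ⟨fun hm => absurd hm (hR p ⟨hp, h⟩), fun hm => absurd hm (not_le.2 h)⟩
  · exfalso
    have hcl : (x₀, y₀) ∈ closure (interior D.M) := by
      rw [D.closure_interior]; exact isClosed.frontier_subset hp0f
    obtain ⟨q, hq, hqi⟩ := mem_closure_iff.1 hcl _ hopen hp0
    have hqf : q ∉ frontier D.M := fun h => h.2 hqi
    rcases lt_trichotomy q.1 (γ q.2) with h | h | h
    exacts [hL q ⟨hq, h⟩ (interior_subset hqi), hqf (hgraph q hq h),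
      hR q ⟨hq, h⟩ (interior_subset hqi)]

end SegRegion

namespace SegRegion

variable {S : Type} {D : SegRegion S}

/-! ### The two types of sides -/

theorem continuous_bend {s₁ s₂ : S} {y₀ : ℝ} (h : D.xs s₁ y₀ = D.xs s₂ y₀) :
    Continuous (D.bend s₁ s₂ y₀) := by
  unfold bend
  exact Continuous.if_le (continuous_xs _) (continuous_xs _) continuous_id continuous_const
    (by rintro x rfl; exact h)

theorem eventually_HL_of_box {x₀ y₀ r : ℝ} {γ : ℝ → ℝ} (hγ : Continuous γ) (h₀ : γ y₀ = x₀)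
    (hr : 0 < r) (h : ∀ p ∈ box x₀ y₀ r, p ∈ D.M ↔ γ p.2 ≤ p.1) :
    ∀ᶠ y in 𝓝 y₀, D.HL (γ y) y := by
  have h1 : ∀ᶠ y in 𝓝 y₀, |γ y - x₀| < r := by
    have h := (hγ.sub (continuous_const (y := x₀))).abs.tendsto y₀
    have := h.eventually_lt_const (u := r) (by simpa [h₀] using hr)
    exact this
  have h2 : ∀ᶠ y in 𝓝 y₀, |y - y₀| < r := by
    have := Metric.ball_mem_nhds y₀ hr
    filter_upwards [this] with y hy
    rwa [Metric.mem_ball, Real.dist_eq] at hy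
  filter_upwards [h1, h2] with y hy1 hy2
  refine ⟨r - |γ y - x₀|, by linarith, fun z hz => h (z, y) ⟨?_, hy2⟩⟩
  calc |z - x₀| ≤ |z - γ y| + |γ y - x₀| := abs_sub_le _ _ _
    _ < r := by linarith

theorem eventually_HR_of_box {x₀ y₀ r : ℝ} {γ : ℝ → ℝ} (hγ : Continuous γ) (h₀ : γ y₀ = x₀)
    (hr : 0 < r) (h : ∀ p ∈ box x₀ y₀ r, p ∈ D.M ↔ p.1 ≤ γ p.2) :
    ∀ᶠ y in 𝓝 y₀, D.HR (γ y) y := by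
  have h1 : ∀ᶠ y in 𝓝 y₀, |γ y - x₀| < r := by
    have h := (hγ.sub (continuous_const (y := x₀))).abs.tendsto y₀
    have := h.eventually_lt_const (u := r) (by simpa [h₀] using hr)
    exact this
  have h2 : ∀ᶠ y in 𝓝 y₀, |y - y₀| < r := by
    have := Metric.ball_mem_nhds y₀ hr
    filter_upwards [this] with y hy
    rwa [Metric.mem_ball, Real.dist_eq] at hy
  filter_upwards [h1, h2] with y hy1 hy2
  refine ⟨r - |γ y - x₀|, by linarith, fun z hz => h (z, y) ⟨?_, hy2⟩⟩
  calc |z - x₀| ≤ |z - γ y| + |γ y - x₀| := abs_sub_le _ _ _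
    _ < r := by linarith

theorem eventually_HL_or_HR [Finite S] {s₁ s₂ : S} {x₀ y₀ : ℝ}
    (h1 : y₀ ∈ Ioc (D.lo s₁) (D.hi s₁)) (h2 : y₀ ∈ Ico (D.lo s₂) (D.hi s₂))
    (hx1 : D.xs s₁ y₀ = x₀) (hx2 : D.xs s₂ y₀ = x₀)
    (hc : s₁ = s₂ ∨ D.hi s₁ = y₀ ∧ D.lo s₂ = y₀)
    (hall : ∀ t, y₀ ∈ Icc (D.lo t) (D.hi t) → D.xs t y₀ = x₀ → t = s₁ ∨ t = s₂) :
    (∀ᶠ y in 𝓝 y₀, D.HL (D.bend s₁ s₂ y₀ y) y) ∨ ∀ᶠ y in 𝓝 y₀, D.HR (D.bend s₁ s₂ y₀ y) y := by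
  have hγ := continuous_bend (D := D) (hx1.trans hx2.symm)
  have h0 : D.bend s₁ s₂ y₀ y₀ = x₀ := by rw [bend, if_pos le_rfl, hx1]
  obtain ⟨r, hr, h | h⟩ := passing h1 h2 hx1 hx2 hc hall
  · exact Or.inl (eventually_HL_of_box hγ h0 hr h)
  · exact Or.inr (eventually_HR_of_box hγ h0 hr h)

theorem isL_or_isR [Finite S] (s : S) : D.IsL s ∨ D.IsR s := by
  have hb : ∀ y₀, D.bend s s y₀ = D.xs s := by intro y₀; funext y; simp [bend]
  have key : ∀ y₀ ∈ Ioo (D.lo s) (D.hi s), (∀ᶠ y in 𝓝 y₀, D.HL (D.xs s y) y) ∨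
      ∀ᶠ y in 𝓝 y₀, D.HR (D.xs s y) y := by
    intro y₀ hy
    have := eventually_HL_or_HR (D := D) (s₁ := s) (s₂ := s) ⟨hy.1, hy.2.le⟩ ⟨hy.1.le, hy.2⟩ rfl
      rfl (Or.inl rfl) (fun t ht h => Or.inl (eq_of_xs_eq hy ht h.symm).symm)
    rwa [hb] at this
  rcases isPreconnected_Ioo.subset_or_subset (s := Ioo (D.lo s) (D.hi s))
    (u := {y₀ | ∀ᶠ y in 𝓝 y₀, D.HL (D.xs s y) y}) (v := {y₀ | ∀ᶠ y in 𝓝 y₀, D.HR (D.xs s y) y})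
    isOpen_setOfPred_eventually_nhds isOpen_setOfPred_eventually_nhds
    (Set.disjoint_left.2 fun y h1 h2 => (Eventually.self_of_nhds h1).not_HR h2.self_of_nhds)
    (fun y hy => key y hy) with h | h
  · exact Or.inl fun y hy => (h hy).self_of_nhds
  · exact Or.inr fun y hy => (h hy).self_of_nhds

theorem exists_mem_Ioo (s : S) : ∃ y, y ∈ Ioo (D.lo s) (D.hi s) := exists_between (lo_lt_hi s)

theorem IsL.not_isR {s : S} (h : D.IsL s) : ¬ D.IsR s := by
  obtain ⟨y, hy⟩ := exists_mem_Ioo (D := D) s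
  exact fun h' => (h y hy).not_HR (h' y hy)

theorem isL_of_HL [Finite S] {s : S} {y : ℝ} (hy : y ∈ Ioo (D.lo s) (D.hi s))
    (h : D.HL (D.xs s y) y) : D.IsL s :=
  (isL_or_isR s).resolve_right fun h' => h.not_HR (h' y hy)

theorem isR_of_HR [Finite S] {s : S} {y : ℝ} (hy : y ∈ Ioo (D.lo s) (D.hi s))
    (h : D.HR (D.xs s y) y) : D.IsR s :=
  (isL_or_isR s).resolve_left fun h' => (h' y hy).not_HR h

/-! ### The three types of vertices -/

variable (D) in
/-- A regular vertex: the boundary curve passes it from below to above. -/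
def Reg (v : S) : Prop := ∃ s₁ s₂, D.Inc s₁ v ∧ D.Inc s₂ v ∧ D.hi s₁ = D.η v ∧ D.lo s₂ = D.η v

variable (D) in
/-- Both sides at the vertex go up. -/
def Up (v : S) : Prop := ∀ s, D.Inc s v → D.lo s = D.η v

variable (D) in
/-- Both sides at the vertex go down. -/
def Down (v : S) : Prop := ∀ s, D.Inc s v → D.hi s = D.η v

variable (D) in
/-- The fiber through the vertex extends to the left of the vertex. -/
def Lft (v : S) : Prop := ∃ x < D.c v, D.Horiz x (D.c v) (D.η v)

@[simp] theorem flip_up {v : S} : D.flip.Up v ↔ D.Down v := by simp [Up, Down]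
@[simp] theorem flip_down {v : S} : D.flip.Down v ↔ D.Up v := by simp [Up, Down]
@[simp] theorem flip_lft {v : S} : D.flip.Lft v ↔ D.Lft v := by simp [Lft]
@[simp] theorem flip_reg {v : S} : D.flip.Reg v ↔ D.Reg v := by
  simp only [Reg, flip_inc, flip_hi, flip_lo, flip_η, neg_inj]
  constructor
  · rintro ⟨a, b, h1, h2, h3, h4⟩; exact ⟨b, a, h2, h1, h4, h3⟩
  · rintro ⟨a, b, h1, h2, h3, h4⟩; exact ⟨b, a, h2, h1, h4, h3⟩

theorem inc_iff {s v : S} : D.Inc s v ↔ s = v ∨ s = D.next.symm v := by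
  rw [Inc, Equiv.eq_symm_apply]

theorem prev_ne (v : S) : D.next.symm v ≠ v := fun h =>
  D.next_ne v (by conv_lhs => rw [← h]; simp)

theorem Inc.eq_or_eq {s t u v : S} (hs : D.Inc s v) (ht : D.Inc t v) (hst : s ≠ t)
    (hu : D.Inc u v) : u = s ∨ u = t := by
  rw [inc_iff] at hs ht hu
  grind

theorem exists_inc_pair (v : S) : ∃ s t, s ≠ t ∧ D.Inc s v ∧ D.Inc t v :=
  ⟨v, D.next.symm v, (prev_ne v).symm, inc_iff.2 (Or.inl rfl), inc_iff.2 (Or.inr rfl)⟩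

theorem reg_or_up_or_down (v : S) : D.Reg v ∨ D.Up v ∨ D.Down v := by
  obtain ⟨s, t, hst, hs, ht⟩ := exists_inc_pair (D := D) v
  rcases hs.eq_lo_or_hi with h1 | h1 <;> rcases ht.eq_lo_or_hi with h2 | h2
  · right; left; intro u hu
    rcases hs.eq_or_eq ht hst hu with rfl | rfl
    exacts [h1.symm, h2.symm]
  · left; exact ⟨t, s, ht, hs, h2.symm, h1.symm⟩
  · left; exact ⟨s, t, hs, ht, h1.symm, h2.symm⟩
  · right; right; intro u hu
    rcases hs.eq_or_eq ht hst hu with rfl | rfl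
    exacts [h1.symm, h2.symm]

theorem xs_eq_of_inc {s v : S} (h : D.Inc s v) (y : ℝ) :
    D.xs s y = D.c v + D.slope s * (y - D.η v) := by
  rw [← h.xs_eq]; simp only [xs]; ring

theorem HL.not_lft {v : S} (h : D.HL (D.c v) (D.η v)) : ¬ D.Lft v := fun ⟨_, hx, hh⟩ =>
  h.not_horiz hx hh

theorem HR.lft {v : S} (h : D.HR (D.c v) (D.η v)) : D.Lft v := by
  obtain ⟨r, hr, h⟩ := h
  refine ⟨D.c v - r / 2, by linarith, fun z hz => ?_⟩
  rw [uIcc_of_le (by linarith)] at hz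
  exact (h z (by rw [abs_sub_comm, abs_of_nonneg] <;> linarith [hz.1, hz.2])).2 hz.2

/-- At a regular vertex the region stays on the same side of the boundary curve. -/
theorem reg_types [Finite S] {s₁ s₂ v : S} (h1 : D.Inc s₁ v) (h2 : D.Inc s₂ v)
    (hhi : D.hi s₁ = D.η v) (hlo : D.lo s₂ = D.η v) :
    D.IsL s₁ ∧ D.IsL s₂ ∧ D.HL (D.c v) (D.η v) ∨ D.IsR s₁ ∧ D.IsR s₂ ∧ D.HR (D.c v) (D.η v) := by
  have l1 := lo_lt_hi (D := D) s₁
  have l2 := lo_lt_hi (D := D) s₂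
  have hne : s₁ ≠ s₂ := by rintro rfl; exact l1.ne (hlo.trans hhi.symm)
  have hev : ∀ᶠ y in 𝓝[<] D.η v, y ∈ Ioo (D.lo s₁) (D.hi s₁) := by
    rw [hhi]; exact Ioo_mem_nhdsLT (by rwa [← hhi])
  have hev2 : ∀ᶠ y in 𝓝[>] D.η v, y ∈ Ioo (D.lo s₂) (D.hi s₂) := by
    rw [hlo]; exact Ioo_mem_nhdsGT (by rwa [← hlo])
  have hb : ∀ y < D.η v, D.bend s₁ s₂ (D.η v) y = D.xs s₁ y := fun y hy => if_pos hy.le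
  have hb2 : ∀ y > D.η v, D.bend s₁ s₂ (D.η v) y = D.xs s₂ y := fun y hy => if_neg hy.not_ge
  have hb3 : D.bend s₁ s₂ (D.η v) (D.η v) = D.c v := (if_pos le_rfl).trans h1.xs_eq
  rcases eventually_HL_or_HR (D := D) (s₁ := s₁) (s₂ := s₂) ⟨by rwa [← hhi], hhi.ge⟩
    ⟨hlo.le, by rwa [← hlo]⟩ h1.xs_eq h2.xs_eq (Or.inr ⟨hhi, hlo⟩)
    (fun t ht h => h1.eq_or_eq h2 hne (inc_of_xs_eq ht h)) with h | h
  · obtain ⟨y, hy1, hy2, hy3⟩ := ((h.filter_mono nhdsWithin_le_nhds).and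
      (hev.and self_mem_nhdsWithin)).exists
    obtain ⟨z, hz1, hz2, hz3⟩ := ((h.filter_mono nhdsWithin_le_nhds).and
      (hev2.and self_mem_nhdsWithin)).exists
    rw [hb _ hy3] at hy1
    rw [hb2 _ hz3] at hz1
    exact Or.inl ⟨isL_of_HL hy2 hy1, isL_of_HL hz2 hz1, hb3 ▸ h.self_of_nhds⟩
  · obtain ⟨y, hy1, hy2, hy3⟩ := ((h.filter_mono nhdsWithin_le_nhds).and
      (hev.and self_mem_nhdsWithin)).exists
    obtain ⟨z, hz1, hz2, hz3⟩ := ((h.filter_mono nhdsWithin_le_nhds).and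
      (hev2.and self_mem_nhdsWithin)).exists
    rw [hb _ hy3] at hy1
    rw [hb2 _ hz3] at hz1
    exact Or.inr ⟨isR_of_HR hy2 hy1, isR_of_HR hz2 hz1, hb3 ▸ h.self_of_nhds⟩

theorem HL.mem_right {x y : ℝ} (h : D.HL x y) : ∀ᶠ z in 𝓝[>] x, (z, y) ∈ D.M := by
  obtain ⟨r, hr, h⟩ := h
  filter_upwards [Ioo_mem_nhdsGT (show x < x + r by linarith)] with z hz
  exact (h z (by rw [abs_of_pos] <;> linarith [hz.1, hz.2])).2 hz.1.le

theorem HL.notMem_left {x y : ℝ} (h : D.HL x y) : ∀ᶠ z in 𝓝[<] x, (z, y) ∉ D.M := by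
  obtain ⟨r, hr, h⟩ := h
  filter_upwards [Ioo_mem_nhdsLT (show x - r < x by linarith)] with z hz
  intro hm
  exact absurd ((h z (by rw [abs_sub_comm, abs_of_pos] <;> linarith [hz.1, hz.2])).1 hm)
    (not_le.2 hz.2)

theorem HR.mem_left {x y : ℝ} (h : D.HR x y) : ∀ᶠ z in 𝓝[<] x, (z, y) ∈ D.M := by
  obtain ⟨r, hr, h⟩ := h
  filter_upwards [Ioo_mem_nhdsLT (show x - r < x by linarith)] with z hz
  exact (h z (by rw [abs_sub_comm, abs_of_pos] <;> linarith [hz.1, hz.2])).2 hz.2.le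

theorem HR.notMem_right {x y : ℝ} (h : D.HR x y) : ∀ᶠ z in 𝓝[>] x, (z, y) ∉ D.M := by
  obtain ⟨r, hr, h⟩ := h
  filter_upwards [Ioo_mem_nhdsGT (show x < x + r by linarith)] with z hz
  intro hm
  exact absurd ((h z (by rw [abs_of_pos] <;> linarith [hz.1, hz.2])).1 hm) (not_le.2 hz.1)

/-- At a vertex whose two sides go up, the region lies either between the two sides, and then its
fiber does not extend to the left, or outside of them. -/
theorem up_types [Finite S] {s₁ s₂ v : S} (h1 : D.Inc s₁ v) (h2 : D.Inc s₂ v)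
    (hlo1 : D.lo s₁ = D.η v) (hlo2 : D.lo s₂ = D.η v) (hsl : D.slope s₁ < D.slope s₂) :
    D.IsL s₁ ∧ D.IsR s₂ ∧ ¬ D.Lft v ∨ D.IsR s₁ ∧ D.IsL s₂ := by
  have l1 := lo_lt_hi (D := D) s₁
  have l2 := lo_lt_hi (D := D) s₂
  have hne : s₁ ≠ s₂ := by rintro rfl; exact lt_irrefl _ hsl
  obtain ⟨r, hr, hbox⟩ := exists_box (D := D) (D.c v) (D.η v)
  have hfr : ∀ p ∈ box (D.c v) (D.η v) r, p ∈ frontier D.M →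
      D.η v ≤ p.2 ∧ (p.1 = D.xs s₁ p.2 ∨ p.1 = D.xs s₂ p.2) := by
    intro p hp hf
    obtain ⟨s, hs, hsx⟩ := mem_frontier.1 hf
    obtain ⟨ha, hb⟩ := hbox p hp s hs hsx
    rcases h1.eq_or_eq h2 hne (inc_of_xs_eq ha hb.symm) with rfl | rfl
    · exact ⟨hlo1 ▸ hs.1, Or.inl hsx⟩
    · exact ⟨hlo2 ▸ hs.1, Or.inr hsx⟩
  have hlt : ∀ y, D.η v < y → D.xs s₁ y < D.xs s₂ y := by
    intro y hy
    rw [xs_eq_of_inc h1, xs_eq_of_inc h2]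
    nlinarith
  have hle : ∀ y, y ≤ D.η v → D.xs s₂ y ≤ D.xs s₁ y := by
    intro y hy
    rw [xs_eq_of_inc h1, xs_eq_of_inc h2]
    nlinarith
  -- a level just above the vertex
  have hnear : ∀ s, D.Inc s v → ∀ᶠ y in 𝓝[>] D.η v, |D.xs s y - D.c v| < r := by
    intro s hs
    have : Tendsto (fun y => |D.xs s y - D.c v|) (𝓝 (D.η v)) (𝓝 0) := by
      have h := ((continuous_xs (D := D) s).sub (continuous_const (y := D.c v))).abs.tendsto (D.η v)
      simpa [hs.xs_eq] using h
    exact (this.mono_left nhdsWithin_le_nhds).eventually_lt_const hr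
  have habove : ∀ b, D.η v < b → ∀ᶠ y in 𝓝[>] D.η v, y ∈ Ioo (D.η v) b := fun b hb =>
    Ioo_mem_nhdsGT hb
  obtain ⟨y, hy1, hy2, hyr, hya, hyb⟩ := ((hnear s₁ h1).and ((hnear s₂ h2).and
    ((habove (D.η v + r) (by linarith)).and ((habove (D.hi s₁) (hlo1 ▸ l1)).and
      (habove (D.hi s₂) (hlo2 ▸ l2)))))).exists
  have hyr' : |y - D.η v| < r := by rw [abs_of_pos] <;> linarith [hyr.1, hyr.2]
  have hlty := hlt y hyr.1
  rw [← hlo1] at hya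
  rw [← hlo2] at hyb
  rw [abs_lt] at hy1 hy2
  have hin : IsPreconnected (box (D.c v) (D.η v) r ∩ {p | D.xs s₁ p.2 < p.1} ∩
      {p | p.1 < D.xs s₂ p.2}) :=
    (((convex_box _ _ _).inter (convex_right _)).inter (convex_left _)).isPreconnected
  have hmem : ∀ x ∈ Ioo (D.xs s₁ y) (D.xs s₂ y), (x, y) ∈ box (D.c v) (D.η v) r ∩
      {p | D.xs s₁ p.2 < p.1} ∩ {p | p.1 < D.xs s₂ p.2} := by
    intro x hx
    refine ⟨⟨⟨?_, hyr'⟩, hx.1⟩, hx.2⟩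
    rw [abs_lt]; constructor <;> simp only <;> linarith [hx.1, hx.2]
  rcases subset_or_disjoint hin fun p hp hf => by
      rcases (hfr p hp.1.1 hf).2 with h | h
      · exact absurd hp.1.2 (by simp [h])
      · exact absurd hp.2 (by simp [h]) with h | h
  · left
    have hL : D.IsL s₁ := (isL_or_isR s₁).resolve_right fun hR => by
      obtain ⟨x, hx1, hx2⟩ := ((hR y hya).notMem_right.and (Ioo_mem_nhdsGT hlty)).exists
      exact hx1 (h _ (hmem x hx2))
    have hR : D.IsR s₂ := (isL_or_isR s₂).resolve_left fun hL => by
      obtain ⟨x, hx1, hx2⟩ := ((hL y hyb).notMem_left.and (Ioo_mem_nhdsLT hlty)).exists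
      exact hx1 (h _ (hmem x hx2))
    refine ⟨hL, hR, ?_⟩
    have hout : IsPreconnected (box (D.c v) (D.η v) r ∩ {p | D.η v ≤ p.2} ∩
        {p | p.1 < D.xs s₁ p.2}) :=
      (((convex_box _ _ _).inter (convex_above _)).inter (convex_left _)).isPreconnected
    rcases subset_or_disjoint hout fun p hp hf => by
        have h3 : p.1 < D.xs s₁ p.2 := hp.2
        have h4 : D.xs s₁ p.2 ≤ D.xs s₂ p.2 := by
          rcases (show D.η v ≤ p.2 from hp.1.2).eq_or_lt with h | h
          · rw [← h, h1.xs_eq, h2.xs_eq]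
          · exact (hlt _ h).le
        rcases (hfr p hp.1.1 hf).2 with h | h <;> linarith with h' | h'
    · exfalso
      obtain ⟨x, hx1, hx2⟩ := ((hL y hya).notMem_left.and
        (Ioo_mem_nhdsLT (show D.c v - r < D.xs s₁ y by linarith))).exists
      refine hx1 (h' _ ⟨⟨⟨?_, hyr'⟩, hyr.1.le⟩, hx2.2⟩)
      rw [abs_lt]; constructor <;> simp only <;> linarith [hx2.1, hx2.2]
    · rintro ⟨x, hx, hh⟩
      have hm : max x (D.c v - r / 2) < D.c v := max_lt hx (by linarith)
      refine h' (max x (D.c v - r / 2), D.η v) ⟨⟨⟨?_, by simpa using hr⟩, le_refl (D.η v)⟩, ?_⟩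
        (hh _ (mem_uIcc.2 (Or.inl ⟨le_max_left _ _, hm.le⟩)))
      · rw [abs_sub_comm, abs_of_pos] <;> simp only <;>
          linarith [le_max_right x (D.c v - r / 2)]
      · show max x (D.c v - r / 2) < D.xs s₁ (D.η v)
        rwa [h1.xs_eq]
  · right
    constructor
    · exact (isL_or_isR s₁).resolve_left fun hL => by
        obtain ⟨x, hx1, hx2⟩ := ((hL y hya).mem_right.and (Ioo_mem_nhdsGT hlty)).exists
        exact h _ (hmem x hx2) hx1
    · exact (isL_or_isR s₂).resolve_right fun hR => by
        obtain ⟨x, hx1, hx2⟩ := ((hR y hyb).mem_left.and (Ioo_mem_nhdsLT hlty)).exists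
        exact h _ (hmem x hx2) hx1

theorem slope_ne_of_up {s₁ s₂ v : S} (h1 : D.Inc s₁ v) (h2 : D.Inc s₂ v) (hne : s₁ ≠ s₂)
    (hlo1 : D.lo s₁ = D.η v) (hlo2 : D.lo s₂ = D.η v) : D.slope s₁ ≠ D.slope s₂ := by
  intro h
  have l1 := lo_lt_hi (D := D) s₁
  have l2 := lo_lt_hi (D := D) s₂
  obtain ⟨y, hy1, hy2⟩ := exists_between (lt_min (hlo1 ▸ l1) (hlo2 ▸ l2))
  rw [lt_min_iff] at hy2
  refine hne (eq_of_xs_eq (y := y) ⟨by rwa [hlo1], hy2.1⟩ ⟨by rw [hlo2]; exact hy1.le, hy2.2.le⟩ ?_)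
  rw [xs_eq_of_inc h1, xs_eq_of_inc h2, h]

/-- The two sides at a vertex of type `Up`, in the order from left to right. -/
theorem Up.exists_pair {v : S} (h : D.Up v) : ∃ s₁ s₂, D.Inc s₁ v ∧ D.Inc s₂ v ∧
    D.slope s₁ < D.slope s₂ := by
  obtain ⟨s, t, hst, hs, ht⟩ := exists_inc_pair (D := D) v
  rcases lt_or_gt_of_ne (slope_ne_of_up hs ht hst (h s hs) (h t ht)) with h | h
  · exact ⟨s, t, hs, ht, h⟩
  · exact ⟨t, s, ht, hs, h⟩

/-! ### Left ends of fibers -/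

/-- A fiber has a left end, and this lies on the frontier. -/
theorem exists_left_end {x y : ℝ} (h : (x, y) ∈ D.M) : ∃ l ≤ x, D.Horiz l x y ∧
    (l, y) ∈ frontier D.M ∧ ∀ z < l, ¬ D.Horiz z x y := by
  set T := {z | z ≤ x ∧ D.Horiz z x y} with hT
  have hx : x ∈ T := ⟨le_rfl, by simpa [Horiz] using h⟩
  have hTM : ∀ z ∈ T, (z, y) ∈ D.M := fun z hz => hz.2 z left_mem_uIcc
  have hbdd : BddBelow T := by
    obtain ⟨b, hb⟩ := (D.isCompact.image continuous_fst).bddBelow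
    exact ⟨b, fun z hz => hb ⟨_, hTM z hz, rfl⟩⟩
  set l := sInf T with hl
  have hlx : l ≤ x := csInf_le hbdd hx
  have hIoc : ∀ z ∈ Ioc l x, (z, y) ∈ D.M := by
    intro z hz
    obtain ⟨w, hw, hwz⟩ := exists_lt_of_csInf_lt ⟨x, hx⟩ hz.1
    exact hw.2 z (mem_uIcc.2 (Or.inl ⟨hwz.le, hz.2⟩))
  have hlM : (l, y) ∈ D.M := by
    rcases hlx.eq_or_lt with h' | h'
    · rw [h']; exact h
    · have : (l, y) ∈ closure D.M := by
        have h1 : l ∈ closure (Ioc l x) := by rw [closure_Ioc h'.ne]; exact left_mem_Icc.2 hlx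
        exact map_mem_closure (f := fun z => (z, y)) (by fun_prop) h1 hIoc
      rwa [isClosed.closure_eq] at this
  have hlH : D.Horiz l x y := by
    intro z hz
    rw [uIcc_of_le hlx] at hz
    rcases hz.1.eq_or_lt with h' | h'
    · rw [← h']; exact hlM
    · exact hIoc z ⟨h', hz.2⟩
  have hlast : ∀ z < l, ¬ D.Horiz z x y := fun z hz hh =>
    absurd (csInf_le hbdd ⟨hz.le.trans hlx, hh⟩) (not_le.2 hz)
  refine ⟨l, hlx, hlH, ?_, hlast⟩
  rw [isClosed.frontier_eq]
  refine ⟨hlM, fun hi => ?_⟩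
  have : ∀ᶠ z in 𝓝 l, (z, y) ∈ D.M := by
    have := (show Continuous fun z : ℝ => (z, y) by fun_prop).tendsto l
    exact this (mem_interior_iff_mem_nhds.1 hi)
  obtain ⟨e, he, hb⟩ := Metric.eventually_nhds_iff.1 this
  refine hlast (l - e / 2) (by linarith) fun z hz => ?_
  rw [uIcc_of_le (by linarith)] at hz
  rcases le_total l z with h' | h'
  · exact hlH z (mem_uIcc.2 (Or.inl ⟨h', hz.2⟩))
  · exact hb (by rw [Real.dist_eq, abs_sub_comm, abs_of_nonneg] <;> linarith [hz.1])

theorem Horiz.trans {x x' x'' y : ℝ} (h1 : D.Horiz x x' y) (h2 : D.Horiz x' x'' y) :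
    D.Horiz x x'' y := fun z hz => by
  rcases uIcc_subset_uIcc_union_uIcc hz with h | h
  exacts [h1 z h, h2 z h]

theorem Horiz.symm {x x' y : ℝ} (h : D.Horiz x x' y) : D.Horiz x' x y := by
  unfold Horiz; rw [uIcc_comm]; exact h

theorem Horiz.mono {x x' z z' y : ℝ} (h : D.Horiz x x' y) (hz : z ∈ uIcc x x')
    (hz' : z' ∈ uIcc x x') : D.Horiz z z' y := fun w hw => h w (uIcc_subset_uIcc hz hz' hw)

/-- The left end of a fiber is a vertex or an inner point of a side with the region to its
right. -/
theorem exists_isL_or_vertex [Finite S] {x y : ℝ} (h : (x, y) ∈ D.M) : ∃ l ≤ x, D.Horiz l x y ∧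
    (∀ z < l, ¬ D.Horiz z x y) ∧ ((∃ v, D.η v = y ∧ D.c v = l) ∨
      ∃ t, y ∈ Ioo (D.lo t) (D.hi t) ∧ D.xs t y = l ∧ D.IsL t) := by
  obtain ⟨l, hlx, hH, hf, hlast⟩ := exists_left_end h
  refine ⟨l, hlx, hH, hlast, ?_⟩
  obtain ⟨t, ht, rfl⟩ := mem_frontier.1 hf
  rcases ht.1.eq_or_lt with h1 | h1
  · obtain ⟨v, hv, h2⟩ := exists_inc_lo (D := D) t
    have h3 : D.η v = y := h2.trans h1
    exact Or.inl ⟨v, h3, by rw [← h3, hv.xs_eq]⟩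
  rcases ht.2.eq_or_lt with h2 | h2
  · obtain ⟨v, hv, h2'⟩ := exists_inc_hi (D := D) t
    have h3 : D.η v = y := h2'.trans h2.symm
    exact Or.inl ⟨v, h3, by rw [← h3, hv.xs_eq]⟩
  refine Or.inr ⟨t, ⟨h1, h2⟩, rfl, (isL_or_isR t).resolve_right fun hR => ?_⟩
  obtain ⟨z, hz1, hz2⟩ := ((hR y ⟨h1, h2⟩).mem_left.and self_mem_nhdsWithin).exists
  obtain ⟨r, hr, hb⟩ := hR y ⟨h1, h2⟩
  refine hlast (D.xs t y - r / 2) (by linarith) (Horiz.trans (fun z hz => ?_) hH)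
  rw [uIcc_of_le (by linarith)] at hz
  exact (hb z (by rw [abs_sub_comm, abs_of_nonneg] <;> linarith [hz.1, hz.2])).2 hz.2

/-! ### Sides that start at the fiber of a vertex -/

variable (D) in
/-- The sides with the region to their right that run upwards from the fiber of the vertex `v`. -/
def Above (v : S) : Set S :=
  {t | D.IsL t ∧ D.η v ∈ Ico (D.lo t) (D.hi t) ∧ D.Horiz (D.xs t (D.η v)) (D.c v) (D.η v)}

/-- The part of `Above v` that consists of the sides at `v` itself. -/
def AboveInc (D : SegRegion S) (v : S) : Set S := {t | D.Inc t v ∧ D.lo t = D.η v ∧ D.IsL t}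

theorem Horiz.refl {x y : ℝ} (h : (x, y) ∈ D.M) : D.Horiz x x y := by
  simpa [Horiz] using h

theorem aboveInc_subset (v : S) : D.AboveInc v ⊆ D.Above v := by
  rintro t ⟨h1, h2, h3⟩
  refine ⟨h3, ⟨h2.le, h2 ▸ lo_lt_hi t⟩, ?_⟩
  rw [h1.xs_eq]; exact Horiz.refl (pt_mem v)

theorem xs_lt_of_mem_above {t v : S} (h : t ∈ D.Above v) (hn : t ∉ D.AboveInc v) :
    D.η v ∈ Ioo (D.lo t) (D.hi t) ∧ D.xs t (D.η v) < D.c v := by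
  obtain ⟨h1, h2, h3⟩ := h
  have hinc : ¬ D.Inc t v := fun hi => by
    rcases hi.eq_lo_or_hi with h | h
    · exact hn ⟨hi, h.symm, h1⟩
    · exact h2.2.ne h
  have hlt : D.η v ∈ Ioo (D.lo t) (D.hi t) := by
    refine ⟨lt_of_le_of_ne h2.1 fun h => ?_, h2.2⟩
    obtain ⟨w, hw, hw'⟩ := exists_inc_lo (D := D) t
    exact hinc (η_injective (hw'.trans h) ▸ hw)
  refine ⟨hlt, ?_⟩
  rcases lt_trichotomy (D.xs t (D.η v)) (D.c v) with h | h | h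
  · exact h
  · exact absurd h (xs_ne_of_mem_Ioo hlt)
  · exact absurd h3.symm ((h1 _ hlt).not_horiz h)

theorem above_eq_of_not_lft {v : S} (h : ¬ D.Lft v) : D.Above v = D.AboveInc v := by
  refine Subset.antisymm (fun t ht => ?_) (aboveInc_subset v)
  by_contra hn
  exact h ⟨_, (xs_lt_of_mem_above ht hn).2, ht.2.2⟩

/-- If the fiber of `v` extends to the left of `v`, then besides sides at `v` itself exactly one side
runs upwards from the fiber with the region to its right, namely the one at the left end. -/
theorem above_eq_of_lft [Finite S] {v : S} (h : D.Lft v) :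
    ∃ t, t ∉ D.AboveInc v ∧ D.Above v = insert t (D.AboveInc v) := by
  obtain ⟨l, hl, hH, hlast, hl'⟩ := exists_isL_or_vertex (pt_mem (D := D) v)
  obtain ⟨x, hx, hxH⟩ := h
  have hlt : l < D.c v := lt_of_le_of_lt (not_lt.1 fun h => hlast x h hxH) hx
  rcases hl' with ⟨w, hw, rfl⟩ | ⟨t, ht, rfl, hL⟩
  · rw [η_injective hw] at hlt; exact absurd hlt (lt_irrefl _)
  refine ⟨t, fun hi => hi.1.notMem_Ioo ht, Subset.antisymm (fun u hu => ?_) ?_⟩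
  · by_cases hn : u ∈ D.AboveInc v
    · exact Or.inr hn
    left
    obtain ⟨h1, h2⟩ := xs_lt_of_mem_above hu hn
    refine eq_of_xs_eq h1 (Ioo_subset_Icc_self ht) (le_antisymm ?_ ?_)
    · by_contra hlt'
      rw [not_le] at hlt'
      exact (hu.1 _ h1).not_horiz hlt'
        (hH.mono left_mem_uIcc (mem_uIcc.2 (Or.inl ⟨hlt'.le, h2.le⟩)))
    · by_contra hlt'
      rw [not_le] at hlt'
      exact hlast _ hlt' hu.2.2
  · rintro u (rfl | hu)
    · exact ⟨hL, ⟨ht.1.le, ht.2⟩, hH⟩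
    · exact aboveInc_subset v hu

theorem Down.aboveInc_eq {v : S} (h : D.Down v) : D.AboveInc v = ∅ := by
  ext t
  simp only [mem_empty_iff_false, iff_false]
  rintro ⟨h1, h2, -⟩
  exact (lo_lt_hi t).ne (h2.trans (h t h1).symm)

theorem Up.exists_aboveInc_eq [Finite S] {v : S} (h : D.Up v) : ∃ t, D.AboveInc v = {t} := by
  obtain ⟨s₁, s₂, h1, h2, hs⟩ := h.exists_pair
  have hne : s₁ ≠ s₂ := by rintro rfl; exact lt_irrefl _ hs
  rcases up_types h1 h2 (h _ h1) (h _ h2) hs with ⟨hL, hR, -⟩ | ⟨hR, hL⟩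
  · refine ⟨s₁, Subset.antisymm ?_ (singleton_subset_iff.2 ⟨h1, h _ h1, hL⟩)⟩
    rintro t ⟨ht, -, htL⟩
    rcases h1.eq_or_eq h2 hne ht with rfl | rfl
    · rfl
    · exact absurd hR htL.not_isR
  · refine ⟨s₂, Subset.antisymm ?_ (singleton_subset_iff.2 ⟨h2, h _ h2, hL⟩)⟩
    rintro t ⟨ht, -, htL⟩
    rcases h1.eq_or_eq h2 hne ht with rfl | rfl
    · exact absurd hR htL.not_isR
    · rfl

theorem ncard_above_reg [Finite S] {v : S} (h : D.Reg v) : (D.Above v).ncard = 1 := by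
  obtain ⟨s₁, s₂, h1, h2, h3, h4⟩ := h
  have hne : s₁ ≠ s₂ := by rintro rfl; exact (lo_lt_hi s₁).ne (h4.trans h3.symm)
  have key : ∀ t, D.Inc t v → D.lo t = D.η v → t = s₂ := by
    intro t ht hlo
    rcases h1.eq_or_eq h2 hne ht with rfl | rfl
    · exact absurd (hlo.trans h3.symm) (lo_lt_hi t).ne
    · rfl
  rcases reg_types h1 h2 h3 h4 with ⟨-, hL, hH⟩ | ⟨-, hR, hH⟩
  · rw [above_eq_of_not_lft hH.not_lft, ncard_eq_one]
    refine ⟨s₂, Subset.antisymm (fun t ht => key t ht.1 ht.2.1) ?_⟩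
    exact singleton_subset_iff.2 ⟨h2, h4, hL⟩
  · obtain ⟨t, ht, h⟩ := above_eq_of_lft hH.lft
    have : D.AboveInc v = ∅ := by
      ext u
      simp only [mem_empty_iff_false, iff_false]
      rintro ⟨h1, h2, h3⟩
      exact (key u h1 h2 ▸ h3).not_isR hR
    rw [h, this]; simp

open Classical in
theorem ncard_above_up [Finite S] {v : S} (h : D.Up v) :
    (D.Above v).ncard = (if D.Lft v then 1 else 0) + 1 := by
  obtain ⟨s, hs⟩ := h.exists_aboveInc_eq
  split_ifs with hl
  · obtain ⟨t, ht, h⟩ := above_eq_of_lft hl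
    rw [h, ncard_insert_of_notMem ht, hs]; simp
  · rw [above_eq_of_not_lft hl, hs]; simp

open Classical in
theorem ncard_above_down [Finite S] {v : S} (h : D.Down v) :
    (D.Above v).ncard = if D.Lft v then 1 else 0 := by
  split_ifs with hl
  · obtain ⟨t, ht, h'⟩ := above_eq_of_lft hl
    rw [h', h.aboveInc_eq]; simp
  · rw [above_eq_of_not_lft hl, h.aboveInc_eq]; simp

end SegRegion

namespace SegRegion

variable {S : Type} {D : SegRegion S}

/-! ### Maximal trapezoids -/

/-- A maximal trapezoid of the region: it lies between two consecutive sides `t` and `t'`, has no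
frontier points strictly between these sides, and extends in height from a vertex `v` to a vertex
`w` that lie on its bottom and on its top. These trapezoids are the edges of the Reeb graph. -/
@[ext]
structure Trap (D : SegRegion S) where
  /-- the left side -/
  t : S
  /-- the right side -/
  t' : S
  /-- the vertex on the bottom -/
  v : S
  /-- the vertex on the top -/
  w : S
  lt : D.η v < D.η w
  lo_left : D.lo t ≤ D.η v
  lo_right : D.lo t' ≤ D.η v
  hi_left : D.η w ≤ D.hi t
  hi_right : D.η w ≤ D.hi t'
  isL : D.IsL t
  isR : D.IsR t'
  xs_lt : ∀ y ∈ Ioo (D.η v) (D.η w), D.xs t y < D.xs t' y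
  notMem_frontier : ∀ y ∈ Ioo (D.η v) (D.η w), ∀ x ∈ Ioo (D.xs t y) (D.xs t' y),
    (x, y) ∉ frontier D.M
  mem : ∀ y ∈ Icc (D.η v) (D.η w), ∀ x ∈ Icc (D.xs t y) (D.xs t' y), (x, y) ∈ D.M
  bot : D.c v ∈ Icc (D.xs t (D.η v)) (D.xs t' (D.η v))
  top : D.c w ∈ Icc (D.xs t (D.η w)) (D.xs t' (D.η w))

namespace Trap

/-- The mirror image of a trapezoid. -/
def flip (q : D.Trap) : D.flip.Trap where
  t := q.t
  t' := q.t'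
  v := q.w
  w := q.v
  lt := by simpa using q.lt
  lo_left := by simpa using q.hi_left
  lo_right := by simpa using q.hi_right
  hi_left := by simpa using q.lo_left
  hi_right := by simpa using q.lo_right
  isL := by simpa using q.isL
  isR := by simpa using q.isR
  xs_lt y hy := by
    simp only [flip_xs]; exact q.xs_lt _ ⟨by simpa [lt_neg] using hy.2, by simpa [neg_lt] using hy.1⟩
  notMem_frontier y hy x hx := by
    simp only [flip_xs] at hx
    rw [flip_frontier]
    exact q.notMem_frontier _ ⟨by simpa [lt_neg] using hy.2, by simpa [neg_lt] using hy.1⟩ x hx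
  mem y hy x hx := by
    simp only [flip_xs] at hx
    exact q.mem _ ⟨by simpa [le_neg] using hy.2, by simpa [neg_le] using hy.1⟩ x hx
  bot := by simpa using q.top
  top := by simpa using q.bot

/-- Mirror image, from the mirror image of the region. -/
def unflip (q : D.flip.Trap) : D.Trap where
  t := q.t
  t' := q.t'
  v := q.w
  w := q.v
  lt := by simpa using q.lt
  lo_left := by simpa using q.hi_left
  lo_right := by simpa using q.hi_right
  hi_left := by simpa using q.lo_left
  hi_right := by simpa using q.lo_right
  isL := by simpa using q.isL
  isR := by simpa using q.isR
  xs_lt y hy := by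
    simpa using q.xs_lt (-y) ⟨by simpa using hy.2, by simpa using hy.1⟩
  notMem_frontier y hy x hx := by
    have := q.notMem_frontier (-y) ⟨by simpa using hy.2, by simpa using hy.1⟩ x (by simpa using hx)
    simpa [flip_frontier] using this
  mem y hy x hx := by
    have := q.mem (-y) ⟨by simpa using hy.2, by simpa using hy.1⟩ x (by simpa using hx)
    simpa [flip_mem] using this
  bot := by simpa using q.top
  top := by simpa using q.bot

/-- Reflection is a bijection between the trapezoids of a region and of its mirror image. -/
def flipEquiv : D.Trap ≃ D.flip.Trap where
  toFun := flip
  invFun := unflip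
  left_inv _ := rfl
  right_inv _ := rfl

variable (q : D.Trap) {y : ℝ}

theorem mem_left (hy : y ∈ Ioo (D.η q.v) (D.η q.w)) : y ∈ Ioo (D.lo q.t) (D.hi q.t) :=
  ⟨q.lo_left.trans_lt hy.1, hy.2.trans_le q.hi_left⟩

theorem mem_right (hy : y ∈ Ioo (D.η q.v) (D.η q.w)) : y ∈ Ioo (D.lo q.t') (D.hi q.t') :=
  ⟨q.lo_right.trans_lt hy.1, hy.2.trans_le q.hi_right⟩

variable {q} in
/-- A slice of an open trapezoid is a full fiber. -/
theorem mem_of_horiz (hy : y ∈ Ioo (D.η q.v) (D.η q.w)) {x x' : ℝ}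
    (hx : x ∈ Icc (D.xs q.t y) (D.xs q.t' y)) (h : D.Horiz x x' y) :
    x' ∈ Icc (D.xs q.t y) (D.xs q.t' y) := by
  constructor
  · by_contra hlt
    rw [not_le] at hlt
    exact (q.isL _ (q.mem_left hy)).not_horiz hlt
      (h.symm.mono left_mem_uIcc (mem_uIcc.2 (Or.inl ⟨hlt.le, hx.1⟩)))
  · by_contra hlt
    rw [not_le] at hlt
    exact (q.isR _ (q.mem_right hy)).not_horiz hlt
      (h.mono (mem_uIcc.2 (Or.inl ⟨hx.2, hlt.le⟩)) right_mem_uIcc)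

variable {q} in
theorem horiz (hy : y ∈ Icc (D.η q.v) (D.η q.w)) {x x' : ℝ}
    (hx : x ∈ Icc (D.xs q.t y) (D.xs q.t' y)) (hx' : x' ∈ Icc (D.xs q.t y) (D.xs q.t' y)) :
    D.Horiz x x' y := fun z hz => q.mem y hy z (uIcc_subset_Icc hx hx' hz)

theorem vertex_notMem {u : S} (hu : D.η u ∈ Ioo (D.η q.v) (D.η q.w)) :
    D.c u ∉ Icc (D.xs q.t (D.η u)) (D.xs q.t' (D.η u)) := by
  intro h
  have hi : D.Inc u u := Or.inl rfl
  rcases h.1.eq_or_lt with h1 | h1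
  · exact xs_ne_of_mem_Ioo (q.mem_left hu) h1
  rcases h.2.eq_or_lt with h2 | h2
  · exact xs_ne_of_mem_Ioo (q.mem_right hu) h2.symm
  · exact q.notMem_frontier _ hu _ ⟨h1, h2⟩ (mem_frontier.2 ⟨u, hi.mem_Icc, hi.xs_eq.symm⟩)

theorem right_le {q₁ q₂ : D.Trap} (h : q₁.t = q₂.t) (h1 : y ∈ Ioo (D.η q₁.v) (D.η q₁.w))
    (h2 : y ∈ Ioo (D.η q₂.v) (D.η q₂.w)) : D.xs q₁.t' y ≤ D.xs q₂.t' y := by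
  by_contra hlt
  rw [not_le] at hlt
  have := q₂.xs_lt y h2
  exact q₁.notMem_frontier y h1 (D.xs q₂.t' y) ⟨h ▸ this, hlt⟩
    (mem_frontier.2 ⟨_, Ioo_subset_Icc_self (q₂.mem_right h2), rfl⟩)

theorem v_le {q₁ q₂ : D.Trap} (h : q₁.t = q₂.t) (h' : q₁.t' = q₂.t')
    (h1 : y ∈ Ioo (D.η q₁.v) (D.η q₁.w)) (h2 : y ∈ Ioo (D.η q₂.v) (D.η q₂.w)) :
    D.η q₂.v ≤ D.η q₁.v := by
  by_contra hlt
  rw [not_le] at hlt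
  exact q₁.vertex_notMem ⟨hlt, h2.1.trans h1.2⟩ (h ▸ h' ▸ q₂.bot)

theorem w_le {q₁ q₂ : D.Trap} (h : q₁.t = q₂.t) (h' : q₁.t' = q₂.t')
    (h1 : y ∈ Ioo (D.η q₁.v) (D.η q₁.w)) (h2 : y ∈ Ioo (D.η q₂.v) (D.η q₂.w)) :
    D.η q₁.w ≤ D.η q₂.w := by
  by_contra hlt
  rw [not_le] at hlt
  exact q₁.vertex_notMem ⟨h1.1.trans h2.2, hlt⟩ (h ▸ h' ▸ q₂.top)

/-- A trapezoid is determined by its left side and one level that it meets. -/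
theorem eq_of_left_eq {q₁ q₂ : D.Trap} (h : q₁.t = q₂.t) (h1 : y ∈ Ioo (D.η q₁.v) (D.η q₁.w))
    (h2 : y ∈ Ioo (D.η q₂.v) (D.η q₂.w)) : q₁ = q₂ := by
  have h' : q₁.t' = q₂.t' := eq_of_xs_eq (q₁.mem_right h1) (Ioo_subset_Icc_self (q₂.mem_right h2))
    (le_antisymm (right_le h h1 h2) (right_le h.symm h2 h1))
  have hv : q₁.v = q₂.v := η_injective (le_antisymm (v_le h.symm h'.symm h2 h1) (v_le h h' h1 h2))
  have hw : q₁.w = q₂.w := η_injective (le_antisymm (w_le h h' h1 h2) (w_le h.symm h'.symm h2 h1))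
  exact Trap.ext h h' hv hw

/-- Different open trapezoids do not share a fiber. -/
theorem eq_of_horiz {q₁ q₂ : D.Trap} {x₁ x₂ : ℝ} (h1 : y ∈ Ioo (D.η q₁.v) (D.η q₁.w))
    (h2 : y ∈ Ioo (D.η q₂.v) (D.η q₂.w)) (hx₁ : x₁ ∈ Icc (D.xs q₁.t y) (D.xs q₁.t' y))
    (hx₂ : x₂ ∈ Icc (D.xs q₂.t y) (D.xs q₂.t' y)) (h : D.Horiz x₁ x₂ y) : q₁ = q₂ := by
  have e1 : D.xs q₁.t y ∈ Icc (D.xs q₂.t y) (D.xs q₂.t' y) :=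
    mem_of_horiz h2 hx₂ (h.symm.trans
      (horiz (Ioo_subset_Icc_self h1) hx₁ (left_mem_Icc.2 (q₁.xs_lt y h1).le)))
  have e2 : D.xs q₂.t y ∈ Icc (D.xs q₁.t y) (D.xs q₁.t' y) :=
    mem_of_horiz h1 hx₁ (h.trans
      (horiz (Ioo_subset_Icc_self h2) hx₂ (left_mem_Icc.2 (q₂.xs_lt y h2).le)))
  exact eq_of_left_eq (eq_of_xs_eq (q₁.mem_left h1) (Ioo_subset_Icc_self (q₂.mem_left h2))
    (le_antisymm e2.1 e1.1)) h1 h2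

instance [Finite S] : Finite D.Trap :=
  Finite.of_injective (fun q : D.Trap => (q.t, q.t', q.v, q.w)) fun q₁ q₂ h => by
    simp only [Prod.mk.injEq] at h
    exact Trap.ext h.1 h.2.1 h.2.2.1 h.2.2.2

end Trap

theorem xs_lineMap (s : S) (y z θ : ℝ) :
    D.xs s (y + θ * (z - y)) = D.xs s y + θ * (D.xs s z - D.xs s y) := by
  simp only [xs]; ring

/-! ### Existence of trapezoids -/

/-- Two consecutive sides at some level remain consecutive downwards until the slab between them
reaches a vertex. -/
theorem exists_bottom [Finite S] {t t' : S} {y₀ : ℝ} (ht : y₀ ∈ Ioo (D.lo t) (D.hi t))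
    (ht' : y₀ ∈ Ioo (D.lo t') (D.hi t')) (hlt : D.xs t y₀ < D.xs t' y₀)
    (hcons : ∀ u, y₀ ∈ Icc (D.lo u) (D.hi u) → D.xs t y₀ < D.xs u y₀ → ¬ D.xs u y₀ < D.xs t' y₀) :
    ∃ v, D.η v < y₀ ∧ D.lo t ≤ D.η v ∧ D.lo t' ≤ D.η v ∧
      D.c v ∈ Icc (D.xs t (D.η v)) (D.xs t' (D.η v)) ∧
      ∀ y ∈ Ioc (D.η v) y₀, D.xs t y < D.xs t' y ∧
        ∀ u, y ∈ Icc (D.lo u) (D.hi u) → D.xs t y < D.xs u y → ¬ D.xs u y < D.xs t' y := by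
  have hI := Ioo_subset_Icc_self ht
  have hI' := Ioo_subset_Icc_self ht'
  obtain ⟨v, ⟨hv1, hv2, hv3, hv4⟩, hmax⟩ := Set.exists_max_image
    {u | D.η u < y₀ ∧ D.lo t ≤ D.η u ∧ D.lo t' ≤ D.η u ∧
      D.c u ∈ Icc (D.xs t (D.η u)) (D.xs t' (D.η u))} D.η (toFinite _) (by
    rcases le_total (D.lo t) (D.lo t') with h | h
    · obtain ⟨u, hu, hu'⟩ := exists_inc_lo (D := D) t'
      refine ⟨u, hu' ▸ ht'.1, hu' ▸ h, hu'.ge, ?_, hu.xs_eq.ge⟩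
      rw [← hu.xs_eq]
      exact xs_le_of_xs_lt hI hI' ⟨hu' ▸ h, hu' ▸ (ht'.1.trans ht.2).le⟩ hu.mem_Icc hlt
    · obtain ⟨u, hu, hu'⟩ := exists_inc_lo (D := D) t
      refine ⟨u, hu' ▸ ht.1, hu'.ge, hu' ▸ h, hu.xs_eq.le, ?_⟩
      rw [← hu.xs_eq]
      exact xs_le_of_xs_lt hI hI' hu.mem_Icc ⟨hu' ▸ h, hu' ▸ (ht.1.trans ht'.2).le⟩ hlt)
  refine ⟨v, hv1, hv2, hv3, hv4, fun y hy => ?_⟩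
  have hyt : y ∈ Ioo (D.lo t) (D.hi t) := ⟨hv2.trans_lt hy.1, hy.2.trans_lt ht.2⟩
  have hyt' : y ∈ Ioo (D.lo t') (D.hi t') := ⟨hv3.trans_lt hy.1, hy.2.trans_lt ht'.2⟩
  refine ⟨xs_lt_of_xs_lt hI hI' (Ioo_subset_Icc_self hyt) (Ioo_subset_Icc_self hyt') hlt
    (Or.inl hyt), fun u hu h1 h2 => ?_⟩
  have hz : min (D.hi u) y₀ ∈ Icc y y₀ := ⟨le_min hu.2 hy.2, min_le_right _ _⟩
  have hzu : min (D.hi u) y₀ ∈ Icc (D.lo u) (D.hi u) := ⟨hu.1.trans hz.1, min_le_left _ _⟩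
  have hzt : min (D.hi u) y₀ ∈ Ioo (D.lo t) (D.hi t) :=
    ⟨hyt.1.trans_le hz.1, hz.2.trans_lt ht.2⟩
  have hzt' : min (D.hi u) y₀ ∈ Ioo (D.lo t') (D.hi t') :=
    ⟨hyt'.1.trans_le hz.1, hz.2.trans_lt ht'.2⟩
  have k1 := xs_lt_of_xs_lt (Ioo_subset_Icc_self hyt) hu (Ioo_subset_Icc_self hzt) hzu h1
    (Or.inl hzt)
  have k2 := xs_lt_of_xs_lt hu (Ioo_subset_Icc_self hyt') hzu (Ioo_subset_Icc_self hzt') h2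
    (Or.inr hzt')
  rcases le_or_gt y₀ (D.hi u) with h | h
  · rw [min_eq_right h] at hzu k1 k2
    exact hcons u hzu k1 k2
  · rw [min_eq_left h.le] at hz hzt hzt' k1 k2
    obtain ⟨w, hw, hw'⟩ := exists_inc_hi (D := D) u
    have := hmax w ⟨hw' ▸ h, hw' ▸ hzt.1.le, hw' ▸ hzt'.1.le, by
      rw [← hw.xs_eq, hw']; exact ⟨k1.le, k2.le⟩⟩
    linarith [hz.1, hy.1]

theorem exists_top [Finite S] {t t' : S} {y₀ : ℝ} (ht : y₀ ∈ Ioo (D.lo t) (D.hi t))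
    (ht' : y₀ ∈ Ioo (D.lo t') (D.hi t')) (hlt : D.xs t y₀ < D.xs t' y₀)
    (hcons : ∀ u, y₀ ∈ Icc (D.lo u) (D.hi u) → D.xs t y₀ < D.xs u y₀ → ¬ D.xs u y₀ < D.xs t' y₀) :
    ∃ v, y₀ < D.η v ∧ D.η v ≤ D.hi t ∧ D.η v ≤ D.hi t' ∧
      D.c v ∈ Icc (D.xs t (D.η v)) (D.xs t' (D.η v)) ∧
      ∀ y ∈ Ico y₀ (D.η v), D.xs t y < D.xs t' y ∧
        ∀ u, y ∈ Icc (D.lo u) (D.hi u) → D.xs t y < D.xs u y → ¬ D.xs u y < D.xs t' y := by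
  obtain ⟨v, h1, h2, h3, h4, h5⟩ := exists_bottom (D := D.flip) (t := t) (t' := t') (y₀ := -y₀)
    (by simpa [and_comm] using ht) (by simpa [and_comm] using ht') (by simpa using hlt)
    (by
      intro u hu
      simp only [flip_lo, flip_hi, mem_Icc, neg_le_neg_iff] at hu
      simpa using hcons u ⟨hu.2, hu.1⟩)
  refine ⟨v, by simpa using h1, by simpa using h2, by simpa using h3, by simpa using h4,
    fun y hy => ?_⟩
  have := h5 (-y) ⟨by simpa using hy.2, by simpa using hy.1⟩
  simp only [flip_xs, neg_neg, flip_lo, flip_hi, mem_Icc, neg_le_neg_iff] at this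
  exact ⟨this.1, fun u hu => this.2 u ⟨hu.2, hu.1⟩⟩

theorem subset_or_disjoint_line {J : Set ℝ} (hJ : IsPreconnected J) (y : ℝ)
    (h : ∀ x ∈ J, (x, y) ∉ frontier D.M) : (∀ x ∈ J, (x, y) ∈ D.M) ∨ ∀ x ∈ J, (x, y) ∉ D.M := by
  have := subset_or_disjoint (D := D) (hJ.image (fun x => (x, y)) (by fun_prop))
    (by rintro _ ⟨x, hx, rfl⟩; exact h x hx)
  simpa only [forall_mem_image] using this

/-- From a side with the region to its right, the next side to the right. -/
theorem exists_next_side [Finite S] {t : S} {y₀ : ℝ} (ht : y₀ ∈ Ioo (D.lo t) (D.hi t))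
    (hL : D.IsL t) : ∃ t', y₀ ∈ Icc (D.lo t') (D.hi t') ∧ D.xs t y₀ < D.xs t' y₀ ∧
      (∀ u, y₀ ∈ Icc (D.lo u) (D.hi u) → D.xs t y₀ < D.xs u y₀ → ¬ D.xs u y₀ < D.xs t' y₀) ∧
      ∀ x ∈ Icc (D.xs t y₀) (D.xs t' y₀), (x, y₀) ∈ D.M := by
  have hne : {u | y₀ ∈ Icc (D.lo u) (D.hi u) ∧ D.xs t y₀ < D.xs u y₀}.Nonempty := by
    by_contra hemp
    rw [not_nonempty_iff_eq_empty] at hemp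
    obtain ⟨b, hb⟩ := (D.isCompact.image continuous_fst).bddAbove
    rcases subset_or_disjoint_line (D := D) (isPreconnected_Ioi (a := D.xs t y₀)) y₀ (by
        intro x hx hf
        obtain ⟨u, hu, rfl⟩ := mem_frontier.1 hf
        exact (hemp.subset ⟨hu, hx⟩ : u ∈ (∅ : Set S))) with h | h
    · have h1 := h (max b (D.xs t y₀) + 1) (by
        show D.xs t y₀ < _; linarith [le_max_right b (D.xs t y₀)])
      have := hb ⟨_, h1, rfl⟩
      simp only at this
      linarith [le_max_left b (D.xs t y₀)]
    · obtain ⟨z, hz1, hz2⟩ := ((hL _ ht).mem_right.and self_mem_nhdsWithin).exists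
      exact h z hz2 hz1
  obtain ⟨t', ⟨h1, h2⟩, hmin⟩ := Set.exists_min_image _ (fun u => D.xs u y₀) (toFinite _) hne
  refine ⟨t', h1, h2, fun u hu h => not_lt.2 (hmin u ⟨hu, h⟩), ?_⟩
  rcases subset_or_disjoint_line (D := D) (isPreconnected_Ioo (a := D.xs t y₀) (b := D.xs t' y₀)) y₀
    (by
      intro x hx hf
      obtain ⟨u, hu, rfl⟩ := mem_frontier.1 hf
      exact (hmin u ⟨hu, hx.1⟩).not_gt hx.2) with h | h
  · intro x hx
    rcases hx.1.eq_or_lt with h3 | h3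
    · rw [← h3]; exact side_mem (Ioo_subset_Icc_self ht)
    rcases hx.2.eq_or_lt with h4 | h4
    · rw [h4]; exact side_mem h1
    exact h x ⟨h3, h4⟩
  · obtain ⟨z, hz1, hz2⟩ := ((hL _ ht).mem_right.and (Ioo_mem_nhdsGT h2)).exists
    exact absurd hz1 (h z hz2)

/-- Through every inner point of a left side whose fiber contains no vertex there is a
trapezoid. -/
theorem exists_trap [Finite S] {t : S} {y₀ : ℝ} (ht : y₀ ∈ Ioo (D.lo t) (D.hi t)) (hL : D.IsL t)
    (hfree : ∀ u, D.η u = y₀ → ¬ D.Horiz (D.xs t y₀) (D.c u) y₀) :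
    ∃ q : D.Trap, q.t = t ∧ y₀ ∈ Ioo (D.η q.v) (D.η q.w) := by
  obtain ⟨t', hI', hlt, hcons, hM⟩ := exists_next_side ht hL
  have hH : D.Horiz (D.xs t y₀) (D.xs t' y₀) y₀ := fun z hz =>
    hM z (by rwa [uIcc_of_le hlt.le] at hz)
  have ht' : y₀ ∈ Ioo (D.lo t') (D.hi t') := by
    constructor
    · refine lt_of_le_of_ne hI'.1 fun h => ?_
      obtain ⟨u, hu, hu'⟩ := exists_inc_lo (D := D) t'
      have hy := hu'.trans h
      refine hfree u hy ?_
      rw [← hu.xs_eq, hy]; exact hH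
    · refine lt_of_le_of_ne hI'.2 fun h => ?_
      obtain ⟨u, hu, hu'⟩ := exists_inc_hi (D := D) t'
      have hy := hu'.trans h.symm
      refine hfree u hy ?_
      rw [← hu.xs_eq, hy]; exact hH
  have hR : D.IsR t' := (isL_or_isR t').resolve_left fun h => (h _ ht').not_horiz hlt hH
  obtain ⟨v, v1, v2, v3, v4, v5⟩ := exists_bottom ht ht' hlt hcons
  obtain ⟨w, w1, w2, w3, w4, w5⟩ := exists_top ht ht' hlt hcons
  have hboth : ∀ y ∈ Ioo (D.η v) (D.η w), D.xs t y < D.xs t' y ∧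
      ∀ u, y ∈ Icc (D.lo u) (D.hi u) → D.xs t y < D.xs u y → ¬ D.xs u y < D.xs t' y := by
    intro y hy
    rcases le_total y y₀ with h | h
    · exact v5 y ⟨hy.1, h⟩
    · exact w5 y ⟨h, hy.2⟩
  have hfr : ∀ y ∈ Ioo (D.η v) (D.η w), ∀ x ∈ Ioo (D.xs t y) (D.xs t' y),
      (x, y) ∉ frontier D.M := by
    intro y hy x hx hf
    obtain ⟨u, hu, rfl⟩ := mem_frontier.1 hf
    exact (hboth y hy).2 u hu hx.1 hx.2
  -- the open trapezoid is convex, misses the frontier and meets the region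
  have hconv : Convex ℝ ({p : ℝ × ℝ | D.xs t p.2 < p.1} ∩ {p | p.1 < D.xs t' p.2} ∩
      ({p | D.η v < p.2} ∩ {p | p.2 < D.η w})) :=
    ((convex_right t).inter (convex_left t')).inter
      ((convex_halfSpace_gt (LinearMap.snd ℝ ℝ ℝ).isLinear _).inter
        (convex_halfSpace_lt (LinearMap.snd ℝ ℝ ℝ).isLinear _))
  obtain ⟨x₀, hx₀⟩ := exists_between hlt
  have hopen : ∀ y ∈ Ioo (D.η v) (D.η w), ∀ x ∈ Ioo (D.xs t y) (D.xs t' y), (x, y) ∈ D.M := by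
    rcases subset_or_disjoint hconv.isPreconnected (D := D)
      (fun p hp => hfr p.2 hp.2 p.1 hp.1) with h | h
    · exact fun y hy x hx => h (x, y) ⟨hx, hy⟩
    · exact absurd (hM x₀ (Ioo_subset_Icc_self hx₀)) (h (x₀, y₀) ⟨hx₀, v1, w1⟩)
  refine ⟨⟨t, t', v, w, v1.trans w1, v2, v3, w2, w3, hL, hR, fun y hy => (hboth y hy).1, hfr,
    fun y hy x hx => ?_, v4, w4⟩, rfl, v1, w1⟩
  -- the closed trapezoid lies in the closure of the open one
  have hcl : (x, y) ∈ closure D.M := by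
    have h0 : (0 : ℝ) ∈ closure (Ioc (0 : ℝ) 1) := by
      rw [closure_Ioc (by norm_num)]; simp
    have hmaps : MapsTo (fun θ : ℝ => (x + θ * (x₀ - x), y + θ * (y₀ - y))) (Ioc 0 1) D.M := by
      intro θ hθ
      have e1 : 0 ≤ 1 - θ := by linarith [hθ.2]
      have e2 := hθ.1
      refine hopen _ ⟨?_, ?_⟩ _ ⟨?_, ?_⟩
      · nlinarith [mul_nonneg e1 (sub_nonneg.2 hy.1), mul_pos e2 (sub_pos.2 v1)]
      · nlinarith [mul_nonneg e1 (sub_nonneg.2 hy.2), mul_pos e2 (sub_pos.2 w1)]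
      · rw [xs_lineMap]
        nlinarith [mul_nonneg e1 (sub_nonneg.2 hx.1), mul_pos e2 (sub_pos.2 hx₀.1)]
      · rw [xs_lineMap]
        nlinarith [mul_nonneg e1 (sub_nonneg.2 hx.2), mul_pos e2 (sub_pos.2 hx₀.2)]
    have := map_mem_closure (f := fun θ : ℝ => (x + θ * (x₀ - x), y + θ * (y₀ - y)))
      (by fun_prop) h0 hmaps
    simpa using this
  rwa [isClosed.closure_eq] at hcl

/-- Every point of the region whose fiber contains no vertex lies in an open trapezoid. -/
theorem exists_trap_of_regular [Finite S] {x y : ℝ} (h : (x, y) ∈ D.M)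
    (hfree : ∀ u, D.η u = y → ¬ D.Horiz x (D.c u) y) :
    ∃ q : D.Trap, y ∈ Ioo (D.η q.v) (D.η q.w) ∧ x ∈ Icc (D.xs q.t y) (D.xs q.t' y) := by
  obtain ⟨l, hl, hH, -, ⟨v, hv, rfl⟩ | ⟨t, ht, rfl, hL⟩⟩ := exists_isL_or_vertex h
  · exact absurd hH.symm (hfree v hv)
  · obtain ⟨q, rfl, hq⟩ := exists_trap ht hL fun u hu hh => hfree u hu (hH.symm.trans hh)
    exact ⟨q, hq, Trap.mem_of_horiz hq (left_mem_Icc.2 (q.xs_lt y hq).le) hH⟩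

/-! ### Degrees -/

theorem exists_above_vertex_free [Finite S] {y b : ℝ} (hb : y < b) :
    ∃ z ∈ Ioo y b, ∀ u, D.η u ∉ Ioc y z := by
  have h : ∀ u, ∀ᶠ z in 𝓝[>] y, D.η u ∉ Ioc y z := by
    intro u
    rcases le_or_gt (D.η u) y with h | h
    · exact Eventually.of_forall fun z hz => not_lt.2 h hz.1
    · filter_upwards [Ioo_mem_nhdsGT h] with z hz hz'
      exact not_lt.2 hz'.2 hz.2
  have h2 : ∀ᶠ z in 𝓝[>] y, z ∈ Ioo y b := Ioo_mem_nhdsGT hb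
  exact (h2.and (eventually_all.2 h)).exists

/-- The trapezoids that start at a vertex correspond to the left sides above its fiber. -/
theorem image_left_eq_above [Finite S] (v : S) :
    Trap.t '' {q : D.Trap | q.v = v} = D.Above v := by
  ext t
  constructor
  · rintro ⟨q, rfl, rfl⟩
    exact ⟨q.isL, ⟨q.lo_left, q.lt.trans_le q.hi_left⟩, Trap.horiz (left_mem_Icc.2 q.lt.le)
      (left_mem_Icc.2 (q.bot.1.trans q.bot.2)) q.bot⟩
  · rintro ⟨hL, hv, hH⟩
    obtain ⟨z, hz, hfree⟩ := exists_above_vertex_free (D := D) hv.2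
    obtain ⟨q, rfl, hq⟩ := exists_trap (D := D) (t := t) (y₀ := z) ⟨hv.1.trans_lt hz.1, hz.2⟩ hL
      (fun u hu => absurd ⟨hu ▸ hz.1, hu.le⟩ (hfree u))
    have h1 : D.η q.v ≤ D.η v := not_lt.1 fun h => hfree q.v ⟨h, hq.1.le⟩
    refine ⟨q, ?_, rfl⟩
    by_contra hne
    have h2 : D.η v ∈ Ioo (D.η q.v) (D.η q.w) :=
      ⟨lt_of_le_of_ne h1 fun h => hne (η_injective h), hz.1.trans hq.2⟩
    exact q.vertex_notMem h2 (Trap.mem_of_horiz h2 (left_mem_Icc.2 (q.xs_lt _ h2).le) hH)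

theorem injOn_left (v : S) : InjOn Trap.t {q : D.Trap | q.v = v} := by
  intro q₁ h1 q₂ h2 h
  obtain ⟨y, hy1, hy2⟩ := exists_between (lt_min q₁.lt
    (show D.η q₁.v < D.η q₂.w by rw [show q₁.v = q₂.v from h1.trans h2.symm]; exact q₂.lt))
  rw [lt_min_iff] at hy2
  exact Trap.eq_of_left_eq h ⟨hy1, hy2.1⟩ ⟨by
    rw [show q₂.v = q₁.v from h2.trans h1.symm]; exact hy1, hy2.2⟩

theorem ncard_start [Finite S] (v : S) : {q : D.Trap | q.v = v}.ncard = (D.Above v).ncard := by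
  rw [← image_left_eq_above, (injOn_left v).ncard_image]

theorem ncard_end [Finite S] (v : S) : {q : D.Trap | q.w = v}.ncard = (D.flip.Above v).ncard := by
  rw [← ncard_start, ← ncard_image_of_injective _ Trap.flipEquiv.injective]
  congr 1
  ext q
  rw [Equiv.image_eq_preimage_symm]
  rfl

end SegRegion

namespace SegRegion

variable {S : Type} {D : SegRegion S}

/-! ### Parity of cycles along the boundary curves -/

noncomputable instance [Finite S] : Fintype D.Trap := Fintype.ofFinite _

theorem Trap.horiz_vertex (q : D.Trap) {u : S} (h : q.v = u ∨ q.w = u) :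
    D.Horiz (D.xs q.t (D.η u)) (D.c u) (D.η u) ∧ D.η u ∈ Icc (D.lo q.t) (D.hi q.t) := by
  rcases h with rfl | rfl
  · exact ⟨Trap.horiz (left_mem_Icc.2 q.lt.le) (left_mem_Icc.2 (q.bot.1.trans q.bot.2)) q.bot,
      q.lo_left, q.lt.le.trans q.hi_left⟩
  · exact ⟨Trap.horiz (right_mem_Icc.2 q.lt.le) (left_mem_Icc.2 (q.top.1.trans q.top.2)) q.top,
      q.lo_left.trans q.lt.le, q.hi_left⟩

section Parity

variable [Finite S] (Z : D.Trap → ZMod 2) {Z' : D.Trap → ZMod 2} {x y : ℝ}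

open Classical in
/-- A cycle modulo 2 of the graph whose edges are the trapezoids. -/
def IsCycle (Z : D.Trap → ZMod 2) : Prop :=
  ∀ v, (∑ q, if q.v = v then Z q else 0) + (∑ q, if q.w = v then Z q else 0) = 0

open Classical in
/-- The number of edges of the chain `Z` to the left of `x` just above height `y`. -/
noncomputable def countAbove (x y : ℝ) : ZMod 2 :=
  ∑ q : D.Trap, if D.η q.v ≤ y ∧ y < D.η q.w ∧ D.xs q.t y < x then Z q else 0

open Classical in
/-- The number of edges of the chain `Z` to the left of `x` just below height `y`. -/
noncomputable def countBelow (x y : ℝ) : ZMod 2 :=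
  ∑ q : D.Trap, if D.η q.v < y ∧ y ≤ D.η q.w ∧ D.xs q.t y < x then Z q else 0

/-- The mirror image of a chain. -/
def flipChain (Z : D.Trap → ZMod 2) : D.flip.Trap → ZMod 2 := fun q => Z q.unflip

theorem countBelow_eq_flip : countBelow Z x y = countAbove (flipChain Z) x (-y) := by
  refine Fintype.sum_equiv Trap.flipEquiv _ _ fun q => ?_
  have e : flipChain Z (Trap.flipEquiv q) = Z q := rfl
  rw [e]
  refine if_congr ?_ rfl rfl
  change _ ↔ -D.η q.w ≤ -y ∧ -y < -D.η q.v ∧ D.flip.xs q.t (-y) < x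
  rw [flip_xs, neg_neg, neg_le_neg_iff, neg_lt_neg_iff]
  tauto

variable {Z}

theorem IsCycle.flip (h : IsCycle Z) : IsCycle (flipChain Z) := by
  classical
  intro v
  refine Eq.trans ?_ (h v)
  rw [add_comm]
  congr 1
  · exact (Fintype.sum_equiv Trap.flipEquiv _ _ fun q => rfl).symm
  · exact (Fintype.sum_equiv Trap.flipEquiv _ _ fun q => rfl).symm

theorem countAbove_eq_countBelow_of_free (h : ∀ u, D.η u ≠ y) :
    countAbove Z x y = countBelow Z x y := by
  refine Finset.sum_congr rfl fun q _ => if_congr ?_ rfl rfl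
  rw [(h q.v).le_iff_lt, (h q.w).symm.le_iff_lt]

/-- At a frontier point that separates the region from its complement horizontally, the counts
above and below agree: all trapezoids that start or end at the vertex of this level lie on the same
side of the point, and a cycle has an even number of edges at the vertex. -/
theorem countAbove_eq_countBelow (hZ : IsCycle Z) (hx : D.HL x y ∨ D.HR x y)
    (hx' : ∀ t, D.IsL t → y ∈ Icc (D.lo t) (D.hi t) → D.xs t y = x → D.HL x y) :
    countAbove Z x y = countBelow Z x y := by
  classical
  by_cases hu : ∃ u, D.η u = y
  swap
  · exact countAbove_eq_countBelow_of_free fun u hu' => hu ⟨u, hu'⟩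
  obtain ⟨u, rfl⟩ := hu
  have hA : countAbove Z x (D.η u) = (∑ q : D.Trap, if q.v = u ∧ D.xs q.t (D.η u) < x then Z q
      else 0) + ∑ q : D.Trap, if D.η q.v < D.η u ∧ D.η u < D.η q.w ∧ D.xs q.t (D.η u) < x then Z q
        else 0 := by
    rw [← Finset.sum_add_distrib]
    refine Finset.sum_congr rfl fun q _ => ?_
    by_cases h : q.v = u
    · subst h; simp [q.lt]
    · have : D.η q.v ≠ D.η u := fun h' => h (η_injective h')
      simp [h, this.le_iff_lt]
  have hB : countBelow Z x (D.η u) = (∑ q : D.Trap, if q.w = u ∧ D.xs q.t (D.η u) < x then Z q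
      else 0) + ∑ q : D.Trap, if D.η q.v < D.η u ∧ D.η u < D.η q.w ∧ D.xs q.t (D.η u) < x then Z q
        else 0 := by
    rw [← Finset.sum_add_distrib]
    refine Finset.sum_congr rfl fun q _ => ?_
    by_cases h : q.w = u
    · subst h; simp [q.lt]
    · have : D.η u ≠ D.η q.w := fun h' => h (η_injective h').symm
      simp [h, this.le_iff_lt]
  rw [hA, hB]
  congr 1
  have key : ∀ q₀ q : D.Trap, (q₀.v = u ∨ q₀.w = u) → (q.v = u ∨ q.w = u) →
      D.xs q₀.t (D.η u) < x → D.xs q.t (D.η u) < x := by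
    intro q₀ q h0 h1 hlt
    by_contra hge
    rw [not_lt] at hge
    have hH := (q₀.horiz_vertex h0).1.trans (q.horiz_vertex h1).1.symm
    have hm : x ∈ uIcc (D.xs q₀.t (D.η u)) (D.xs q.t (D.η u)) := mem_uIcc.2 (Or.inl ⟨hlt.le, hge⟩)
    have hnL : ¬ D.HL x (D.η u) := fun hL => hL.not_horiz hlt (hH.mono left_mem_uIcc hm)
    rcases hge.eq_or_lt with h | h
    · exact hnL (hx' q.t q.isL (q.horiz_vertex h1).2 h.symm)
    · exact (hx.resolve_left hnL).not_horiz h (hH.mono hm right_mem_uIcc)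
  by_cases hK : ∃ q₀ : D.Trap, (q₀.v = u ∨ q₀.w = u) ∧ D.xs q₀.t (D.η u) < x
  · obtain ⟨q₀, h0, h1⟩ := hK
    have e1 : ∀ q : D.Trap, q.v = u ∧ D.xs q.t (D.η u) < x ↔ q.v = u := fun q =>
      ⟨And.left, fun h => ⟨h, key q₀ q h0 (Or.inl h) h1⟩⟩
    have e2 : ∀ q : D.Trap, q.w = u ∧ D.xs q.t (D.η u) < x ↔ q.w = u := fun q =>
      ⟨And.left, fun h => ⟨h, key q₀ q h0 (Or.inr h) h1⟩⟩
    simp only [e1, e2]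
    exact CharTwo.add_eq_zero.1 (hZ u)
  · push Not at hK
    rw [Finset.sum_eq_zero fun q _ => if_neg fun h => not_lt.2 (hK q (Or.inl h.1)) h.2,
      Finset.sum_eq_zero fun q _ => if_neg fun h => not_lt.2 (hK q (Or.inr h.1)) h.2]

/-- The number of edges to the left of a side is constant just above a height, unless an edge that
counts starts on the side at this height and lies to the left of the side further up. -/
theorem eventually_countAbove {s : S} (h : ∀ q : D.Trap, D.η q.v ≤ y → y < D.η q.w →
    D.xs q.t y = D.xs s y → q.t = s ∨ Z q = 0 ∨ ∀ z > y, D.xs s z ≤ D.xs q.t z) :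
    ∀ᶠ z in 𝓝[>] y, countAbove Z (D.xs s z) z = countAbove Z (D.xs s y) y := by
  classical
  suffices h : ∀ q : D.Trap, ∀ᶠ z in 𝓝[>] y,
      (if D.η q.v ≤ z ∧ z < D.η q.w ∧ D.xs q.t z < D.xs s z then Z q else 0) =
      (if D.η q.v ≤ y ∧ y < D.η q.w ∧ D.xs q.t y < D.xs s y then Z q else 0) by
    filter_upwards [eventually_all.2 h] with z hz
    exact Finset.sum_congr rfl fun q _ => hz q
  intro q
  rcases lt_or_ge y (D.η q.v) with h1 | h1
  · filter_upwards [Ioo_mem_nhdsGT h1] with z hz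
    rw [if_neg fun h => not_le.2 hz.2 h.1, if_neg fun h => not_le.2 h1 h.1]
  rcases le_or_gt (D.η q.w) y with h2 | h2
  · filter_upwards [self_mem_nhdsWithin] with z hz
    rw [if_neg fun h => not_le.2 h.2.1 (h2.trans (le_of_lt hz)), if_neg fun h => not_le.2 h.2.1 h2]
  have hev : ∀ᶠ z in 𝓝[>] y, z ∈ Ioo y (D.η q.w) := Ioo_mem_nhdsGT h2
  have c1 : Tendsto (D.xs q.t) (𝓝[>] y) (𝓝 (D.xs q.t y)) :=
    ((continuous_xs q.t).tendsto y).mono_left nhdsWithin_le_nhds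
  have c2 : Tendsto (D.xs s) (𝓝[>] y) (𝓝 (D.xs s y)) :=
    ((continuous_xs s).tendsto y).mono_left nhdsWithin_le_nhds
  rcases lt_trichotomy (D.xs q.t y) (D.xs s y) with h3 | h3 | h3
  · filter_upwards [hev, c1.eventually_lt c2 h3] with z hz hz'
    rw [if_pos ⟨h1.trans hz.1.le, hz.2, hz'⟩, if_pos ⟨h1, h2, h3⟩]
  · filter_upwards [hev] with z hz
    rcases h q h1 h2 h3 with h4 | h4 | h4
    · simp [h4]
    · simp [h4]
    · rw [if_neg fun h => not_le.2 h.2.2 (h4 z hz.1), if_neg fun h => h.2.2.ne h3]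
  · filter_upwards [hev, c2.eventually_lt c1 h3] with z hz hz'
    rw [if_neg fun h => not_le.2 h.2.2 hz'.le, if_neg fun h => not_le.2 h.2.2 h3.le]

theorem eventually_free_right (y : ℝ) : ∀ᶠ z in 𝓝[>] y, ∀ u, D.η u ≠ z := by
  refine eventually_all.2 fun u => ?_
  rcases le_or_gt (D.η u) y with h | h
  · filter_upwards [self_mem_nhdsWithin] with z hz
    exact (h.trans_lt hz).ne
  · filter_upwards [Ioo_mem_nhdsGT h] with z hz
    exact hz.2.ne'

theorem eventually_free_left (y : ℝ) : ∀ᶠ z in 𝓝[<] y, ∀ u, D.η u ≠ z := by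
  refine eventually_all.2 fun u => ?_
  rcases le_or_gt y (D.η u) with h | h
  · filter_upwards [self_mem_nhdsWithin] with z hz
    exact (lt_of_lt_of_le hz h).ne'
  · filter_upwards [Ioo_mem_nhdsLT h] with z hz
    exact hz.1.ne

theorem eventually_side {s : S} (hZ : IsCycle Z) (hy : y ∈ Ioo (D.lo s) (D.hi s)) :
    ∀ᶠ z in 𝓝 y, countAbove Z (D.xs s z) z = countAbove Z (D.xs s y) y := by
  have hR := eventually_countAbove (Z := Z) (s := s) (y := y) fun q h1 h2 h3 =>
    Or.inl (eq_of_xs_eq hy ⟨q.lo_left.trans h1, h2.le.trans q.hi_left⟩ h3.symm).symm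
  have hL := eventually_countAbove (Z := flipChain Z) (s := s) (y := -y) fun q h1 h2 h3 =>
    Or.inl (eq_of_xs_eq (D := D.flip) (y := -y) (by simpa [and_comm] using hy)
      ⟨q.lo_left.trans h1, h2.le.trans q.hi_left⟩ h3.symm).symm
  have hL' := (tendsto_neg_nhdsLT (a := y)).eventually hL
  have hThru : countAbove Z (D.xs s y) y = countBelow Z (D.xs s y) y :=
    countAbove_eq_countBelow hZ ((isL_or_isR s).imp (fun h => h y hy) fun h => h y hy)
      fun t hL ht hst => by
        have : s = t := eq_of_xs_eq hy ht hst.symm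
        subst this; exact hL y hy
  rw [← nhdsNE_sup_pure, eventually_sup, ← nhdsLT_sup_nhdsGT, eventually_sup]
  refine ⟨⟨?_, hR⟩, by simp⟩
  filter_upwards [hL', eventually_free_left (D := D) y] with z hz hz'
  rw [hThru, countAbove_eq_countBelow_of_free hz', countBelow_eq_flip, countBelow_eq_flip]
  simpa using hz

variable (Z) in
/-- The number of edges of a cycle to the left of a side, modulo 2; it does not depend on the
height. -/
noncomputable def sideCount (s : S) : ZMod 2 :=
  countAbove Z (D.xs s ((D.lo s + D.hi s) / 2)) ((D.lo s + D.hi s) / 2)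

theorem countAbove_eq_sideCount {s : S} (hZ : IsCycle Z) (hy : y ∈ Ioo (D.lo s) (D.hi s)) :
    countAbove Z (D.xs s y) y = sideCount Z s := by
  have hm : (D.lo s + D.hi s) / 2 ∈ Ioo (D.lo s) (D.hi s) := by
    have := lo_lt_hi (D := D) s
    constructor <;> linarith
  rcases isPreconnected_Ioo.subset_or_subset (s := Ioo (D.lo s) (D.hi s))
    (u := {y | ∀ᶠ z in 𝓝 y, countAbove Z (D.xs s z) z = sideCount Z s})
    (v := {y | ∀ᶠ z in 𝓝 y, countAbove Z (D.xs s z) z ≠ sideCount Z s})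
    isOpen_setOfPred_eventually_nhds isOpen_setOfPred_eventually_nhds
    (Set.disjoint_left.2 fun y h1 h2 => (show ∀ᶠ z in 𝓝 y, _ from h2).self_of_nhds
      (show ∀ᶠ z in 𝓝 y, _ from h1).self_of_nhds)
    (fun z hz => by
      have h := eventually_side (Z := Z) hZ hz
      by_cases heq : countAbove Z (D.xs s z) z = sideCount Z s
      · exact Or.inl (h.mono fun w hw => hw.trans heq)
      · exact Or.inr (h.mono fun w hw => by rw [hw]; exact heq)) with h | h
  · exact (h hy).self_of_nhds
  · exact absurd rfl (h hm).self_of_nhds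

theorem sideCount_flip {s : S} (hZ : IsCycle Z) : sideCount (flipChain Z) s = sideCount Z s := by
  obtain ⟨z, hz, hfree⟩ := ((show ∀ᶠ z in 𝓝[>] (D.lo s), z ∈ Ioo (D.lo s) (D.hi s) from
    Ioo_mem_nhdsGT (lo_lt_hi s)).and (eventually_free_right (D := D) (D.lo s))).exists
  rw [← countAbove_eq_sideCount hZ hz, ← countAbove_eq_sideCount (D := D.flip) hZ.flip (y := -z)
    (by simpa [and_comm] using hz), countAbove_eq_countBelow_of_free hfree, countBelow_eq_flip]
  simp

/-- At the lower end of a side, the count for the side agrees with the count at the vertex. -/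
theorem sideCount_eq_of_lo {s v : S} (hZ : IsCycle Z) (hs : D.Inc s v) (hlo : D.lo s = D.η v)
    (h : ∀ q : D.Trap, D.Inc q.t v → D.lo q.t = D.η v → q.v = v → q.t = s ∨ Z q = 0 ∨
      ∀ z > D.η v, D.xs s z ≤ D.xs q.t z) : sideCount Z s = countAbove Z (D.c v) (D.η v) := by
  have hev := eventually_countAbove (Z := Z) (s := s) (y := D.η v) fun q h1 h2 h3 => by
    have hinc : D.Inc q.t v := inc_of_xs_eq ⟨q.lo_left.trans h1, h2.le.trans q.hi_left⟩
      (h3.trans hs.xs_eq)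
    have hlo' : D.lo q.t = D.η v := by
      rcases hinc.eq_lo_or_hi with h | h
      · exact h.symm
      · exact absurd (h2.trans_le q.hi_left) (by rw [h]; exact lt_irrefl _)
    exact h q hinc hlo' (η_injective (le_antisymm h1 (hlo' ▸ q.lo_left)))
  obtain ⟨z, hz1, hz2⟩ := ((show ∀ᶠ z in 𝓝[>] (D.lo s), z ∈ Ioo (D.lo s) (D.hi s) from
    Ioo_mem_nhdsGT (lo_lt_hi s)).and (hlo ▸ hev)).exists
  rw [← countAbove_eq_sideCount hZ hz1, hz2, hlo, hs.xs_eq]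

/-- At a regular vertex, the counts for the two sides agree. -/
theorem sideCount_reg {s₁ s₂ v : S} (hZ : IsCycle Z) (h1 : D.Inc s₁ v) (h2 : D.Inc s₂ v)
    (hhi : D.hi s₁ = D.η v) (hlo : D.lo s₂ = D.η v) : sideCount Z s₁ = sideCount Z s₂ := by
  have hne : s₁ ≠ s₂ := by rintro rfl; exact (lo_lt_hi s₁).ne (hlo.trans hhi.symm)
  have e2 : sideCount Z s₂ = countAbove Z (D.c v) (D.η v) :=
    sideCount_eq_of_lo hZ h2 hlo fun q hq hq' _ => by
      rcases h1.eq_or_eq h2 hne hq with h | h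
      · rw [h] at hq'; exact absurd (hq'.trans hhi.symm) (lo_lt_hi _).ne
      · exact Or.inl h
  have e1 : sideCount Z s₁ = countBelow Z (D.c v) (D.η v) := by
    rw [← sideCount_flip hZ, countBelow_eq_flip]
    refine sideCount_eq_of_lo (D := D.flip) hZ.flip h1 (by simpa using hhi) fun q hq hq' _ => ?_
    rcases h1.eq_or_eq h2 hne hq with h | h
    · exact Or.inl h
    · rw [h, flip_lo, flip_η, neg_inj] at hq'
      exact absurd (hq'.trans hlo.symm) (lo_lt_hi _).ne'
  rw [e1, e2]
  have ht := reg_types h1 h2 hhi hlo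
  refine (countAbove_eq_countBelow hZ (ht.imp (fun h => h.2.2) fun h => h.2.2)
    fun t hL ht' hx => ?_).symm
  rcases ht with h | h
  · exact h.2.2
  · exfalso
    rcases h1.eq_or_eq h2 hne (inc_of_xs_eq ht' hx) with rfl | rfl
    exacts [hL.not_isR h.1, hL.not_isR h.2.1]

/-- At a vertex whose two sides go up, the counts for the two sides agree: if there is a trapezoid
between the two sides, then it is the only edge at this vertex, so that no cycle contains it. -/
theorem sideCount_up {s₁ s₂ v : S} (hZ : IsCycle Z) (hv : D.Up v) (h1 : D.Inc s₁ v)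
    (h2 : D.Inc s₂ v) (hsl : D.slope s₁ < D.slope s₂) : sideCount Z s₁ = sideCount Z s₂ := by
  classical
  have hne : s₁ ≠ s₂ := by rintro rfl; exact lt_irrefl _ hsl
  rw [sideCount_eq_of_lo hZ h1 (hv _ h1) fun q hq _ _ => ?_,
    sideCount_eq_of_lo hZ h2 (hv _ h2) fun q hq hlo hqv => ?_]
  · rcases h1.eq_or_eq h2 hne hq with h | h
    swap
    · exact Or.inl h
    right; left
    rcases up_types h1 h2 (hv _ h1) (hv _ h2) hsl with ⟨hL, hR, hlft⟩ | ⟨hR, -⟩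
    swap
    · exact absurd hR (h ▸ q.isL).not_isR
    have hstart : ∀ q' : D.Trap, q'.v = v ↔ q' = q := by
      intro q'
      refine ⟨fun h' => injOn_left v h' hqv ?_, fun h' => h' ▸ hqv⟩
      have : q'.t ∈ D.Above v := by rw [← image_left_eq_above]; exact ⟨q', h', rfl⟩
      rw [above_eq_of_not_lft hlft] at this
      rcases h1.eq_or_eq h2 hne this.1 with h'' | h''
      · rw [h'', h]
      · exact absurd hR (h'' ▸ this.2.2).not_isR
    have hend : ∀ q' : D.Trap, q'.w ≠ v := by
      intro q' h'
      have : q'.t ∈ D.flip.Above v := by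
        rw [← image_left_eq_above]; exact ⟨q'.flip, h', rfl⟩
      rw [above_eq_of_not_lft (by simpa using hlft),
        Down.aboveInc_eq (D := D.flip) (by simpa using hv)] at this
      exact this
    have := hZ v
    simpa [hstart, hend] using this
  · rcases h1.eq_or_eq h2 hne hq with h | h
    · exact Or.inl h
    right; right; intro z hz
    rw [h, xs_eq_of_inc h1, xs_eq_of_inc h2]
    nlinarith

theorem sideCount_eq_of_up {s t v : S} (hZ : IsCycle Z) (hv : D.Up v) (hs : D.Inc s v)
    (ht : D.Inc t v) : sideCount Z s = sideCount Z t := by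
  obtain ⟨s₁, s₂, h1, h2, hsl⟩ := hv.exists_pair
  have hne : s₁ ≠ s₂ := by rintro rfl; exact lt_irrefl _ hsl
  have := sideCount_up hZ hv h1 h2 hsl
  rcases h1.eq_or_eq h2 hne hs with rfl | rfl <;> rcases h1.eq_or_eq h2 hne ht with rfl | rfl <;>
    simp [this]

theorem sideCount_eq_of_inc {s t v : S} (hZ : IsCycle Z) (hs : D.Inc s v) (ht : D.Inc t v) :
    sideCount Z s = sideCount Z t := by
  rcases reg_or_up_or_down (D := D) v with ⟨s₁, s₂, h1, h2, hhi, hlo⟩ | hv | hv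
  · have hne : s₁ ≠ s₂ := by rintro rfl; exact (lo_lt_hi s₁).ne (hlo.trans hhi.symm)
    have := sideCount_reg hZ h1 h2 hhi hlo
    rcases h1.eq_or_eq h2 hne hs with rfl | rfl <;>
      rcases h1.eq_or_eq h2 hne ht with rfl | rfl <;> simp [this]
  · exact sideCount_eq_of_up hZ hv hs ht
  · rw [← sideCount_flip hZ, ← sideCount_flip hZ (s := t)]
    exact sideCount_eq_of_up (D := D.flip) hZ.flip (by simpa using hv) hs ht

/-- The count is constant along each boundary curve. -/
theorem sideCount_next (hZ : IsCycle Z) (s : S) : sideCount Z (D.next s) = sideCount Z s :=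
  sideCount_eq_of_inc hZ (v := D.next s) (Or.inl rfl) (Or.inr rfl)

/-- A cycle is determined by its counts, since the counts at both sides of a trapezoid differ by
the multiplicity of this trapezoid. -/
theorem eq_zero_of_sideCount_eq_zero (hZ : IsCycle Z) (h : ∀ s, sideCount Z s = 0) : Z = 0 := by
  classical
  funext q
  obtain ⟨y, hy, hfree⟩ := ((show ∀ᶠ z in 𝓝[>] (D.η q.v), z ∈ Ioo (D.η q.v) (D.η q.w) from
    Ioo_mem_nhdsGT q.lt).and (eventually_free_right (D := D) (D.η q.v))).exists
  have e1 := (countAbove_eq_sideCount hZ (q.mem_left hy)).trans (h _)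
  have e2 := (countAbove_eq_sideCount hZ (q.mem_right hy)).trans (h _)
  have : countAbove Z (D.xs q.t' y) y = countAbove Z (D.xs q.t y) y +
      ∑ q' : D.Trap, if q' = q then Z q' else 0 := by
    unfold countAbove
    rw [← Finset.sum_add_distrib]
    refine Finset.sum_congr rfl fun q' _ => ?_
    by_cases hq : q' = q
    · subst hq; simp [hy.1.le, hy.2, q'.xs_lt y hy]
    rw [if_neg hq, add_zero]
    refine if_congr (and_congr_right fun h1 => and_congr_right fun h2 => ?_) rfl rfl
    refine ⟨fun h3 => ?_, fun h3 => h3.trans (q.xs_lt y hy)⟩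
    have hy' : y ∈ Ioo (D.η q'.v) (D.η q'.w) := ⟨lt_of_le_of_ne h1 (hfree _), h2⟩
    rcases lt_trichotomy (D.xs q'.t y) (D.xs q.t y) with h4 | h4 | h4
    · exact h4
    · exact absurd (Trap.eq_of_left_eq (eq_of_xs_eq (q'.mem_left hy')
        (Ioo_subset_Icc_self (q.mem_left hy)) h4) hy' hy) hq
    · exact absurd (mem_frontier.2 ⟨_, Ioo_subset_Icc_self (q'.mem_left hy'), rfl⟩)
        (q.notMem_frontier y hy _ ⟨h4, h3⟩)
  rw [e1, e2] at this
  simpa using this.symm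

/-- The count vanishes at the leftmost side of some level. -/
theorem exists_sideCount_eq_zero [Nonempty S] :
    ∃ s, ∀ Z : D.Trap → ZMod 2, IsCycle Z → sideCount Z s = 0 := by
  classical
  obtain ⟨s₀⟩ := ‹Nonempty S›
  obtain ⟨y, hy, hfree⟩ := ((show ∀ᶠ z in 𝓝[>] (D.lo s₀), z ∈ Ioo (D.lo s₀) (D.hi s₀) from
    Ioo_mem_nhdsGT (lo_lt_hi s₀)).and (eventually_free_right (D := D) (D.lo s₀))).exists
  obtain ⟨s, hs, hmin⟩ := Set.exists_min_image {s | y ∈ Ioo (D.lo s) (D.hi s)} (fun s => D.xs s y)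
    (toFinite _) ⟨s₀, hy⟩
  refine ⟨s, fun Z hZ => ?_⟩
  rw [← countAbove_eq_sideCount hZ hs]
  refine Finset.sum_eq_zero fun q _ => if_neg ?_
  rintro ⟨h1, h2, h3⟩
  exact not_lt.2 (hmin q.t (q.mem_left ⟨lt_of_le_of_ne h1 (hfree _), h2⟩)) h3

end Parity

/-! ### The bound for the first Betti number -/

section Betti

variable [Fintype S]

open Classical in
/-- The boundary operator modulo 2 of the graph of trapezoids. -/
noncomputable def boundaryMap (D : SegRegion S) : (D.Trap → ZMod 2) →ₗ[ZMod 2] (S → ZMod 2) where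
  toFun Z v := (∑ q, if q.v = v then Z q else 0) + (∑ q, if q.w = v then Z q else 0)
  map_add' Z Z' := by
    funext v
    simp only [Pi.add_apply, ← Finset.sum_add_distrib]
    refine Finset.sum_congr rfl fun q _ => ?_
    split_ifs <;> ring
  map_smul' a Z := by
    funext v
    simp [Finset.mul_sum, mul_add]

/-- The counts along finitely many sides, as a linear map. -/
noncomputable def sideCountMap (D : SegRegion S) {I : Type} (rep : I → S) :
    (D.Trap → ZMod 2) →ₗ[ZMod 2] (I → ZMod 2) where
  toFun Z i := sideCount Z (rep i)
  map_add' Z Z' := by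
    funext i
    simp only [Pi.add_apply, sideCount, countAbove, ← Finset.sum_add_distrib]
    refine Finset.sum_congr rfl fun q _ => ?_
    split_ifs <;> simp
  map_smul' a Z := by
    funext i
    simp [sideCount, countAbove, Finset.mul_sum]

theorem mem_ker_boundaryMap {Z : D.Trap → ZMod 2} :
    Z ∈ LinearMap.ker D.boundaryMap ↔ IsCycle Z := by
  rw [LinearMap.mem_ker, funext_iff]; rfl

theorem sum_boundaryMap (Z : D.Trap → ZMod 2) : ∑ v, D.boundaryMap Z v = 0 := by
  classical
  change ∑ v, ((∑ q : D.Trap, if q.v = v then Z q else 0) +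
    (∑ q : D.Trap, if q.w = v then Z q else 0)) = 0
  rw [Finset.sum_add_distrib, Finset.sum_comm, Finset.sum_comm (s := Finset.univ (α := S))]
  simp [CharTwo.add_self_eq_zero]

/-- The graph of trapezoids has at most `n - 1` independent cycles if the boundary consists of `n`
curves. -/
theorem card_trap_add_two_le {n : ℕ} (rep : Fin n → S)
    (hrep : ∀ s, ∃ i, ∃ k : ℕ, D.next^[k] (rep i) = s) [Nonempty S] :
    Nat.card D.Trap + 2 ≤ Nat.card S + n := by
  classical
  have hconst : ∀ Z : D.Trap → ZMod 2, IsCycle Z → ∀ i (k : ℕ),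
      sideCount Z (D.next^[k] (rep i)) = sideCount Z (rep i) := by
    intro Z hZ i k
    induction k with
    | zero => rfl
    | succ k ih => rw [Function.iterate_succ_apply', sideCount_next hZ, ih]
  obtain ⟨s₀, hs₀⟩ := exists_sideCount_eq_zero (D := D)
  obtain ⟨i₀, k₀, hk₀⟩ := hrep s₀
  let f : LinearMap.ker D.boundaryMap →ₗ[ZMod 2] ({i // i ≠ i₀} → ZMod 2) :=
    (D.sideCountMap fun i : {i // i ≠ i₀} => rep i) ∘ₗ (LinearMap.ker D.boundaryMap).subtype
  have hf : Function.Injective f := by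
    rw [injective_iff_map_eq_zero]
    rintro ⟨Z, hZ⟩ h
    have hZ' := mem_ker_boundaryMap.1 hZ
    refine Subtype.ext (eq_zero_of_sideCount_eq_zero hZ' fun s => ?_)
    obtain ⟨i, k, rfl⟩ := hrep s
    rw [hconst Z hZ']
    by_cases hi : i = i₀
    · rw [hi, ← hconst Z hZ' i₀ k₀, hk₀, hs₀ Z hZ']
    · exact congrFun h ⟨i, hi⟩
  have h1 := LinearMap.finrank_le_finrank_of_injective hf
  obtain ⟨v₀⟩ := ‹Nonempty S›
  let g : (D.Trap → ZMod 2) →ₗ[ZMod 2] ({v // v ≠ v₀} → ZMod 2) :=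
    LinearMap.funLeft (ZMod 2) (ZMod 2) (fun v : {v // v ≠ v₀} => (v : S)) ∘ₗ D.boundaryMap
  have hg : LinearMap.ker g ≤ LinearMap.ker D.boundaryMap := by
    intro Z hZ
    have h0 : ∀ v, v ≠ v₀ → D.boundaryMap Z v = 0 := fun v hv =>
      congrFun (LinearMap.mem_ker.1 hZ) ⟨v, hv⟩
    have hsum := sum_boundaryMap Z
    rw [Finset.sum_eq_single v₀ (fun v _ hv => h0 v hv) (by simp)] at hsum
    rw [LinearMap.mem_ker]
    funext v
    by_cases hv : v = v₀
    · rw [hv]; exact hsum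
    · exact h0 v hv
  have h2 := Submodule.finrank_mono hg
  have h3 := LinearMap.finrank_range_add_finrank_ker g
  have h4 := Submodule.finrank_le (LinearMap.range g)
  simp only [Module.finrank_fintype_fun_eq_card, Fintype.card_subtype_compl,
    Fintype.card_unique, Fintype.card_fin, ne_eq] at h1 h3 h4
  have h5 : 0 < Fintype.card S := Fintype.card_pos_iff.2 ⟨v₀⟩
  have h6 : 0 < n := i₀.pos
  simp only [Nat.card_eq_fintype_card]
  omega

end Betti

end SegRegion

/-! ### Homotopy types of finite graphs -/

/-- A directed multigraph. -/
structure Multigraph where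
  /-- the vertices -/
  V : Type
  /-- the edges -/
  E : Type
  /-- the start of an edge -/
  src : E → V
  /-- the end of an edge -/
  tgt : E → V

namespace Multigraph

open unitInterval

variable (G : Multigraph)

instance : TopologicalSpace (G.V ⊕ G.E) := ⊥
instance : DiscreteTopology (G.V ⊕ G.E) := ⟨rfl⟩

/-- The identifications that turn a disjoint union of intervals, one for each vertex and one for
each edge, into the realization of the graph: the intervals of the vertices are collapsed, and the
ends of the intervals of the edges are glued to the vertices. -/
inductive Rel : (G.V ⊕ G.E) × I → (G.V ⊕ G.E) × I → Prop
  | vert (v : G.V) (τ : I) : Rel (Sum.inl v, τ) (Sum.inl v, 0)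
  | src (e : G.E) : Rel (Sum.inr e, 0) (Sum.inl (G.src e), 0)
  | tgt (e : G.E) : Rel (Sum.inr e, 1) (Sum.inl (G.tgt e), 0)

/-- The geometric realization of a multigraph. -/
abbrev Realization : Type := Quot G.Rel

variable {G}

/-- The point of the realization that belongs to a vertex. -/
def pt (v : G.V) : G.Realization := Quot.mk _ (Sum.inl v, 0)

/-- The arc in the realization that belongs to an edge. -/
def arc (e : G.E) (τ : I) : G.Realization := Quot.mk _ (Sum.inr e, τ)

@[simp] theorem arc_zero (e : G.E) : arc e 0 = pt (G.src e) := Quot.sound (Rel.src e)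

@[simp] theorem arc_one (e : G.E) : arc e 1 = pt (G.tgt e) := Quot.sound (Rel.tgt e)

theorem mk_inl (v : G.V) (τ : I) : (Quot.mk _ (Sum.inl v, τ) : G.Realization) = pt v :=
  Quot.sound (Rel.vert v τ)

@[fun_prop] theorem continuous_arc (e : G.E) : Continuous (arc e) :=
  continuous_quot_mk.comp (by fun_prop)

theorem exists_pt_or_arc (x : G.Realization) : (∃ v, pt v = x) ∨ ∃ e τ, arc e τ = x := by
  obtain ⟨⟨v | e, τ⟩⟩ := x
  · exact Or.inl ⟨v, (mk_inl v τ).symm⟩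
  · exact Or.inr ⟨e, τ, rfl⟩

variable {Y : Type*}

/-- The map from the realization that is given by images of the vertices and of the edges. -/
def lift (a : G.V → Y) (p : G.E → I → Y) (h0 : ∀ e, p e 0 = a (G.src e))
    (h1 : ∀ e, p e 1 = a (G.tgt e)) : G.Realization → Y :=
  Quot.lift (fun k => Sum.elim (fun v => a v) (fun e => p e k.2) k.1) (by
    rintro _ _ (⟨v, τ⟩ | ⟨e⟩ | ⟨e⟩)
    exacts [rfl, h0 e, h1 e])

@[simp] theorem lift_pt {a : G.V → Y} {p : G.E → I → Y} {h0 h1} (v : G.V) :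
    lift a p h0 h1 (pt v) = a v := rfl

@[simp] theorem lift_arc {a : G.V → Y} {p : G.E → I → Y} {h0 h1} (e : G.E) (τ : I) :
    lift a p h0 h1 (arc e τ) = p e τ := rfl

variable [TopologicalSpace Y]

theorem continuous_of_arc {f : G.Realization → Y} (h : ∀ e, Continuous fun τ => f (arc e τ)) :
    Continuous f := by
  refine continuous_coinduced_dom.2 (continuous_prod_of_discrete_left.2 ?_)
  rintro (v | e)
  · have : (fun τ : I => f (Quot.mk _ (Sum.inl v, τ))) = fun _ => f (pt v) := by
      funext τ; rw [mk_inl]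
    exact (continuous_const (y := f (pt v))).congr fun τ => (congrFun this τ).symm
  · exact h e

theorem continuous_homotopy {H : I × G.Realization → Y} (hv : ∀ v, Continuous fun θ => H (θ, pt v))
    (he : ∀ e, Continuous fun p : I × I => H (p.1, arc e p.2)) : Continuous H := by
  refine (isQuotientMap_quot_mk (r := G.Rel)).continuous_lift_prod_right ?_
  have h2 : Continuous fun p : ((G.V ⊕ G.E) × I) × I => H (p.2, Quot.mk _ p.1) := by
    have h3 : Continuous fun p : (G.V ⊕ G.E) × (I × I) => H (p.2.2, Quot.mk _ (p.1, p.2.1)) := by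
      refine continuous_prod_of_discrete_left.2 ?_
      rintro (v | e)
      · have : (fun τ : I × I => H (τ.2, Quot.mk _ (Sum.inl v, τ.1))) =
            fun τ => H (τ.2, pt v) := by funext τ; rw [mk_inl]
        rw [this]; exact (hv v).comp continuous_snd
      · exact (he e).comp continuous_swap
    exact h3.comp (Homeomorph.prodAssoc _ _ _).continuous
  exact h2.comp continuous_swap

/-! ### Collapsing an edge -/

section Collapse

open Classical in
/-- The vertex map of the collapse of the edge `e₀` that is not a loop. -/
noncomputable def collapseVertex (e₀ : G.E) (h : G.src e₀ ≠ G.tgt e₀) (v : G.V) :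
    {v // v ≠ G.tgt e₀} := if hv : v = G.tgt e₀ then ⟨G.src e₀, h⟩ else ⟨v, hv⟩

/-- The graph that arises by collapsing the edge `e₀`, which is not a loop. -/
noncomputable def collapse (e₀ : G.E) (h : G.src e₀ ≠ G.tgt e₀) : Multigraph where
  V := {v // v ≠ G.tgt e₀}
  E := {e // e ≠ e₀}
  src e := collapseVertex e₀ h (G.src e)
  tgt e := collapseVertex e₀ h (G.tgt e)

variable (e₀ : G.E) (h : G.src e₀ ≠ G.tgt e₀)

open Classical in
/-- The track of a vertex when the edge `e₀` is contracted to its start. -/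
noncomputable def track (e₀ : G.E) (v : G.V) (θ : I) : G.Realization :=
  if v = G.tgt e₀ then arc e₀ (symm θ) else pt v

theorem continuous_track (v : G.V) : Continuous (track e₀ v) := by
  unfold track; split_ifs <;> fun_prop

@[simp] theorem track_zero (v : G.V) : track e₀ v 0 = pt v := by
  unfold track; split_ifs with hv <;> simp [hv]

theorem track_one (v : G.V) : track e₀ v 1 = pt (collapseVertex e₀ h v : {v // v ≠ G.tgt e₀}) := by
  unfold track collapseVertex; split_ifs with hv <;> simp

/-- An edge, prolonged on both sides by the tracks of its ends. -/
noncomputable def prolong (e₀ e : G.E) (u : ℝ) : G.Realization :=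
  if u ≤ 0 then track e₀ (G.src e) (projIcc 0 1 zero_le_one (-u))
  else if u ≤ 1 then arc e (projIcc 0 1 zero_le_one u)
  else track e₀ (G.tgt e) (projIcc 0 1 zero_le_one (u - 1))

theorem continuous_prolong (e : G.E) : Continuous (prolong e₀ e) := by
  refine Continuous.if_le ((continuous_track e₀ _).comp (continuous_projIcc.comp (by fun_prop)))
    (Continuous.if_le ((continuous_arc e).comp continuous_projIcc)
      ((continuous_track e₀ _).comp (continuous_projIcc.comp (by fun_prop))) continuous_id
      continuous_const ?_) continuous_id continuous_const ?_
  · rintro u rfl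
    simp [projIcc_right]
  · rintro u rfl
    simp [projIcc_left]

theorem prolong_coe (e : G.E) (τ : I) : prolong e₀ e τ = arc e τ := by
  unfold prolong
  split_ifs with h1 h2
  · have : τ = 0 := le_antisymm h1 τ.2.1
    subst this; simp [projIcc_left]
  · rw [projIcc_val]
  · exact absurd τ.2.2 h2

theorem prolong_neg (e : G.E) (θ : I) : prolong e₀ e (-θ) = track e₀ (G.src e) θ := by
  unfold prolong
  rw [if_pos (neg_nonpos.2 θ.2.1), neg_neg, projIcc_val]

theorem prolong_one_add (e : G.E) (θ : I) : prolong e₀ e (1 + θ) = track e₀ (G.tgt e) θ := by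
  rcases eq_or_ne θ 0 with rfl | h
  · have := prolong_coe e₀ e 1
    simpa using this
  have hθ : (0 : ℝ) < θ := lt_of_le_of_ne θ.2.1 fun h' => h (Subtype.ext h'.symm)
  unfold prolong
  rw [if_neg (by linarith), if_neg (by linarith), add_sub_cancel_left, projIcc_val]

/-- The collapse map. -/
noncomputable def collapseMap : G.Realization → (collapse e₀ h).Realization := open Classical in
  lift (fun v => pt (G := collapse e₀ h) (collapseVertex e₀ h v))
    (fun e τ => if he : e = e₀ then pt (G := collapse e₀ h) ⟨G.src e₀, h⟩
      else arc (G := collapse e₀ h) ⟨e, he⟩ τ)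
    (by
      intro e
      split_ifs with he
      · subst he; simp [collapseVertex, h]
      · exact arc_zero (G := collapse e₀ h) _)
    (by
      intro e
      split_ifs with he
      · subst he; simp [collapseVertex]
      · exact arc_one (G := collapse e₀ h) _)

theorem collapseMap_pt (v : G.V) :
    collapseMap e₀ h (pt v) = pt (G := collapse e₀ h) (collapseVertex e₀ h v) := rfl

theorem collapseMap_arc_self (τ : I) :
    collapseMap e₀ h (arc e₀ τ) = pt (G := collapse e₀ h) ⟨G.src e₀, h⟩ := by
  simp [collapseMap]

theorem collapseMap_arc {e : G.E} (he : e ≠ e₀) (τ : I) :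
    collapseMap e₀ h (arc e τ) = arc (G := collapse e₀ h) ⟨e, he⟩ τ := by
  simp [collapseMap, he]

theorem continuous_collapseMap : Continuous (collapseMap e₀ h) := by
  refine continuous_of_arc fun e => ?_
  by_cases he : e = e₀
  · subst he; simp only [collapseMap_arc_self]; exact continuous_const
  · simp only [collapseMap_arc e₀ h he]; exact continuous_arc _

theorem collapseMap_track (v : G.V) (θ : I) :
    collapseMap e₀ h (track e₀ v θ) = pt (G := collapse e₀ h) (collapseVertex e₀ h v) := by
  unfold track
  split_ifs with hv
  · rw [collapseMap_arc_self, collapseVertex, dif_pos hv]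
  · rfl

/-- A homotopy inverse of the collapse map, which prolongs every edge at the end of `e₀` by a
detour along `e₀`. -/
noncomputable def expandMap : (collapse e₀ h).Realization → G.Realization :=
  lift (G := collapse e₀ h) (fun v => pt v.1) (fun e τ => prolong e₀ e.1 (3 * τ - 1))
    (fun e => by
      have := prolong_neg e₀ e.1 1
      rw [track_one e₀ h] at this
      norm_num at this
      norm_num
      exact this)
    (fun e => by
      have := prolong_one_add e₀ e.1 1
      rw [track_one e₀ h] at this
      norm_num at this
      norm_num
      exact this)

theorem continuous_expandMap : Continuous (expandMap e₀ h) :=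
  continuous_of_arc fun e => (continuous_prolong e₀ e.1).comp (by fun_prop)

open Classical in
/-- The deformation of the identity that contracts `e₀` to its start. -/
noncomputable def contraction (θ : I) : G.Realization → G.Realization :=
  lift (fun v => track e₀ v θ)
    (fun e τ => if e = e₀ then arc e₀ (symm θ * τ) else prolong e₀ e ((1 + 2 * θ) * τ - θ))
    (by
      intro e
      split_ifs with he
      · subst he; simp [track, h]
      · simpa using prolong_neg e₀ e θ)
    (by
      intro e
      split_ifs with he
      · subst he; simp [track]
      · have := prolong_one_add e₀ e θ
        rw [← this]; congr 1; simp; ring)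

/-- The deformation of the identity of the collapsed graph to the composite of `expandMap` and
`collapseMap`. -/
noncomputable def contractionCollapsed (θ : I) :
    (collapse e₀ h).Realization → (collapse e₀ h).Realization :=
  lift (G := collapse e₀ h) (fun v => pt v)
    (fun e τ => collapseMap e₀ h (prolong e₀ e.1 ((1 + 2 * θ) * τ - θ)))
    (by
      intro e
      have := prolong_neg e₀ e.1 θ
      simp only [Icc.coe_zero, mul_zero, zero_sub]
      rw [this, collapseMap_track]; rfl)
    (by
      intro e
      have := prolong_one_add e₀ e.1 θ
      have h2 : (1 + 2 * (θ : ℝ)) * ((1 : I) : ℝ) - θ = 1 + θ := by simp; ring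
      rw [h2, this, collapseMap_track]; rfl)

/-- Collapsing an edge that is not a loop is a homotopy equivalence. -/
theorem nonempty_homotopyEquiv_collapse :
    Nonempty (ContinuousMap.HomotopyEquiv G.Realization (collapse e₀ h).Realization) := by
  refine ⟨⟨⟨collapseMap e₀ h, continuous_collapseMap e₀ h⟩,
    ⟨expandMap e₀ h, continuous_expandMap e₀ h⟩,
    ⟨ContinuousMap.Homotopy.symm ⟨⟨fun p => contraction e₀ h p.1 p.2, ?_⟩, ?_, ?_⟩⟩,
    ⟨ContinuousMap.Homotopy.symm ⟨⟨fun p => contractionCollapsed e₀ h p.1 p.2, ?_⟩, ?_, ?_⟩⟩⟩⟩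
  · refine continuous_homotopy (fun v => continuous_track e₀ v) fun e => ?_
    by_cases he : e = e₀
    · simp only [contraction, lift_arc, he, if_true]
      exact (continuous_arc e₀).comp (by fun_prop)
    · simp only [contraction, lift_arc, he, if_false]
      exact (continuous_prolong e₀ e).comp (by fun_prop)
  · intro x
    rcases exists_pt_or_arc x with ⟨v, rfl⟩ | ⟨e, τ, rfl⟩
    · simp [contraction]
    · by_cases he : e = e₀
      · simp [contraction, he]
      · simp [contraction, he, prolong_coe]
  · intro x
    rcases exists_pt_or_arc x with ⟨v, rfl⟩ | ⟨e, τ, rfl⟩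
    · simp only [contraction, lift_pt, track_one e₀ h]; rfl
    · by_cases he : e = e₀
      · subst he
        simp only [contraction, lift_arc, if_true, ContinuousMap.comp_apply, ContinuousMap.coe_mk,
          collapseMap_arc_self]
        simp only [symm_one, zero_mul, arc_zero]; rfl
      · simp only [contraction, lift_arc, he, if_false, ContinuousMap.comp_apply,
          ContinuousMap.coe_mk, collapseMap_arc e₀ h he]
        simp only [expandMap]
        refine congrArg (prolong e₀ e) ?_
        rw [Icc.coe_one]; ring
  · refine continuous_homotopy (fun v => continuous_const) fun e => ?_
    exact (continuous_collapseMap e₀ h).comp ((continuous_prolong e₀ e.1).comp (by fun_prop))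
  · intro x
    rcases exists_pt_or_arc x with ⟨v, rfl⟩ | ⟨e, τ, rfl⟩
    · rfl
    · have : collapseMap e₀ h (prolong e₀ e.1 τ) = arc e τ := by
        rw [prolong_coe, collapseMap_arc e₀ h e.2]; rfl
      simpa [contractionCollapsed] using this
  · intro x
    rcases exists_pt_or_arc x with ⟨v, rfl⟩ | ⟨e, τ, rfl⟩
    · have : collapseVertex e₀ h v.1 = v := dif_neg v.2
      simp only [contractionCollapsed, lift_pt, ContinuousMap.comp_apply, ContinuousMap.coe_mk,
        expandMap, collapseMap_pt]
      rw [this]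
    · simp only [contractionCollapsed, lift_arc, ContinuousMap.comp_apply, ContinuousMap.coe_mk,
        expandMap]
      refine congrArg (fun u => collapseMap e₀ h (prolong e₀ e.1 u)) ?_
      rw [Icc.coe_one]; ring

end Collapse

/-! ### Classification of connected finite graphs up to homotopy -/

/-- Connectedness of a multigraph: a property of vertices that is inherited along edges in both
directions holds for all vertices or for none. -/
def IsConn (G : Multigraph) : Prop :=
  ∀ p : G.V → Prop, (∀ e, p (G.src e) ↔ p (G.tgt e)) → ∀ v w, p v → p w

theorem IsConn.collapse (hG : G.IsConn) (e₀ : G.E) (h : G.src e₀ ≠ G.tgt e₀) :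
    (collapse e₀ h).IsConn := by
  intro p hp v w hv
  have hr : ∀ u : {v // v ≠ G.tgt e₀}, collapseVertex e₀ h u.1 = u := fun u => by
    rw [collapseVertex, dif_neg u.2]
  have := hG (fun u => p (collapseVertex e₀ h u)) (fun e => by
    by_cases he : e = e₀
    · subst he; simp [collapseVertex, h]
    · exact hp ⟨e, he⟩) v.1 w.1 ((congrArg p (hr v)).mpr hv)
  exact (congrArg p (hr w)).mp this

/-- By collapsing edges that are not loops, a connected finite graph is reduced to a graph with one
vertex. -/
theorem exists_rose (m : ℕ) : ∀ (G : Multigraph) [Finite G.V] [Finite G.E], G.IsConn →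
    Nat.card G.V = m + 1 → ∃ R : Multigraph, Finite R.E ∧ Nat.card R.V = 1 ∧
      Nat.card R.E + m = Nat.card G.E ∧
      Nonempty (ContinuousMap.HomotopyEquiv G.Realization R.Realization) := by
  induction m with
  | zero => exact fun G _ hE _ hm => ⟨G, hE, hm, rfl, ⟨ContinuousMap.HomotopyEquiv.refl _⟩⟩
  | succ m ih =>
    intro G _ _ hG hm
    have hloop : ∃ e₀, G.src e₀ ≠ G.tgt e₀ := by
      by_contra! hl
      obtain ⟨v, w, hvw⟩ : ∃ v w : G.V, v ≠ w := by
        have : Nontrivial G.V := Finite.one_lt_card_iff_nontrivial.1 (by omega)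
        exact exists_pair_ne _
      exact hvw (hG (fun u => u = v) (fun e => by rw [hl e]) v w rfl).symm
    obtain ⟨e₀, h⟩ := hloop
    have : Finite (collapse e₀ h).V := inferInstanceAs (Finite {v // v ≠ G.tgt e₀})
    have : Finite (collapse e₀ h).E := inferInstanceAs (Finite {e // e ≠ e₀})
    have hV : Nat.card (collapse e₀ h).V + 1 = Nat.card G.V := by
      classical
      have := Fintype.ofFinite G.V
      have h0 : 0 < Fintype.card G.V := Fintype.card_pos_iff.2 ⟨G.tgt e₀⟩
      change Nat.card {v // v ≠ G.tgt e₀} + 1 = _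
      rw [Nat.card_eq_fintype_card, Nat.card_eq_fintype_card, Fintype.card_subtype_compl]
      simp; omega
    have hE : Nat.card (collapse e₀ h).E + 1 = Nat.card G.E := by
      classical
      have := Fintype.ofFinite G.E
      have h0 : 0 < Fintype.card G.E := Fintype.card_pos_iff.2 ⟨e₀⟩
      change Nat.card {e // e ≠ e₀} + 1 = _
      rw [Nat.card_eq_fintype_card, Nat.card_eq_fintype_card, Fintype.card_subtype_compl]
      simp; omega
    obtain ⟨R, h1, h2, h3, ⟨h4⟩⟩ := ih (collapse e₀ h) (hG.collapse e₀ h) (by omega)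
    obtain ⟨h5⟩ := nonempty_homotopyEquiv_collapse e₀ h
    exact ⟨R, h1, h2, by omega, ⟨h5.trans h4⟩⟩

/-- Graphs with one vertex and equally many edges have homotopy equivalent realizations. -/
theorem nonempty_homotopyEquiv_rose {R R' : Multigraph} [Finite R.E] [Finite R'.E]
    (h1 : Nat.card R.V = 1) (h1' : Nat.card R'.V = 1) (h : Nat.card R.E = Nat.card R'.E) :
    Nonempty (ContinuousMap.HomotopyEquiv R.Realization R'.Realization) := by
  obtain ⟨hs, ⟨v⟩⟩ := Nat.card_eq_one_iff_unique.1 h1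
  obtain ⟨hs', ⟨v'⟩⟩ := Nat.card_eq_one_iff_unique.1 h1'
  let ε : R.E ≃ R'.E := (Finite.card_eq.1 h).some
  let f : R.Realization → R'.Realization := lift (fun _ => pt v') (fun e τ => arc (ε e) τ)
    (fun e => by rw [arc_zero]; congr 1; exact Subsingleton.elim _ _)
    (fun e => by rw [arc_one]; congr 1; exact Subsingleton.elim _ _)
  let g : R'.Realization → R.Realization := lift (fun _ => pt v) (fun e τ => arc (ε.symm e) τ)
    (fun e => by rw [arc_zero]; congr 1; exact Subsingleton.elim _ _)
    (fun e => by rw [arc_one]; congr 1; exact Subsingleton.elim _ _)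
  have hf : Continuous f := continuous_of_arc fun e => continuous_arc _
  have hg : Continuous g := continuous_of_arc fun e => continuous_arc _
  refine ⟨⟨⟨f, hf⟩, ⟨g, hg⟩, ?_, ?_⟩⟩
  · have : (ContinuousMap.mk g hg).comp ⟨f, hf⟩ = ContinuousMap.id _ := by
      ext x
      rcases exists_pt_or_arc x with ⟨w, rfl⟩ | ⟨e, τ, rfl⟩
      · exact congrArg pt (Subsingleton.elim _ _)
      · exact congrArg (fun e => arc e τ) (ε.symm_apply_apply e)
    rw [this]
  · have : (ContinuousMap.mk f hf).comp ⟨g, hg⟩ = ContinuousMap.id _ := by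
      ext x
      rcases exists_pt_or_arc x with ⟨w, rfl⟩ | ⟨e, τ, rfl⟩
      · exact congrArg pt (Subsingleton.elim _ _)
      · exact congrArg (fun e => arc e τ) (ε.apply_symm_apply e)
    rw [this]

/-- Connected finite graphs with the same Euler characteristic have homotopy equivalent
realizations. -/
theorem nonempty_homotopyEquiv {G G' : Multigraph} [Finite G.V] [Finite G.E] [Finite G'.V]
    [Finite G'.E] [Nonempty G.V] [Nonempty G'.V] (hG : G.IsConn) (hG' : G'.IsConn)
    (h : Nat.card G.E + Nat.card G'.V = Nat.card G'.E + Nat.card G.V) :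
    Nonempty (ContinuousMap.HomotopyEquiv G.Realization G'.Realization) := by
  obtain ⟨m, hm⟩ := Nat.exists_eq_succ_of_ne_zero (Nat.card_pos (α := G.V)).ne'
  obtain ⟨m', hm'⟩ := Nat.exists_eq_succ_of_ne_zero (Nat.card_pos (α := G'.V)).ne'
  obtain ⟨R, _, h2, h3, ⟨h4⟩⟩ := exists_rose m G hG hm
  obtain ⟨R', _, h2', h3', ⟨h4'⟩⟩ := exists_rose m' G' hG' hm'
  obtain ⟨k⟩ := nonempty_homotopyEquiv_rose h2 h2' (by omega)
  exact ⟨(h4.trans k).trans h4'.symm⟩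

/-- A connected finite graph has at least as many edges as a tree. -/
theorem IsConn.card_le {G : Multigraph} [Finite G.V] [Finite G.E] [Nonempty G.V] (hG : G.IsConn) :
    Nat.card G.V ≤ Nat.card G.E + 1 := by
  obtain ⟨m, hm⟩ := Nat.exists_eq_succ_of_ne_zero (Nat.card_pos (α := G.V)).ne'
  obtain ⟨R, _, h2, h3, -⟩ := exists_rose m G hG hm
  omega

end Multigraph

namespace PolygonalRegion

variable {n : ℕ} (P : PolygonalRegion n)

/-! ### Polygons in general position as regions bounded by segments -/

theorem edgePath_zero (i : Fin n) (a : Fin (P.size i)) :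
    (P.bdry i).edgePath ℝ a 0 = (P.bdry i).vertices a := by simp [Polygon.edgePath]

theorem edgePath_one (i : Fin n) (a : Fin (P.size i)) :
    (P.bdry i).edgePath ℝ a 1 = (P.bdry i).vertices (finRotate _ a) := by simp [Polygon.edgePath]

theorem mem_edgeSet {i : Fin n} {a : Fin (P.size i)} {p : ℝ × ℝ} :
    p ∈ segment ℝ ((P.bdry i).vertices a) ((P.bdry i).vertices (finRotate _ a)) ↔
      ∃ θ ∈ Icc (0 : ℝ) 1, (P.bdry i).edgePath ℝ a θ = p := by
  rw [← affineSegment_eq_segment]; rfl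

theorem boundary_eq (i : Fin n) : (P.bdry i).boundary ℝ = ⋃ a, segment ℝ ((P.bdry i).vertices a)
    ((P.bdry i).vertices (finRotate _ a)) := by
  unfold Polygon.boundary Polygon.edgeSet
  simp only [affineSegment_eq_segment]

theorem vertex_injective (hP : P.InGeneralPosition) : Function.Injective
    fun s : Σ i, Fin (P.size i) => ((P.bdry s.1).vertices s.2).2 := by
  rintro ⟨i, a⟩ ⟨j, b⟩ h
  have hv : (P.bdry i).vertices a = (P.bdry j).vertices b := by
    by_contra hne
    exact hP _ ⟨i, a, rfl⟩ _ ⟨j, b, rfl⟩ hne h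
  have hij : i = j := by
    by_contra hne
    have hmem : ∀ i (a : Fin (P.size i)), (P.bdry i).vertices a ∈ (P.bdry i).boundary ℝ := by
      intro i a
      rw [boundary_eq]
      exact mem_iUnion.2 ⟨a, left_mem_segment ℝ _ _⟩
    exact disjoint_left.1 (P.disjoint i j hne) (hmem i a) (hv ▸ hmem j b)
  subst hij
  rw [((P.isSimple i).2 a b 0 (by simp) 0 (by simp)
    (by rw [edgePath_zero, edgePath_zero, hv])).1]

/-- A polygon in general position as a region bounded by non-horizontal segments. -/
def toSeg (hP : P.InGeneralPosition) : SegRegion (Σ i, Fin (P.size i)) where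
  M := P.carrier
  isCompact := P.isCompact
  nonempty := P.isConnected.nonempty
  closure_interior := P.closure_interior
  next := Equiv.sigmaCongrRight fun i => finRotate (P.size i)
  pt s := (P.bdry s.1).vertices s.2
  height_injective := P.vertex_injective hP
  next_ne := by
    rintro ⟨i, a⟩ h
    have ha : finRotate _ a = a := by simpa using h
    have := ((P.isSimple i).2 a a 0 (by simp) (1 / 2) (by norm_num)
      (by simp [Polygon.edgePath, ha])).2
    norm_num at this
  frontier_eq := by
    rw [P.frontier_eq, iUnion_sigma]
    exact iUnion_congr fun i => P.boundary_eq i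
  eq_of_mem_segment := by
    rintro ⟨i, a⟩ ⟨j, b⟩ hne p hs ht
    replace hs : p ∈ segment ℝ ((P.bdry i).vertices a) ((P.bdry i).vertices (finRotate _ a)) := hs
    replace ht : p ∈ segment ℝ ((P.bdry j).vertices b) ((P.bdry j).vertices (finRotate _ b)) := ht
    have hij : i = j := by
      by_contra hne
      have h1 : p ∈ (P.bdry i).boundary ℝ := by rw [boundary_eq]; exact mem_iUnion.2 ⟨a, hs⟩
      have h2 : p ∈ (P.bdry j).boundary ℝ := by rw [boundary_eq]; exact mem_iUnion.2 ⟨b, ht⟩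
      exact disjoint_left.1 (P.disjoint i j hne) h1 h2
    subst hij
    have hab : a ≠ b := fun h => hne (by rw [h])
    obtain ⟨θ, ⟨h0, h1⟩, rfl⟩ := P.mem_edgeSet.1 hs
    obtain ⟨τ, ⟨k0, k1⟩, hp⟩ := P.mem_edgeSet.1 ht
    have inj := (P.isSimple i).2
    rcases h1.eq_or_lt with rfl | h1 <;> rcases k1.eq_or_lt with rfl | k1
    · rw [edgePath_one, edgePath_one, ← edgePath_zero, ← edgePath_zero P] at hp
      have := (inj _ _ 0 (by simp) 0 (by simp) hp).1
      exact absurd ((finRotate _).injective this).symm hab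
    · rw [edgePath_one, ← edgePath_zero] at hp
      obtain ⟨e1, rfl⟩ := inj _ _ τ ⟨k0, k1⟩ 0 (by simp) hp
      right
      refine ⟨?_, ?_⟩
      · change _ = (P.bdry i).vertices b
        rw [edgePath_one, e1]
      · change (⟨i, finRotate _ a⟩ : Σ i, Fin (P.size i)) = _
        rw [e1]
    · rw [edgePath_one, ← edgePath_zero] at hp
      obtain ⟨e1, rfl⟩ := inj _ _ 0 (by simp) θ ⟨h0, h1⟩ hp
      left
      refine ⟨?_, ?_⟩
      · change _ = (P.bdry i).vertices a
        rw [edgePath_zero]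
      · change (⟨i, finRotate _ b⟩ : Σ i, Fin (P.size i)) = _
        rw [e1]
    · exact absurd (inj _ _ θ ⟨h0, h1⟩ τ ⟨k0, k1⟩ hp.symm).1 hab

/-- Every vertex is reached from the first vertex of its boundary curve. -/
theorem exists_iterate_next (hP : P.InGeneralPosition) (s : Σ i, Fin (P.size i)) :
    ∃ i, ∃ k : ℕ, (P.toSeg hP).next^[k]
      (⟨i, ⟨0, by have := (P.isSimple i).1; omega⟩⟩ : Σ i, Fin (P.size i)) = s := by
  obtain ⟨i, a⟩ := s
  refine ⟨i, a, ?_⟩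
  have key : ∀ (m : ℕ) (h : 0 < m) (k : ℕ) (hk : k < m), (finRotate m)^[k] ⟨0, h⟩ = ⟨k, hk⟩ := by
    intro m h k hk
    induction k with
    | zero => rfl
    | succ k ih =>
      rw [Function.iterate_succ_apply', ih (by omega)]
      obtain ⟨m, rfl⟩ := Nat.exists_eq_succ_of_ne_zero h.ne'
      exact finRotate_of_lt (by omega)
  have key2 : ∀ (k : ℕ) (b : Fin (P.size i)), (P.toSeg hP).next^[k]
      (⟨i, b⟩ : Σ i, Fin (P.size i)) = ⟨i, (finRotate _)^[k] b⟩ := by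
    intro k b
    induction k with
    | zero => rfl
    | succ k ih => rw [Function.iterate_succ_apply', ih, Function.iterate_succ_apply']; rfl
  rw [key2, key _ _ a a.2]

/-! ### The topology of the Reeb graph -/

variable (hP : P.InGeneralPosition)

/-- The projection to the Reeb graph. -/
def proj (x : P.carrier) : P.Reeb := Quotient.mk _ x

variable {P}

theorem continuous_proj : Continuous P.proj := continuous_quotient_mk'

theorem proj_surjective : Function.Surjective P.proj := Quotient.mk_surjective

theorem proj_eq_iff {x y : P.carrier} : P.proj x = P.proj y ↔ (x : ℝ × ℝ).2 = (y : ℝ × ℝ).2 ∧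
    (P.toSeg hP).Horiz (x : ℝ × ℝ).1 (y : ℝ × ℝ).1 (x : ℝ × ℝ).2 := by
  have h1 : P.proj x = P.proj y ↔ P.fiber x = P.fiber y := Quotient.eq
  rw [h1]
  constructor
  · intro h
    refine ⟨P.snd_eq_of_fiber_eq x y h, fun z hz => ?_⟩
    have hx : (x : ℝ × ℝ) ∈ P.fiber x := mem_connectedComponentIn ⟨x.2, rfl⟩
    have hy : (y : ℝ × ℝ) ∈ P.fiber x := h ▸ mem_connectedComponentIn ⟨y.2, rfl⟩
    have hpre : (Prod.fst '' P.fiber x).OrdConnected :=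
      (isPreconnected_connectedComponentIn.image Prod.fst continuous_fst.continuousOn).ordConnected
    obtain ⟨p, hp, rfl⟩ := hpre.uIcc_subset ⟨_, hx, rfl⟩ ⟨_, hy, rfl⟩ hz
    obtain ⟨hp1, hp2⟩ := connectedComponentIn_subset _ _ hp
    have : p = (p.1, (x : ℝ × ℝ).2) := Prod.ext rfl hp2
    rw [this] at hp1
    exact hp1
  · rintro ⟨h1, h2⟩
    unfold fiber
    rw [← h1]
    refine connectedComponentIn_eq ?_
    have hpre : IsPreconnected ((fun z => (z, (x : ℝ × ℝ).2)) ''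
        uIcc (x : ℝ × ℝ).1 (y : ℝ × ℝ).1) :=
      isPreconnected_uIcc.image _ (by fun_prop)
    refine hpre.subset_connectedComponentIn ⟨_, left_mem_uIcc, rfl⟩ ?_
      ⟨_, right_mem_uIcc, Prod.ext rfl h1⟩
    rintro _ ⟨z, hz, rfl⟩
    exact ⟨h2 z hz, rfl⟩

include hP in
theorem isClosed_rel : IsClosed {p : P.carrier × P.carrier | P.proj p.1 = P.proj p.2} := by
  have : {p : P.carrier × P.carrier | P.proj p.1 = P.proj p.2} =
      {p | (p.1 : ℝ × ℝ).2 = (p.2 : ℝ × ℝ).2} ∩ ⋂ θ ∈ Icc (0 : ℝ) 1,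
        {p | ((p.1 : ℝ × ℝ).1 + θ * ((p.2 : ℝ × ℝ).1 - (p.1 : ℝ × ℝ).1), (p.1 : ℝ × ℝ).2) ∈
          P.carrier} := by
    ext p
    simp only [mem_ofPred_eq, mem_inter_iff, mem_iInter]
    rw [proj_eq_iff hP]
    refine and_congr_right fun _ => ?_
    have hu : uIcc (p.1 : ℝ × ℝ).1 (p.2 : ℝ × ℝ).1 = _ :=
      (segment_eq_uIcc (𝕜 := ℝ) _ _).symm.trans (segment_eq_image' ℝ _ _)
    unfold SegRegion.Horiz
    rw [hu, forall_mem_image]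
    rfl
  rw [this]
  refine IsClosed.inter (isClosed_eq (by fun_prop) (by fun_prop))
    (isClosed_iInter fun θ => isClosed_iInter fun _ => ?_)
  exact P.isCompact.isClosed.preimage
    (f := fun p : P.carrier × P.carrier => ((p.1 : ℝ × ℝ).1 + θ * ((p.2 : ℝ × ℝ).1 -
      (p.1 : ℝ × ℝ).1), (p.1 : ℝ × ℝ).2)) (by fun_prop)

instance : CompactSpace P.carrier := isCompact_iff_compactSpace.1 P.isCompact

instance : ConnectedSpace P.carrier := isConnected_iff_connectedSpace.1 P.isConnected

include hP in
theorem isClosedMap_proj : IsClosedMap P.proj := by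
  intro C hC
  have hq : IsQuotientMap P.proj := isQuotientMap_quot_mk
  rw [← hq.isClosed_preimage]
  have : P.proj ⁻¹' (P.proj '' C) = Prod.snd ''
      ({p : P.carrier × P.carrier | P.proj p.1 = P.proj p.2} ∩ Prod.fst ⁻¹' C) := by
    ext y
    constructor
    · rintro ⟨x, hx, h⟩; exact ⟨(x, y), ⟨h, hx⟩, rfl⟩
    · rintro ⟨⟨x, y⟩, ⟨h, hx⟩, rfl⟩; exact ⟨x, hx, h⟩
  rw [this]
  exact isClosedMap_snd_of_compactSpace _
    ((isClosed_rel hP).inter (hC.preimage continuous_fst))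

include hP in
/-- The Reeb graph is Hausdorff, as the quotient of a compact space by a closed relation. -/
theorem t2Space_reeb : T2Space P.Reeb := by
  refine ⟨fun r s hrs => ?_⟩
  have hcl : ∀ r : P.Reeb, IsClosed (P.proj ⁻¹' {r}) := by
    intro r
    obtain ⟨x, rfl⟩ := proj_surjective r
    have := isClosedMap_proj hP _ (isClosed_singleton (x := x))
    rw [image_singleton] at this
    exact this.preimage continuous_proj
  obtain ⟨U, V, hU, hV, hrU, hsV, hUV⟩ := normal_separation (hcl r) (hcl s)
    ((disjoint_singleton.2 hrs).preimage _)
  refine ⟨(P.proj '' Uᶜ)ᶜ, (P.proj '' Vᶜ)ᶜ, (isClosedMap_proj hP _ hU.isClosed_compl).isOpen_compl,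
    (isClosedMap_proj hP _ hV.isClosed_compl).isOpen_compl, ?_, ?_, ?_⟩
  · rintro ⟨x, hx, h⟩; exact hx (hrU h)
  · rintro ⟨x, hx, h⟩; exact hx (hsV h)
  · rw [disjoint_left]
    intro t h1 h2
    obtain ⟨x, rfl⟩ := proj_surjective t
    have hxU : x ∈ U := by by_contra h; exact h1 ⟨x, h, rfl⟩
    have hxV : x ∈ V := by by_contra h; exact h2 ⟨x, h, rfl⟩
    exact disjoint_left.1 hUV hxU hxV

theorem connectedSpace_reeb : ConnectedSpace P.Reeb := inferInstance

end PolygonalRegion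

/-! ### The straight-line drawing of the Reeb graph -/

namespace SegRegion

variable {S : Type} (D : SegRegion S)

open unitInterval

/-- The graph of trapezoids. -/
def graph : Multigraph where
  V := S
  E := D.Trap
  src q := q.v
  tgt q := q.w

/-- The straight-line drawing of the graph of trapezoids: every edge is drawn as the segment that
joins its two vertices, which lies in the closed trapezoid. -/
def draw : D.graph.Realization → ℝ × ℝ :=
  Multigraph.lift (G := D.graph) (fun v => (D.c v, D.η v))
    (fun q τ => (D.c q.v + τ * (D.c q.w - D.c q.v), D.η q.v + τ * (D.η q.w - D.η q.v)))
    (fun q => by simp [graph]) (fun q => by simp [graph])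

variable {D}

theorem continuous_draw : Continuous D.draw :=
  Multigraph.continuous_of_arc fun q => by
    change Continuous fun τ : I => (D.c q.v + (τ : ℝ) * (D.c q.w - D.c q.v),
      D.η q.v + (τ : ℝ) * (D.η q.w - D.η q.v))
    fun_prop

theorem draw_arc_mem_Icc (q : D.Trap) (τ : I) :
    (D.draw (Multigraph.arc (G := D.graph) q τ)).2 ∈ Icc (D.η q.v) (D.η q.w) ∧
    (D.draw (Multigraph.arc (G := D.graph) q τ)).1 ∈
      Icc (D.xs q.t (D.draw (Multigraph.arc (G := D.graph) q τ)).2)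
        (D.xs q.t' (D.draw (Multigraph.arc (G := D.graph) q τ)).2) := by
  change D.η q.v + τ * (D.η q.w - D.η q.v) ∈ _ ∧ D.c q.v + τ * (D.c q.w - D.c q.v) ∈
    Icc (D.xs q.t (D.η q.v + τ * (D.η q.w - D.η q.v)))
      (D.xs q.t' (D.η q.v + τ * (D.η q.w - D.η q.v)))
  have h0 := τ.2.1
  have h1 : 0 ≤ 1 - (τ : ℝ) := sub_nonneg.2 τ.2.2
  have := q.lt
  rw [xs_lineMap, xs_lineMap]
  refine ⟨⟨?_, ?_⟩, ?_, ?_⟩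
  · nlinarith
  · nlinarith
  · nlinarith [mul_nonneg h1 (sub_nonneg.2 q.bot.1), mul_nonneg h0 (sub_nonneg.2 q.top.1)]
  · nlinarith [mul_nonneg h1 (sub_nonneg.2 q.bot.2), mul_nonneg h0 (sub_nonneg.2 q.top.2)]

theorem draw_arc_mem_Ioo (q : D.Trap) {τ : I} (hτ : τ ∈ Ioo (0 : I) 1) :
    (D.draw (Multigraph.arc (G := D.graph) q τ)).2 ∈ Ioo (D.η q.v) (D.η q.w) := by
  have h0 : (0 : ℝ) < τ := hτ.1
  have h1 : (τ : ℝ) < 1 := hτ.2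
  have := q.lt
  constructor
  · show D.η q.v < D.η q.v + τ * (D.η q.w - D.η q.v)
    nlinarith
  · show D.η q.v + τ * (D.η q.w - D.η q.v) < D.η q.w
    nlinarith

theorem draw_mem (x : D.graph.Realization) : D.draw x ∈ D.M := by
  rcases Multigraph.exists_pt_or_arc x with ⟨v, rfl⟩ | ⟨q, τ, rfl⟩
  · exact pt_mem (D := D) v
  · obtain ⟨h1, h2⟩ := draw_arc_mem_Icc q τ
    exact q.mem _ h1 _ h2

/-- Different points of the drawing lie in different fibers. -/
theorem draw_injective_of_horiz {x y : D.graph.Realization} (h : (D.draw x).2 = (D.draw y).2)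
    (hH : D.Horiz (D.draw x).1 (D.draw y).1 (D.draw x).2) : x = y := by
  have key : ∀ x : D.graph.Realization, (∃ v, Multigraph.pt v = x) ∨
      ∃ q, ∃ τ ∈ Ioo (0 : I) 1, Multigraph.arc q τ = x := by
    intro x
    rcases Multigraph.exists_pt_or_arc x with h | ⟨q, τ, rfl⟩
    · exact Or.inl h
    rcases eq_or_ne τ 0 with rfl | h0
    · exact Or.inl ⟨_, (Multigraph.arc_zero q).symm⟩
    rcases eq_or_ne τ 1 with rfl | h1
    · exact Or.inl ⟨_, (Multigraph.arc_one q).symm⟩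
    · exact Or.inr ⟨q, τ, ⟨unitInterval.pos_iff_ne_zero.2 h0, unitInterval.lt_one_iff_ne_one.2 h1⟩,
        rfl⟩
  have hpa : ∀ (v : S) (q : D.Trap) (τ : I), τ ∈ Ioo (0 : I) 1 →
      D.η v = (D.draw (Multigraph.arc (G := D.graph) q τ)).2 →
      ¬ D.Horiz (D.draw (Multigraph.arc (G := D.graph) q τ)).1 (D.c v)
        (D.draw (Multigraph.arc (G := D.graph) q τ)).2 := by
    intro v q τ hτ h hH
    have h1 := draw_arc_mem_Ioo q hτ
    have h2 := Trap.mem_of_horiz h1 (draw_arc_mem_Icc q τ).2 hH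
    rw [← h] at h1 h2
    exact q.vertex_notMem h1 h2
  rcases key x with ⟨v, rfl⟩ | ⟨q, τ, hτ, rfl⟩ <;> rcases key y with ⟨w, rfl⟩ | ⟨p, ρ, hρ, rfl⟩
  · exact congrArg _ (η_injective (D := D) h)
  · rw [h] at hH
    exact absurd hH.symm (hpa v p ρ hρ h)
  · exact absurd hH (hpa w q τ hτ h.symm)
  · have h1 := draw_arc_mem_Ioo q hτ
    have h2 := draw_arc_mem_Ioo p hρ
    have h3 := (draw_arc_mem_Icc p ρ).2
    rw [← h] at h2 h3
    obtain rfl := Trap.eq_of_horiz h1 h2 (draw_arc_mem_Icc q τ).2 h3 hH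
    replace h : D.η q.v + τ * (D.η q.w - D.η q.v) = D.η q.v + ρ * (D.η q.w - D.η q.v) := h
    have := sub_ne_zero.2 q.lt.ne'
    have : τ = ρ := Subtype.ext (mul_right_cancel₀ this (by linarith))
    rw [this]

/-- Every fiber meets the drawing. -/
theorem exists_draw_horiz [Finite S] {p : ℝ × ℝ} (hp : p ∈ D.M) :
    ∃ x, (D.draw x).2 = p.2 ∧ D.Horiz (D.draw x).1 p.1 (D.draw x).2 := by
  by_cases h : ∃ u, D.η u = p.2 ∧ D.Horiz p.1 (D.c u) p.2
  · obtain ⟨u, h1, h2⟩ := h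
    refine ⟨Multigraph.pt (G := D.graph) u, h1, ?_⟩
    change D.Horiz (D.c u) p.1 (D.η u)
    rw [h1]; exact h2.symm
  · push Not at h
    obtain ⟨q, hy, hx⟩ := exists_trap_of_regular (x := p.1) (y := p.2) hp h
    have hpos : 0 < D.η q.w - D.η q.v := sub_pos.2 q.lt
    let τ : I := ⟨(p.2 - D.η q.v) / (D.η q.w - D.η q.v),
      div_nonneg (sub_nonneg.2 hy.1.le) hpos.le,
      (div_le_one hpos).2 (by linarith [hy.2])⟩
    have he : (D.draw (Multigraph.arc (G := D.graph) q τ)).2 = p.2 := by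
      change D.η q.v + (p.2 - D.η q.v) / (D.η q.w - D.η q.v) * (D.η q.w - D.η q.v) = p.2
      rw [div_mul_cancel₀ _ hpos.ne']; ring
    refine ⟨_, he, ?_⟩
    have h2 := (draw_arc_mem_Icc q τ).2
    rw [he] at h2 ⊢
    exact Trap.horiz (Ioo_subset_Icc_self hy) h2 hx

instance [Finite S] : CompactSpace D.graph.Realization := by
  have : Finite D.graph.V := inferInstanceAs (Finite S)
  have : Finite D.graph.E := inferInstanceAs (Finite D.Trap)
  infer_instance

end SegRegion

/-! ### Degrees and the number of edges -/

namespace SegRegion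

variable {S : Type} {D : SegRegion S}

theorem degrees_reg [Finite S] {v : S} (h : D.Reg v) :
    {q : D.Trap | q.v = v}.ncard = 1 ∧ {q : D.Trap | q.w = v}.ncard = 1 := by
  rw [ncard_start, ncard_end]
  exact ⟨ncard_above_reg h, ncard_above_reg (flip_reg.2 h)⟩

open Classical in
/-- A vertex that is not regular has degree 3 if its fiber extends to the left of it, that is, if the
region lies outside of the angle between its two sides, and degree 1 otherwise. -/
theorem degrees_not_reg [Finite S] {v : S} (h : ¬ D.Reg v) :
    ({q : D.Trap | q.v = v}.ncard = (if D.Lft v then 1 else 0) + 1 ∧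
      {q : D.Trap | q.w = v}.ncard = if D.Lft v then 1 else 0) ∨
    ({q : D.Trap | q.v = v}.ncard = (if D.Lft v then 1 else 0) ∧
      {q : D.Trap | q.w = v}.ncard = (if D.Lft v then 1 else 0) + 1) := by
  rw [ncard_start, ncard_end]
  rcases (reg_or_up_or_down v).resolve_left h with h | h
  · left
    exact ⟨ncard_above_up h, by rw [ncard_above_down (by simpa using h)]; simp⟩
  · right
    exact ⟨ncard_above_down h, by rw [ncard_above_up (by simpa using h)]; simp⟩

open Classical in
/-- The handshake lemma, where regular vertices have degree 2 and the other ones degree 1 or 3. -/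
theorem two_mul_card_trap [Finite S] : 2 * Nat.card D.Trap = 2 * {v | D.Reg v}.ncard +
    {v | ¬ D.Reg v}.ncard + 2 * {v | ¬ D.Reg v ∧ D.Lft v}.ncard := by
  have := Fintype.ofFinite S
  have h1 : ∀ f : D.Trap → S, Nat.card D.Trap = ∑ v, {q : D.Trap | f q = v}.ncard := by
    intro f
    rw [Nat.card_eq_fintype_card, ← Finset.card_univ,
      Finset.card_eq_sum_card_fiberwise (f := f) (t := Finset.univ) (by simp)]
    refine Finset.sum_congr rfl fun v _ => ?_
    rw [← ncard_coe_finset]; congr 1; ext q; simp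
  have h2 : ∀ p : S → Prop, {v | p v}.ncard = ∑ v, if p v then 1 else 0 := by
    intro p
    rw [Finset.sum_boole, ← ncard_coe_finset]
    simp
  rw [two_mul]
  nth_rw 1 [h1 Trap.v]
  rw [h1 Trap.w, h2, h2, h2, Finset.mul_sum, Finset.mul_sum, ← Finset.sum_add_distrib,
    ← Finset.sum_add_distrib, ← Finset.sum_add_distrib]
  refine Finset.sum_congr rfl fun v _ => ?_
  by_cases hr : D.Reg v
  · obtain ⟨e1, e2⟩ := degrees_reg hr
    rw [e1, e2]; simp [hr]
  · rcases degrees_not_reg hr with ⟨e1, e2⟩ | ⟨e1, e2⟩ <;> rw [e1, e2] <;>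
      by_cases hl : D.Lft v <;> simp [hr, hl]

end SegRegion

/-! ### The Reeb graph as a finite graph -/

namespace PolygonalRegion

open unitInterval

variable {n : ℕ} {P : PolygonalRegion n} (hP : P.InGeneralPosition)

/-- The map from the realization of the graph of trapezoids to the Reeb graph. -/
def toReeb (x : (P.toSeg hP).graph.Realization) : P.Reeb :=
  P.proj ⟨(P.toSeg hP).draw x, SegRegion.draw_mem x⟩

theorem continuous_toReeb : Continuous (toReeb hP) :=
  continuous_proj.comp (SegRegion.continuous_draw.subtype_mk _)

theorem toReeb_bijective : Function.Bijective (toReeb hP) := by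
  constructor
  · intro x y h
    obtain ⟨h1, h2⟩ := (proj_eq_iff hP).1 h
    exact SegRegion.draw_injective_of_horiz h1 h2
  · intro r
    obtain ⟨p, rfl⟩ := proj_surjective r
    obtain ⟨x, h1, h2⟩ := SegRegion.exists_draw_horiz (D := P.toSeg hP) p.2
    exact ⟨x, (proj_eq_iff hP).2 ⟨h1, h2⟩⟩

/-- The Reeb graph is the realization of the graph of trapezoids. -/
noncomputable def reebHomeomorph : (P.toSeg hP).graph.Realization ≃ₜ P.Reeb :=
  have := t2Space_reeb hP
  Continuous.homeoOfEquivCompactToT2 (f := Equiv.ofBijective _ (toReeb_bijective hP))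
    (continuous_toReeb hP)

include hP in
theorem reebIsPlanar : P.ReebIsPlanar := by
  have := t2Space_reeb hP
  have hinj : Function.Injective (P.toSeg hP).draw := fun x y h =>
    (toReeb_bijective hP).1 (congrArg P.proj (Subtype.ext h))
  exact ⟨fun r => (P.toSeg hP).draw ((reebHomeomorph hP).symm r),
    ((SegRegion.continuous_draw.isClosedEmbedding hinj).isEmbedding).comp
      (reebHomeomorph hP).symm.isEmbedding⟩

theorem isConn_graph : (P.toSeg hP).graph.IsConn := by
  classical
  intro p hp v w hv
  have hconn : ConnectedSpace (P.toSeg hP).graph.Realization :=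
    (reebHomeomorph hP).symm.surjective.connectedSpace (reebHomeomorph hP).symm.continuous
  let f : (P.toSeg hP).graph.Realization → Bool := Multigraph.lift (fun v => decide (p v))
    (fun e _ => decide (p ((P.toSeg hP).graph.src e))) (fun e => rfl)
    (fun e => by simp only [hp e])
  have hf : Continuous f := Multigraph.continuous_of_arc fun e => continuous_const
  have h := PreconnectedSpace.constant inferInstance hf (x := Multigraph.pt v)
    (y := Multigraph.pt w)
  have h' : decide (p v) = decide (p w) := h
  rw [decide_eq_decide] at h'
  exact h'.1 hv

/-- The vertex of the Reeb graph that belongs to a vertex of the polygon. -/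
def reebVertex (v : Σ i, Fin (P.size i)) : P.Reeb :=
  toReeb hP (Multigraph.pt (G := (P.toSeg hP).graph) v)

/-- The arc in the Reeb graph that belongs to a trapezoid. -/
def reebArc (q : (P.toSeg hP).Trap) (τ : I) : P.Reeb :=
  toReeb hP (Multigraph.arc (G := (P.toSeg hP).graph) q τ)

theorem reebArc_zero (q : (P.toSeg hP).Trap) : reebArc hP q 0 = reebVertex hP q.v :=
  congrArg (toReeb hP) (Multigraph.arc_zero (G := (P.toSeg hP).graph) q)

theorem reebArc_one (q : (P.toSeg hP).Trap) : reebArc hP q 1 = reebVertex hP q.w :=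
  congrArg (toReeb hP) (Multigraph.arc_one (G := (P.toSeg hP).graph) q)

theorem continuous_reebArc (q : (P.toSeg hP).Trap) : Continuous (reebArc hP q) :=
  (continuous_toReeb hP).comp (Multigraph.continuous_arc _)

theorem reebHeight_reebVertex (v : Σ i, Fin (P.size i)) :
    P.reebHeight (reebVertex hP v) = (P.toSeg hP).η v := rfl

theorem reebHeight_reebArc (q : (P.toSeg hP).Trap) (τ : I) : P.reebHeight (reebArc hP q τ) =
    (P.toSeg hP).η q.v + τ * ((P.toSeg hP).η q.w - (P.toSeg hP).η q.v) := rfl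

theorem reebVertex_injective : Function.Injective (reebVertex hP) := fun _ _ h =>
  SegRegion.η_injective (D := P.toSeg hP) (congrArg P.reebHeight h)

theorem reebVertices_eq : P.reebVertices = range (reebVertex hP) := by
  ext r
  constructor
  · rintro ⟨x, ⟨i, a, hx⟩, rfl⟩
    exact ⟨⟨i, a⟩, congrArg P.proj (Subtype.ext hx.symm)⟩
  · rintro ⟨⟨i, a⟩, rfl⟩
    exact ⟨_, ⟨i, a, rfl⟩, rfl⟩

theorem eq_vertex_or_arc (r : P.Reeb) : (∃ v, reebVertex hP v = r) ∨
    ∃ q, ∃ τ ∈ Ioo (0 : I) 1, reebArc hP q τ = r := by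
  obtain ⟨x, rfl⟩ := (toReeb_bijective hP).2 r
  rcases Multigraph.exists_pt_or_arc x with ⟨v, rfl⟩ | ⟨q, τ, rfl⟩
  · exact Or.inl ⟨v, rfl⟩
  rcases eq_or_ne τ 0 with rfl | h0
  · exact Or.inl ⟨_, (reebArc_zero hP q).symm⟩
  rcases eq_or_ne τ 1 with rfl | h1
  · exact Or.inl ⟨_, (reebArc_one hP q).symm⟩
  · exact Or.inr ⟨q, τ, ⟨unitInterval.pos_iff_ne_zero.2 h0, unitInterval.lt_one_iff_ne_one.2 h1⟩,
      rfl⟩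

theorem arc_ne_vertex {q : (P.toSeg hP).Trap} {τ : I} (hτ : τ ∈ Ioo (0 : I) 1)
    (v : Σ i, Fin (P.size i)) : reebArc hP q τ ≠ reebVertex hP v := by
  intro h
  obtain ⟨h1, h2⟩ := (proj_eq_iff hP).1 h
  have h3 := SegRegion.draw_arc_mem_Ioo q hτ
  have h4 := SegRegion.Trap.mem_of_horiz h3 (SegRegion.draw_arc_mem_Icc q τ).2 h2
  have h5 : ((P.toSeg hP).draw (Multigraph.arc (G := (P.toSeg hP).graph) q τ)).2 =
    (P.toSeg hP).η v := h1
  rw [h5] at h3 h4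
  exact q.vertex_notMem h3 h4

theorem arc_eq_arc {q p : (P.toSeg hP).Trap} {τ ρ : I} (hτ : τ ∈ Ioo (0 : I) 1)
    (hρ : ρ ∈ Ioo (0 : I) 1) (h : reebArc hP q τ = reebArc hP p ρ) : q = p := by
  obtain ⟨h1, h2⟩ := (proj_eq_iff hP).1 h
  have h3 := SegRegion.draw_arc_mem_Ioo p hρ
  have h4 := (SegRegion.draw_arc_mem_Icc p ρ).2
  have h5 : ((P.toSeg hP).draw (Multigraph.arc (G := (P.toSeg hP).graph) q τ)).2 =
    ((P.toSeg hP).draw (Multigraph.arc (G := (P.toSeg hP).graph) p ρ)).2 := h1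
  rw [← h5] at h3 h4
  exact SegRegion.Trap.eq_of_horiz (SegRegion.draw_arc_mem_Ioo q hτ) h3
    (SegRegion.draw_arc_mem_Icc q τ).2 h4 h2

/-- The open edge of the Reeb graph that belongs to a trapezoid. -/
def openArc (q : (P.toSeg hP).Trap) : Set P.Reeb := reebArc hP q '' Ioo 0 1

theorem half_mem : (⟨1 / 2, by norm_num, by norm_num⟩ : I) ∈ Ioo (0 : I) 1 :=
  ⟨show (0 : ℝ) < 1 / 2 by norm_num, show (1 / 2 : ℝ) < 1 by norm_num⟩

theorem openArc_injective : Function.Injective (openArc hP) := by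
  intro q p h
  have : reebArc hP q _ ∈ openArc hP q := mem_image_of_mem _ half_mem
  rw [h] at this
  obtain ⟨τ, hτ, he⟩ := this
  exact (arc_eq_arc hP hτ half_mem he).symm

theorem range_reebArc (q : (P.toSeg hP).Trap) :
    range (reebArc hP q) = openArc hP q ∪ {reebVertex hP q.v, reebVertex hP q.w} := by
  ext r
  constructor
  · rintro ⟨τ, rfl⟩
    rcases eq_or_ne τ 0 with rfl | h0
    · right; left; exact reebArc_zero hP q
    rcases eq_or_ne τ 1 with rfl | h1
    · right; right; exact reebArc_one hP q
    · exact Or.inl ⟨τ, ⟨unitInterval.pos_iff_ne_zero.2 h0,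
        unitInterval.lt_one_iff_ne_one.2 h1⟩, rfl⟩
  · rintro (⟨τ, -, rfl⟩ | rfl | rfl)
    exacts [⟨τ, rfl⟩, ⟨0, reebArc_zero hP q⟩, ⟨1, reebArc_one hP q⟩]

theorem isClosed_range_reebArc (q : (P.toSeg hP).Trap) : IsClosed (range (reebArc hP q)) := by
  have := t2Space_reeb hP
  exact (isCompact_range (continuous_reebArc hP q)).isClosed

theorem compl_reebVertices_eq : P.reebVerticesᶜ = ⋃ q, openArc hP q := by
  ext r
  rw [reebVertices_eq hP, mem_compl_iff, mem_iUnion]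
  constructor
  · intro h
    rcases eq_vertex_or_arc hP r with h' | ⟨q, τ, hτ, rfl⟩
    · exact absurd h' h
    · exact ⟨q, τ, hτ, rfl⟩
  · rintro ⟨q, τ, hτ, rfl⟩ ⟨v, hv⟩
    exact arc_ne_vertex hP hτ v hv.symm

theorem isOpen_openArc (q : (P.toSeg hP).Trap) : IsOpen (openArc hP q) := by
  have := t2Space_reeb hP
  have hc : (openArc hP q)ᶜ = range (reebVertex hP) ∪
      ⋃ p : {p // p ≠ q}, range (reebArc hP p.1) := by
    ext r
    simp only [mem_compl_iff, mem_union, mem_iUnion]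
    constructor
    · intro h
      rcases eq_vertex_or_arc hP r with h' | ⟨p, τ, hτ, rfl⟩
      · exact Or.inl h'
      · exact Or.inr ⟨⟨p, fun hp => h (hp ▸ mem_image_of_mem _ hτ)⟩, τ, rfl⟩
    · rintro (⟨v, rfl⟩ | ⟨⟨p, hp⟩, hr⟩) ⟨τ, hτ, he⟩
      · exact arc_ne_vertex hP hτ v he
      · rw [range_reebArc] at hr
        rcases hr with ⟨ρ, hρ, he'⟩ | he' | he'
        · exact hp (arc_eq_arc hP hρ hτ (he'.trans he.symm))
        · exact arc_ne_vertex hP hτ _ (he.trans he')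
        · exact arc_ne_vertex hP hτ _ (he.trans he')
  rw [← isClosed_compl_iff, hc]
  exact (finite_range _).isClosed.union
    (isClosed_iUnion_of_finite fun p => isClosed_range_reebArc hP p.1)

theorem isPreconnected_openArc (q : (P.toSeg hP).Trap) : IsPreconnected (openArc hP q) := by
  have : openArc hP q = (fun u => reebArc hP q (projIcc 0 1 zero_le_one u)) '' Ioo (0 : ℝ) 1 := by
    ext r
    constructor
    · rintro ⟨τ, hτ, rfl⟩
      exact ⟨τ, ⟨hτ.1, hτ.2⟩, by simp only [projIcc_val]⟩
    · rintro ⟨u, hu, rfl⟩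
      have hm : u ∈ Icc (0 : ℝ) 1 := Ioo_subset_Icc_self hu
      refine ⟨⟨u, hm⟩, ⟨hu.1, hu.2⟩, ?_⟩
      simp only [projIcc_of_mem zero_le_one hm]
  rw [this]
  exact isPreconnected_Ioo.image _
    ((continuous_reebArc hP q).comp continuous_projIcc).continuousOn

theorem connectedComponentIn_openArc {q : (P.toSeg hP).Trap} {r : P.Reeb} (hr : r ∈ openArc hP q) :
    connectedComponentIn P.reebVerticesᶜ r = openArc hP q := by
  have hsub : openArc hP q ⊆ P.reebVerticesᶜ := by
    rw [compl_reebVertices_eq hP]; exact subset_iUnion _ q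
  refine Subset.antisymm ?_ ((isPreconnected_openArc hP q).subset_connectedComponentIn hr hsub)
  refine isPreconnected_connectedComponentIn.subset_left_of_subset_union (isOpen_openArc hP q)
    (isOpen_iUnion fun p : {p // p ≠ q} => isOpen_openArc hP p.1) ?_ ?_
    ⟨r, mem_connectedComponentIn (hsub hr), hr⟩
  · rw [disjoint_iUnion_right]
    rintro ⟨p, hp⟩
    rw [disjoint_left]
    rintro _ ⟨τ, hτ, rfl⟩ ⟨ρ, hρ, h⟩
    exact hp (arc_eq_arc hP hρ hτ h)
  · refine (connectedComponentIn_subset _ _).trans ?_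
    rw [compl_reebVertices_eq hP]
    refine iUnion_subset fun p => ?_
    by_cases hp : p = q
    · exact hp ▸ subset_union_left
    · exact (subset_iUnion (fun p : {p // p ≠ q} => openArc hP p.1) ⟨p, hp⟩).trans
        subset_union_right

theorem reebEdges_eq : P.reebEdges = range (openArc hP) := by
  ext e
  constructor
  · rintro ⟨r, hr, rfl⟩
    rw [compl_reebVertices_eq hP, mem_iUnion] at hr
    obtain ⟨q, hq⟩ := hr
    exact ⟨q, (connectedComponentIn_openArc hP hq).symm⟩
  · rintro ⟨q, rfl⟩
    have hm : reebArc hP q _ ∈ openArc hP q := mem_image_of_mem _ half_mem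
    refine ⟨_, ?_, (connectedComponentIn_openArc hP hm).symm⟩
    rw [compl_reebVertices_eq hP]
    exact mem_iUnion.2 ⟨q, hm⟩

theorem closure_openArc (q : (P.toSeg hP).Trap) :
    closure (openArc hP q) = openArc hP q ∪ {reebVertex hP q.v, reebVertex hP q.w} := by
  rw [← range_reebArc]
  refine Subset.antisymm
    (closure_minimal (image_subset_range _ _) (isClosed_range_reebArc hP q)) ?_
  rw [← image_univ]
  have h : (univ : Set I) ⊆ closure (Ioo 0 1) := by
    intro τ _
    have h1 : (τ : ℝ) ∈ closure (Ioo (0 : ℝ) 1) := by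
      rw [closure_Ioo zero_ne_one]; exact τ.2
    have h2 := map_mem_closure (f := projIcc (0 : ℝ) 1 zero_le_one) (t := Ioo 0 1)
      continuous_projIcc h1 (fun u hu => by
        rw [projIcc_of_mem zero_le_one (Ioo_subset_Icc_self hu)]
        exact ⟨hu.1, hu.2⟩)
    rwa [projIcc_val] at h2
  exact (image_mono h).trans (image_closure_subset_closure_image (continuous_reebArc hP q))

theorem bijOn_openArc (q : (P.toSeg hP).Trap) : BijOn P.reebHeight (openArc hP q)
    (Ioo (P.reebHeight (reebVertex hP q.v)) (P.reebHeight (reebVertex hP q.w))) := by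
  have hlt := q.lt
  have hpos := sub_pos.2 hlt
  simp only [reebHeight_reebVertex]
  refine ⟨?_, ?_, ?_⟩
  · rintro _ ⟨τ, hτ, rfl⟩
    exact SegRegion.draw_arc_mem_Ioo q hτ
  · rintro _ ⟨τ, hτ, rfl⟩ _ ⟨ρ, hρ, rfl⟩ h
    rw [reebHeight_reebArc, reebHeight_reebArc] at h
    have : τ = ρ := Subtype.ext (mul_right_cancel₀ hpos.ne' (by linarith))
    rw [this]
  · intro y hy
    have h0 : 0 < (y - (P.toSeg hP).η q.v) / ((P.toSeg hP).η q.w - (P.toSeg hP).η q.v) :=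
      div_pos (sub_pos.2 hy.1) hpos
    have h1 : (y - (P.toSeg hP).η q.v) / ((P.toSeg hP).η q.w - (P.toSeg hP).η q.v) < 1 :=
      (div_lt_one hpos).2 (by linarith [hy.2])
    refine ⟨_, ⟨⟨_, h0.le, h1.le⟩, ⟨h0, h1⟩, rfl⟩, ?_⟩
    rw [reebHeight_reebArc]
    simp only
    rw [div_mul_cancel₀ _ hpos.ne']; ring

include hP in
theorem isFiniteOrientedGraph : P.IsFiniteOrientedGraph := by
  refine ⟨?_, ?_, ?_⟩
  · rw [reebVertices_eq hP]; exact finite_range _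
  · rw [reebEdges_eq hP]; exact finite_range _
  · rw [reebEdges_eq hP, reebVertices_eq hP]
    rintro _ ⟨q, rfl⟩
    exact ⟨_, ⟨q.v, rfl⟩, _, ⟨q.w, rfl⟩, closure_openArc hP q, bijOn_openArc hP q⟩

theorem startsAt_openArc {q : (P.toSeg hP).Trap} {v : Σ i, Fin (P.size i)} :
    P.StartsAt (openArc hP q) (reebVertex hP v) ↔ q.v = v := by
  have hlt := q.lt
  unfold StartsAt
  rw [closure_openArc]
  constructor
  · rintro ⟨⟨τ, hτ, h⟩ | h | h, hh⟩
    · exact absurd h (arc_ne_vertex hP hτ v)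
    · exact (reebVertex_injective hP h).symm
    · have h1 := (bijOn_openArc hP q).mapsTo (mem_image_of_mem (reebArc hP q) half_mem)
      have h2 := hh _ (mem_image_of_mem (reebArc hP q) half_mem)
      rw [h] at h2
      exact absurd h2 (not_lt.2 h1.2.le)
  · rintro rfl
    exact ⟨Or.inr (Or.inl rfl), fun x hx => ((bijOn_openArc hP q).mapsTo hx).1⟩

theorem endsAt_openArc {q : (P.toSeg hP).Trap} {v : Σ i, Fin (P.size i)} :
    P.EndsAt (openArc hP q) (reebVertex hP v) ↔ q.w = v := by
  have hlt := q.lt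
  unfold EndsAt
  rw [closure_openArc]
  constructor
  · rintro ⟨⟨τ, hτ, h⟩ | h | h, hh⟩
    · exact absurd h (arc_ne_vertex hP hτ v)
    · have h1 := (bijOn_openArc hP q).mapsTo (mem_image_of_mem (reebArc hP q) half_mem)
      have h2 := hh _ (mem_image_of_mem (reebArc hP q) half_mem)
      rw [h] at h2
      exact absurd h2 (not_lt.2 h1.1.le)
    · exact (reebVertex_injective hP h).symm
  · rintro rfl
    exact ⟨Or.inr (Or.inr rfl), fun x hx => ((bijOn_openArc hP q).mapsTo hx).2⟩

theorem outDegree_reebVertex (v : Σ i, Fin (P.size i)) :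
    P.outDegree (reebVertex hP v) = {q : (P.toSeg hP).Trap | q.v = v}.ncard := by
  unfold outDegree
  rw [reebEdges_eq hP, ← ncard_image_of_injective _ (openArc_injective hP)]
  congr 1
  ext e
  constructor
  · rintro ⟨⟨q, rfl⟩, h⟩; exact ⟨q, (startsAt_openArc hP).1 h, rfl⟩
  · rintro ⟨q, h, rfl⟩; exact ⟨⟨q, rfl⟩, (startsAt_openArc hP).2 h⟩

theorem inDegree_reebVertex (v : Σ i, Fin (P.size i)) :
    P.inDegree (reebVertex hP v) = {q : (P.toSeg hP).Trap | q.w = v}.ncard := by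
  unfold inDegree
  rw [reebEdges_eq hP, ← ncard_image_of_injective _ (openArc_injective hP)]
  congr 1
  ext e
  constructor
  · rintro ⟨⟨q, rfl⟩, h⟩; exact ⟨q, (endsAt_openArc hP).1 h, rfl⟩
  · rintro ⟨q, h, rfl⟩; exact ⟨⟨q, rfl⟩, (endsAt_openArc hP).2 h⟩

theorem ncard_reebEdges : P.reebEdges.ncard = Nat.card (P.toSeg hP).Trap := by
  rw [reebEdges_eq hP, ← image_univ, ncard_image_of_injective _ (openArc_injective hP), ncard_univ]

include hP in
theorem ncard_reebVertices : P.reebVertices.ncard = Nat.card (Σ i, Fin (P.size i)) := by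
  rw [reebVertices_eq hP, ← image_univ, ncard_image_of_injective _ (reebVertex_injective hP),
    ncard_univ]

theorem ncard_reebVertices_filter (p : P.Reeb → Prop) :
    {r ∈ P.reebVertices | p r}.ncard = {v | p (reebVertex hP v)}.ncard := by
  rw [reebVertices_eq hP, ← ncard_image_of_injective _ (reebVertex_injective hP)]
  congr 1
  ext r
  constructor
  · rintro ⟨⟨v, rfl⟩, h⟩; exact ⟨v, h, rfl⟩
  · rintro ⟨v, h, rfl⟩; exact ⟨⟨v, rfl⟩, h⟩

include hP in
theorem nonempty_vertices : Nonempty (Σ i, Fin (P.size i)) := by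
  by_contra hemp
  rw [not_nonempty_iff] at hemp
  obtain ⟨p, hp⟩ := P.isConnected.nonempty
  obtain ⟨x, -, -⟩ := SegRegion.exists_draw_horiz (D := P.toSeg hP) hp
  rcases Multigraph.exists_pt_or_arc x with ⟨v, -⟩ | ⟨q, -, -⟩
  · exact hemp.elim v
  · exact hemp.elim q.v

/-- Polygons whose Reeb graphs have equal Euler characteristics have homotopy equivalent Reeb
graphs. -/
theorem nonempty_homotopyEquiv_reeb {k : ℕ} {Q : PolygonalRegion k} (hQ : Q.InGeneralPosition)
    (h : Nat.card (Q.toSeg hQ).Trap + Nat.card (Σ i, Fin (P.size i)) =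
      Nat.card (P.toSeg hP).Trap + Nat.card (Σ i, Fin (Q.size i))) :
    Nonempty (ContinuousMap.HomotopyEquiv Q.Reeb P.Reeb) := by
  have : Finite (P.toSeg hP).graph.V := inferInstanceAs (Finite (Σ i, Fin (P.size i)))
  have : Finite (Q.toSeg hQ).graph.V := inferInstanceAs (Finite (Σ i, Fin (Q.size i)))
  have : Finite (P.toSeg hP).graph.E := inferInstanceAs (Finite (P.toSeg hP).Trap)
  have : Finite (Q.toSeg hQ).graph.E := inferInstanceAs (Finite (Q.toSeg hQ).Trap)
  have : Nonempty (P.toSeg hP).graph.V := nonempty_vertices hP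
  have : Nonempty (Q.toSeg hQ).graph.V := nonempty_vertices hQ
  obtain ⟨e⟩ := Multigraph.nonempty_homotopyEquiv (isConn_graph hQ) (isConn_graph hP) h
  exact ⟨((reebHomeomorph hQ).symm.toHomotopyEquiv.trans e).trans
    (reebHomeomorph hP).toHomotopyEquiv⟩

end PolygonalRegion

/-! ### Triangles with a vertical side -/

/-- The triangle with the vertices `(x, y - r)`, `(x + r, y)` and `(x, y + r)`. -/
structure VTriangle where
  /-- the abscissa of the vertical side -/
  x : ℝ
  /-- the height of the middle vertex -/
  y : ℝ
  /-- half of the height of the triangle -/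
  r : ℝ
  r_pos : 0 < r

namespace VTriangle

variable (T : VTriangle)

/-- A function that is positive inside the triangle, zero on its boundary and negative outside. -/
def ψ (p : ℝ × ℝ) : ℝ := min (p.1 - T.x) (T.r - (p.1 - T.x) - |p.2 - T.y|)

/-- The boundary curve of the triangle. -/
def polygon : Polygon (ℝ × ℝ) 3 :=
  ⟨![(T.x, T.y - T.r), (T.x + T.r, T.y), (T.x, T.y + T.r)]⟩

theorem continuous_ψ : Continuous T.ψ := by unfold ψ; fun_prop

theorem isSimple_polygon : T.polygon.IsSimple := by
  have hr := T.r_pos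
  refine ⟨le_rfl, ?_⟩
  rintro i j s ⟨hs0, hs1⟩ t ⟨ht0, ht1⟩ h
  have e1 : (finRotate 3) 0 = 1 := rfl
  have e2 : (finRotate 3) 1 = 2 := rfl
  have e3 : (finRotate 3) 2 = 0 := rfl
  have hS : s * T.r < T.r := by nlinarith
  have hT : t * T.r < T.r := by nlinarith
  have hS0 : 0 ≤ s * T.r := by positivity
  have hT0 : 0 ≤ t * T.r := by positivity
  have key : s * T.r = t * T.r → s = t := mul_right_cancel₀ hr.ne'
  fin_cases i <;> fin_cases j <;>
    simp [Polygon.edgePath, polygon, AffineMap.lineMap_apply, e1, e2, e3] at h ⊢ <;>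
    obtain ⟨h1, h2⟩ := h <;>
    first
      | exact key (by linarith)
      | nlinarith
      | (rcases h1 with rfl | h1 <;> linarith)

theorem mem_boundary_iff {p : ℝ × ℝ} : p ∈ T.polygon.boundary ℝ ↔ T.ψ p = 0 := by
  have hr := T.r_pos
  obtain ⟨u, v⟩ := p
  have e1 : (finRotate 3) 0 = 1 := rfl
  have e2 : (finRotate 3) 1 = 2 := rfl
  have e3 : (finRotate 3) 2 = 0 := rfl
  simp only [Polygon.boundary, Polygon.edgeSet, mem_iUnion, affineSegment, mem_image]
  constructor
  · rintro ⟨i, t, ⟨h0, h1⟩, h⟩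
    have hT : t * T.r ≤ T.r := by nlinarith
    have hT0 : 0 ≤ t * T.r := by positivity
    unfold ψ
    fin_cases i <;>
      simp [polygon, AffineMap.lineMap_apply, e1, e2, e3] at h <;>
      obtain ⟨rfl, rfl⟩ := h
    · rw [min_eq_right] <;> rw [abs_of_nonpos] <;> simp only <;> linarith
    · rw [min_eq_right] <;> rw [abs_of_nonneg] <;> simp only <;> linarith
    · rw [min_eq_left]
      · simp
      · have : |t * (T.y - T.r - (T.y + T.r)) + (T.y + T.r) - T.y| ≤ T.r := by
          rw [abs_le]; constructor <;> linarith
        simp only; linarith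
  · intro h
    unfold ψ at h
    simp only at h
    rcases min_choice (u - T.x) (T.r - (u - T.x) - |v - T.y|) with hm | hm <;> rw [hm] at h
    · have h2 := min_eq_left_iff.1 hm
      have h3 : |v - T.y| ≤ T.r := by linarith
      rw [abs_le] at h3
      refine ⟨2, (T.y + T.r - v) / (2 * T.r), ⟨?_, ?_⟩, ?_⟩
      · apply div_nonneg <;> linarith
      · rw [div_le_one (by linarith)]; linarith
      · simp [polygon, AffineMap.lineMap_apply, e3]
        constructor
        · linarith
        · field_simp; ring
    · have h2 := min_eq_right_iff.1 hm
      rcases le_total v T.y with hv | hv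
      · rw [abs_of_nonpos (by linarith)] at h h2
        refine ⟨0, (u - T.x) / T.r, ⟨?_, ?_⟩, ?_⟩
        · apply div_nonneg <;> linarith
        · rw [div_le_one (by linarith)]; linarith
        · simp [polygon, AffineMap.lineMap_apply, e1]
          constructor
          · field_simp; ring
          · field_simp; linarith
      · rw [abs_of_nonneg (by linarith)] at h h2
        refine ⟨1, (v - T.y) / T.r, ⟨?_, ?_⟩, ?_⟩
        · apply div_nonneg <;> linarith
        · rw [div_le_one (by linarith)]; linarith
        · simp [polygon, AffineMap.lineMap_apply, e2]
          constructor
          · field_simp; linarith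
          · field_simp; ring

/-- The dilation with the given ratio whose centre is the point of the triangle where `ψ` is
maximal. -/
noncomputable def dil (p : ℝ × ℝ) (t : ℝ) : ℝ × ℝ :=
  (T.x + T.r / 2 + t * (p.1 - (T.x + T.r / 2)), T.y + t * (p.2 - T.y))

theorem ψ_dil {p : ℝ × ℝ} (hp : T.ψ p = 0) {t : ℝ} (ht : 0 ≤ t) :
    T.ψ (T.dil p t) = (1 - t) * (T.r / 2) := by
  have h1 : T.ψ (T.dil p t) = min ((1 - t) * (T.r / 2) + t * (p.1 - T.x))
      ((1 - t) * (T.r / 2) + t * (T.r - (p.1 - T.x) - |p.2 - T.y|)) := by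
    unfold ψ dil
    simp only
    congr 1
    · ring
    · rw [add_sub_cancel_left, abs_mul, abs_of_nonneg ht]; ring
  rw [h1, min_add_add_left, ← mul_min_of_nonneg _ _ ht]
  unfold ψ at hp
  rw [hp]; ring

theorem tendsto_dil (p : ℝ × ℝ) : Tendsto (T.dil p) (𝓝 1) (𝓝 p) := by
  have : Continuous (T.dil p) := by unfold dil; fun_prop
  simpa [dil] using this.tendsto 1

/-- Near every boundary point there are points inside of the triangle. -/
theorem frequently_pos {p : ℝ × ℝ} (hp : T.ψ p = 0) : ∃ᶠ q in 𝓝 p, 0 < T.ψ q := by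
  have h : ∀ᶠ t in 𝓝[<] (1 : ℝ), 0 < T.ψ (T.dil p t) := by
    filter_upwards [Ioo_mem_nhdsLT (show (0 : ℝ) < 1 by norm_num)] with t ht
    rw [T.ψ_dil hp ht.1.le]
    exact mul_pos (sub_pos.2 ht.2) (half_pos T.r_pos)
  exact ((T.tendsto_dil p).mono_left nhdsWithin_le_nhds).frequently h.frequently

/-- Near every boundary point there are points outside of the triangle. -/
theorem frequently_neg {p : ℝ × ℝ} (hp : T.ψ p = 0) : ∃ᶠ q in 𝓝 p, T.ψ q < 0 := by
  have h : ∀ᶠ t in 𝓝[>] (1 : ℝ), T.ψ (T.dil p t) < 0 := by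
    filter_upwards [self_mem_nhdsWithin] with t ht
    rw [T.ψ_dil hp (zero_le_one.trans (le_of_lt ht))]
    exact mul_neg_of_neg_of_pos (sub_neg.2 ht) (half_pos T.r_pos)
  exact ((T.tendsto_dil p).mono_left nhdsWithin_le_nhds).frequently h.frequently

end VTriangle

/-! ### A triangle with triangular holes -/

namespace HoledTriangle

variable (b : ℕ)

/-- The outer triangle. -/
noncomputable def outer : VTriangle := ⟨-1, 1 / 2, 3 * b + 3, by positivity⟩

/-- The holes. -/
def hole (j : Fin b) : VTriangle := ⟨0, 3 * (j : ℕ) + 1, 1, one_pos⟩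

/-- The outer triangle and the holes. -/
noncomputable def tri : Fin (b + 1) → VTriangle := Fin.cons (outer b) (hole b)

/-- The outer triangle without the holes. -/
def carrier : Set (ℝ × ℝ) := {p | 0 ≤ (outer b).ψ p ∧ ∀ j, (hole b j).ψ p ≤ 0}

variable {b}

theorem outer_nonneg_iff {p : ℝ × ℝ} : 0 ≤ (outer b).ψ p ↔
    -1 ≤ p.1 ∧ |p.2 - 1 / 2| ≤ 3 * b + 2 - p.1 := by
  simp only [VTriangle.ψ, outer, le_min_iff]
  constructor <;> rintro ⟨h1, h2⟩ <;> constructor <;> linarith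

theorem hole_nonpos_iff {j : Fin b} {p : ℝ × ℝ} : (hole b j).ψ p ≤ 0 ↔
    p.1 ≤ 0 ∨ 1 ≤ p.1 + |p.2 - (3 * (j : ℕ) + 1)| := by
  simp only [VTriangle.ψ, hole, min_le_iff, sub_zero]
  constructor <;> rintro (h1 | h1)
  exacts [Or.inl h1, Or.inr (by linarith), Or.inl h1, Or.inr (by linarith)]

theorem hole_nonneg_iff {j : Fin b} {p : ℝ × ℝ} : 0 ≤ (hole b j).ψ p ↔
    0 ≤ p.1 ∧ p.1 + |p.2 - (3 * (j : ℕ) + 1)| ≤ 1 := by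
  simp only [VTriangle.ψ, hole, le_min_iff, sub_zero]
  constructor <;> rintro ⟨h1, h2⟩ <;> constructor <;> linarith

theorem hole_le (j : Fin b) : (j : ℝ) + 1 ≤ b := by exact_mod_cast j.2

/-- The holes lie in the interior of the outer triangle. -/
theorem outer_pos_of_hole {j : Fin b} {p : ℝ × ℝ} (h : 0 ≤ (hole b j).ψ p) :
    0 < (outer b).ψ p := by
  obtain ⟨h1, h2⟩ := hole_nonneg_iff.1 h
  have h3 := hole_le j
  have h4 : (0 : ℝ) ≤ (j : ℕ) := Nat.cast_nonneg _
  have h5 : |p.2 - (3 * (j : ℕ) + 1)| ≤ 1 - p.1 := by linarith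
  rw [abs_le] at h5
  have h6 : |p.2 - 1 / 2| < 3 * b + 2 - p.1 := by
    rw [abs_lt]; constructor <;> linarith
  simp only [VTriangle.ψ, outer, lt_min_iff]
  constructor <;> linarith

/-- The holes are disjoint. -/
theorem hole_neg_of_hole {j k : Fin b} (hjk : j ≠ k) {p : ℝ × ℝ} (h : 0 ≤ (hole b j).ψ p) :
    (hole b k).ψ p < 0 := by
  obtain ⟨h1, h2⟩ := hole_nonneg_iff.1 h
  by_contra! h'
  obtain ⟨h3, h4⟩ := hole_nonneg_iff.1 h'
  have h5 : |p.2 - (3 * (j : ℕ) + 1)| ≤ 1 := by linarith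
  have h6 : |p.2 - (3 * (k : ℕ) + 1)| ≤ 1 := by linarith
  rw [abs_le] at h5 h6
  rcases lt_or_gt_of_ne (fun h => hjk (Fin.ext h)) with h | h
  · have : ((j : ℕ) : ℝ) + 1 ≤ (k : ℕ) := by exact_mod_cast h
    linarith
  · have : ((k : ℕ) : ℝ) + 1 ≤ (j : ℕ) := by exact_mod_cast h
    linarith

theorem isClosed_carrier : IsClosed (carrier b) := by
  have : carrier b = {p | 0 ≤ (outer b).ψ p} ∩ ⋂ j, {p | (hole b j).ψ p ≤ 0} := by
    ext p; simp [carrier]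
  rw [this]
  exact (isClosed_le continuous_const (VTriangle.continuous_ψ _)).inter
    (isClosed_iInter fun j => isClosed_le (VTriangle.continuous_ψ _) continuous_const)

theorem isCompact_carrier : IsCompact (carrier b) := by
  refine (isCompact_Icc (a := ((-1, -(3 * b + 3)) : ℝ × ℝ))
    (b := (3 * b + 2, 3 * b + 4))).of_isClosed_subset isClosed_carrier ?_
  rintro p ⟨hp, -⟩
  obtain ⟨h1, h2⟩ := outer_nonneg_iff.1 hp
  have h3 := abs_nonneg (p.2 - 1 / 2)
  rw [abs_le] at h2
  refine ⟨⟨h1, ?_⟩, ⟨?_, ?_⟩⟩ <;> simp only <;> linarith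

/-- The points of the region that lie on none of the boundary curves. -/
def inner (b : ℕ) : Set (ℝ × ℝ) := {p | 0 < (outer b).ψ p ∧ ∀ j, (hole b j).ψ p < 0}

theorem isOpen_inner : IsOpen (inner b) := by
  have : inner b = {p | 0 < (outer b).ψ p} ∩ ⋂ j, {p | (hole b j).ψ p < 0} := by
    ext p; simp [inner]
  rw [this]
  exact (isOpen_lt continuous_const (VTriangle.continuous_ψ _)).inter
    (isOpen_iInter_of_finite fun j => isOpen_lt (VTriangle.continuous_ψ _) continuous_const)

theorem inner_subset_interior : inner b ⊆ interior (carrier b) :=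
  interior_maximal (fun _ hp => ⟨hp.1.le, fun j => (hp.2 j).le⟩) isOpen_inner

theorem mem_inner_or {p : ℝ × ℝ} (hp : p ∈ carrier b) : p ∈ inner b ∨ (outer b).ψ p = 0 ∨
    ∃ j, (hole b j).ψ p = 0 := by
  by_contra! h
  exact h.1 ⟨lt_of_le_of_ne hp.1 h.2.1.symm, fun j => lt_of_le_of_ne (hp.2 j) (h.2.2 j)⟩

theorem hole_neg_of_outer {p : ℝ × ℝ} (h : (outer b).ψ p = 0) (j : Fin b) : (hole b j).ψ p < 0 := by
  by_contra! hj
  exact (outer_pos_of_hole hj).ne' h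

theorem eventually_hole_neg {p : ℝ × ℝ} {j : Fin b} (h : (hole b j).ψ p < 0) :
    ∀ᶠ q in 𝓝 p, (hole b j).ψ q < 0 :=
  ((VTriangle.continuous_ψ _).tendsto p).eventually_lt_const h

theorem mem_closure_inner_of_outer {p : ℝ × ℝ} (h : (outer b).ψ p = 0) : p ∈ closure (inner b) := by
  rw [mem_closure_iff_frequently]
  exact ((outer b).frequently_pos h).and_eventually
    (eventually_all.2 fun j => eventually_hole_neg (hole_neg_of_outer h j))

theorem mem_closure_inner_of_hole {p : ℝ × ℝ} {j : Fin b} (h : (hole b j).ψ p = 0) :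
    p ∈ closure (inner b) := by
  rw [mem_closure_iff_frequently]
  have h1 : ∀ᶠ q in 𝓝 p, 0 < (outer b).ψ q :=
    ((VTriangle.continuous_ψ _).tendsto p).eventually_const_lt (outer_pos_of_hole h.ge)
  have h2 : ∀ᶠ q in 𝓝 p, ∀ k, j ≠ k → (hole b k).ψ q < 0 := by
    refine eventually_all.2 fun k => ?_
    by_cases hk : j = k
    · exact Eventually.of_forall fun _ h => absurd hk h
    · filter_upwards [eventually_hole_neg (hole_neg_of_hole hk h.ge)] with q hq _ using hq
  refine (((hole b j).frequently_neg h).and_eventually (h1.and h2)).mono ?_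
  rintro q ⟨q1, q2, q3⟩
  refine ⟨q2, fun k => ?_⟩
  by_cases hk : j = k
  · exact hk ▸ q1
  · exact q3 k hk

theorem closure_interior_carrier : closure (interior (carrier b)) = carrier b := by
  refine Subset.antisymm (closure_minimal interior_subset isClosed_carrier) ?_
  intro p hp
  refine closure_mono inner_subset_interior ?_
  rcases mem_inner_or hp with h | h | ⟨j, h⟩
  exacts [subset_closure h, mem_closure_inner_of_outer h, mem_closure_inner_of_hole h]

theorem mem_frontier_carrier {p : ℝ × ℝ} :
    p ∈ frontier (carrier b) ↔ (outer b).ψ p = 0 ∨ ∃ j, (hole b j).ψ p = 0 := by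
  constructor
  · intro hp
    rcases mem_inner_or (isClosed_carrier.frontier_subset hp) with h | h
    · exact absurd (inner_subset_interior h) hp.2
    · exact h
  · intro h
    rw [frontier_eq_closure_inter_closure]
    constructor
    · refine closure_mono (inner_subset_interior.trans interior_subset) ?_
      rcases h with h | ⟨j, h⟩
      exacts [mem_closure_inner_of_outer h, mem_closure_inner_of_hole h]
    · rw [mem_closure_iff_frequently]
      rcases h with h | ⟨j, h⟩
      · exact ((outer b).frequently_neg h).mono fun q hq hm => absurd hm.1 (not_le.2 hq)
      · exact ((hole b j).frequently_pos h).mono fun q hq hm => absurd (hm.2 j) (not_le.2 hq)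

/-- A point at the height of no hole can be moved horizontally to the strip left of the holes. -/
theorem joinedIn_left {p : ℝ × ℝ} (hp : p ∈ carrier b) (h0 : 0 ≤ p.1)
    (h : ∀ j : Fin b, 1 ≤ |p.2 - (3 * (j : ℕ) + 1)|) : JoinedIn (carrier b) p (0, p.2) := by
  refine JoinedIn.of_segment_subset ?_
  rw [segment_eq_image']
  rintro _ ⟨θ, ⟨t0, t1⟩, rfl⟩
  obtain ⟨h1, h2⟩ := outer_nonneg_iff.1 hp.1
  have e1 : (p + θ • (((0 : ℝ), p.2) - p)).1 = (1 - θ) * p.1 := by simp; ring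
  have e2 : (p + θ • (((0 : ℝ), p.2) - p)).2 = p.2 := by simp
  have h3 : 0 ≤ (1 - θ) * p.1 := mul_nonneg (by linarith) h0
  refine ⟨outer_nonneg_iff.2 ?_, fun j => hole_nonpos_iff.2 (Or.inr ?_)⟩ <;> rw [e1, e2]
  · constructor <;> nlinarith
  · linarith [h j]

/-- A point to the right of a hole can be moved parallel to the oblique sides of the hole, away from
the height of the middle vertex, until it reaches the strip left of the holes or the height of an
end of the hole. -/
theorem joinedIn_oblique {p : ℝ × ℝ} (hp : p ∈ carrier b) (h0 : 0 ≤ p.1) {j : Fin b}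
    (h : |p.2 - (3 * (j : ℕ) + 1)| < 1) : ∃ q, JoinedIn (carrier b) p q ∧ 0 ≤ q.1 ∧
      (q.1 = 0 ∨ ∀ k : Fin b, 1 ≤ |q.2 - (3 * (k : ℕ) + 1)|) := by
  obtain ⟨h1, h2⟩ := outer_nonneg_iff.1 hp.1
  have hj := hole_nonpos_iff.1 (hp.2 j)
  have hgap : ∀ y : ℝ, |y - (3 * (j : ℕ) + 1)| ≤ 1 → ∀ k : Fin b, k ≠ j →
      1 ≤ |y - (3 * (k : ℕ) + 1)| := by
    intro y hy k hk
    rw [abs_le] at hy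
    rw [le_abs]
    rcases lt_or_gt_of_ne (fun h => hk (Fin.ext h)) with h | h
    · have : ((k : ℕ) : ℝ) + 1 ≤ (j : ℕ) := by exact_mod_cast h
      left; linarith
    · have : ((j : ℕ) : ℝ) + 1 ≤ (k : ℕ) := by exact_mod_cast h
      right; linarith
  -- the direction in which the height changes
  obtain ⟨σ, hσ, hσ'⟩ : ∃ σ : ℝ, |σ| = 1 ∧
      |p.2 - (3 * (j : ℕ) + 1)| = σ * (p.2 - (3 * (j : ℕ) + 1)) := by
    rcases le_total 0 (p.2 - (3 * (j : ℕ) + 1)) with h | h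
    · exact ⟨1, by simp, by rw [abs_of_nonneg h, one_mul]⟩
    · exact ⟨-1, by simp, by rw [abs_of_nonpos h]; ring⟩
  have hσ2 : σ * σ = 1 := by rw [← abs_mul_abs_self, hσ, one_mul]
  have habs : ∀ s, 0 ≤ s → |p.2 + s * σ - (3 * (j : ℕ) + 1)| =
      |p.2 - (3 * (j : ℕ) + 1)| + s := by
    intro s hs
    have e : p.2 + s * σ - (3 * (j : ℕ) + 1) =
        σ * (|p.2 - (3 * (j : ℕ) + 1)| + s) := by
      rw [hσ']; linear_combination (-(p.2 - (3 * (j : ℕ) + 1))) * hσ2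
    rw [e, abs_mul, hσ, one_mul, abs_of_nonneg (add_nonneg (abs_nonneg _) hs)]
  set t := min p.1 (1 - |p.2 - (3 * (j : ℕ) + 1)|) with ht
  have ht0 : 0 ≤ t := le_min h0 (by linarith)
  have ht1 : t ≤ p.1 := min_le_left _ _
  have ht2 : t ≤ 1 - |p.2 - (3 * (j : ℕ) + 1)| := min_le_right _ _
  refine ⟨(p.1 - t, p.2 + t * σ), JoinedIn.of_segment_subset ?_, sub_nonneg.2 ht1, ?_⟩
  · rw [segment_eq_image']
    rintro _ ⟨θ, ⟨t0, t1⟩, rfl⟩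
    have e1 : (p + θ • (((p.1 - t, p.2 + t * σ) : ℝ × ℝ) - p)).1 = p.1 - θ * t := by simp; ring
    have e2 : (p + θ • (((p.1 - t, p.2 + t * σ) : ℝ × ℝ) - p)).2 = p.2 + θ * t * σ := by
      simp; ring
    have hs0 : 0 ≤ θ * t := mul_nonneg t0 ht0
    have hs1 : θ * t ≤ t := mul_le_of_le_one_left ht0 t1
    refine ⟨outer_nonneg_iff.2 ?_, fun k => hole_nonpos_iff.2 ?_⟩ <;> rw [e1, e2]
    · refine ⟨by linarith, ?_⟩
      have e3 : p.2 + θ * t * σ - 1 / 2 = (p.2 - 1 / 2) + θ * t * σ := by ring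
      have h4 := abs_add_le (p.2 - 1 / 2) (θ * t * σ)
      rw [abs_mul, hσ, mul_one, abs_of_nonneg hs0] at h4
      rw [e3]; linarith
    · by_cases hk : k = j
      · subst hk
        rw [habs _ hs0]
        rcases hj with hj | hj
        · left; linarith
        · right; linarith
      · right
        have := hgap (p.2 + θ * t * σ) (by rw [habs _ hs0]; linarith) k hk
        linarith
  · rcases min_choice p.1 (1 - |p.2 - (3 * (j : ℕ) + 1)|) with hm | hm
    · left; simp only; rw [ht, hm]; ring
    · right
      have e : |p.2 + t * σ - (3 * (j : ℕ) + 1)| = 1 := by rw [habs _ ht0, ht, hm]; ring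
      intro k
      by_cases hk : k = j
      · subst hk; exact e.ge
      · exact hgap _ e.le k hk

theorem joinedIn_base {p : ℝ × ℝ} (hp : p ∈ carrier b) : JoinedIn (carrier b) p (0, 1 / 2) := by
  -- the strip left of the holes is convex
  have hstrip : ∀ p ∈ carrier b, p.1 ≤ 0 → JoinedIn (carrier b) p (0, 1 / 2) := by
    intro p hp h0
    obtain ⟨h1, h2⟩ := outer_nonneg_iff.1 hp.1
    refine JoinedIn.of_segment_subset ?_
    rw [segment_eq_image']
    rintro _ ⟨θ, ⟨t0, t1⟩, rfl⟩
    have e1 : (p + θ • (((0 : ℝ), (1 / 2 : ℝ)) - p)).1 = (1 - θ) * p.1 := by simp; ring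
    have e2 : (p + θ • (((0 : ℝ), (1 / 2 : ℝ)) - p)).2 - 1 / 2 = (1 - θ) * (p.2 - 1 / 2) := by
      simp; ring
    have h3 : 0 ≤ 1 - θ := by linarith
    refine ⟨outer_nonneg_iff.2 ?_, fun j => hole_nonpos_iff.2 (Or.inl ?_)⟩
    · rw [e1, e2, abs_mul, abs_of_nonneg h3]
      have hb : (0 : ℝ) ≤ b := Nat.cast_nonneg b
      constructor
      · nlinarith
      · nlinarith [mul_le_mul_of_nonneg_left h2 h3, mul_nonneg t0 hb]
    · rw [e1]; nlinarith
  have hend : ∀ p ∈ carrier b, 0 ≤ p.1 →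
      (p.1 = 0 ∨ ∀ k : Fin b, 1 ≤ |p.2 - (3 * (k : ℕ) + 1)|) →
      JoinedIn (carrier b) p (0, 1 / 2) := by
    rintro p hp h0 (h | h)
    · exact hstrip p hp h.le
    · have := joinedIn_left hp h0 h
      exact this.trans (hstrip _ this.target_mem le_rfl)
  rcases le_total p.1 0 with h0 | h0
  · exact hstrip p hp h0
  by_cases h : ∀ k : Fin b, 1 ≤ |p.2 - (3 * (k : ℕ) + 1)|
  · exact hend p hp h0 (Or.inr h)
  · push Not at h
    obtain ⟨j, hj⟩ := h
    obtain ⟨q, hq, hq0, hq'⟩ := joinedIn_oblique hp h0 hj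
    exact hq.trans (hend q hq.target_mem hq0 hq')

theorem base_mem : ((0, 1 / 2) : ℝ × ℝ) ∈ carrier b := by
  refine ⟨outer_nonneg_iff.2 ⟨by norm_num, ?_⟩, fun j => hole_nonpos_iff.2 (Or.inl le_rfl)⟩
  simp; positivity

theorem isConnected_carrier : IsConnected (carrier b) :=
  IsPathConnected.isConnected ⟨_, base_mem, fun _ hp => (joinedIn_base hp).symm⟩

variable (b) in
/-- A triangle with `b` triangular holes, placed on top of each other. -/
noncomputable def region : PolygonalRegion (b + 1) where
  carrier := carrier b
  size _ := 3
  bdry i := (tri b i).polygon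
  isCompact := isCompact_carrier
  isConnected := isConnected_carrier
  closure_interior := closure_interior_carrier
  isSimple i := (tri b i).isSimple_polygon
  disjoint := by
    intro i j hij
    rw [disjoint_left]
    intro p hi hj
    rw [VTriangle.mem_boundary_iff] at hi hj
    induction i using Fin.cases with
    | zero =>
      induction j using Fin.cases with
      | zero => exact hij rfl
      | succ j => exact (hole_neg_of_outer hi j).ne hj
    | succ i =>
      induction j using Fin.cases with
      | zero => exact (hole_neg_of_outer hj i).ne hi
      | succ j => exact (hole_neg_of_hole (fun h => hij (congrArg _ h)) (le_of_eq hi.symm)).ne hj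
  frontier_eq := by
    ext p
    rw [mem_frontier_carrier, mem_iUnion]
    simp only [VTriangle.mem_boundary_iff]
    rw [Fin.exists_fin_succ]
    rfl

theorem vertex_snd (i : Fin (b + 1)) (a : Fin 3) : ((tri b i).polygon.vertices a).2 =
    (tri b i).y + ((a : ℕ) - 1) * (tri b i).r := by
  fin_cases a <;> simp [VTriangle.polygon] <;> ring

theorem inGeneralPosition : (region b).InGeneralPosition := by
  have outer_ne : ∀ (j : Fin b) (a c : Fin 3), ((tri b 0).polygon.vertices a).2 ≠
      ((tri b j.succ).polygon.vertices c).2 := by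
    intro j a c h
    rw [vertex_snd, vertex_snd] at h
    simp only [tri, Fin.cons_zero, Fin.cons_succ, outer, hole] at h
    have h2 : (1 : ℤ) + 2 * ((a : ℕ) - 1) * (3 * b + 3) = 2 * (3 * (j : ℕ) + (c : ℕ)) := by
      have : (1 : ℝ) + 2 * ((a : ℕ) - 1) * (3 * b + 3) = 2 * (3 * (j : ℕ) + (c : ℕ)) := by
        linarith
      exact_mod_cast this
    have h3 : (1 : ℤ) = 2 * ((3 * (j : ℕ) + (c : ℕ)) - ((a : ℕ) - 1) * (3 * b + 3)) := by linarith
    omega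
  have key : ∀ (i j : Fin (b + 1)) (a c : Fin 3), ((tri b i).polygon.vertices a).2 =
      ((tri b j).polygon.vertices c).2 → i = j ∧ a = c := by
    intro i j a c h
    induction i using Fin.cases with
    | zero =>
      induction j using Fin.cases with
      | zero =>
        rw [vertex_snd, vertex_snd] at h
        have h2 := mul_right_cancel₀ (tri b 0).r_pos.ne' (add_left_cancel h)
        have h3 : ((a : ℕ) : ℝ) = (c : ℕ) := by linarith
        exact ⟨rfl, Fin.ext (by exact_mod_cast h3)⟩
      | succ j => exact absurd h (outer_ne j a c)
    | succ i =>
      induction j using Fin.cases with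
      | zero => exact absurd h.symm (outer_ne i c a)
      | succ j =>
        rw [vertex_snd, vertex_snd] at h
        simp only [tri, Fin.cons_succ, hole] at h
        have h2 : 3 * (i : ℕ) + (a : ℕ) = 3 * (j : ℕ) + (c : ℕ) := by
          have : (3 : ℝ) * (i : ℕ) + (a : ℕ) = 3 * (j : ℕ) + (c : ℕ) := by linarith
          exact_mod_cast this
        exact ⟨congrArg _ (Fin.ext (by omega)), Fin.ext (by omega)⟩
  rintro _ ⟨i, a, rfl⟩ _ ⟨j, c, rfl⟩ hne h
  obtain ⟨rfl, rfl⟩ := key i j a c h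
  exact hne rfl

end HoledTriangle

/-! ### Boundary triangles -/

namespace SegRegion

variable {S : Type} {D : SegRegion S}

/-- A vertex is regular if its height lies between the heights of the two neighbouring vertices. -/
theorem reg_iff {v : S} : D.Reg v ↔ D.η (D.next.symm v) < D.η v ∧ D.η v < D.η (D.next v) ∨
    D.η (D.next v) < D.η v ∧ D.η v < D.η (D.next.symm v) := by
  have h1 := η_next_ne (D := D) v
  have h2 := η_next_ne (D := D) (D.next.symm v)
  rw [Equiv.apply_symm_apply] at h2
  have e1 : D.hi v = max (D.η v) (D.η (D.next v)) := rfl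
  have e2 : D.lo v = min (D.η v) (D.η (D.next v)) := rfl
  have e3 : D.hi (D.next.symm v) = max (D.η (D.next.symm v)) (D.η v) := by
    rw [hi, Equiv.apply_symm_apply]
  have e4 : D.lo (D.next.symm v) = min (D.η (D.next.symm v)) (D.η v) := by
    rw [lo, Equiv.apply_symm_apply]
  constructor
  · rintro ⟨s, t, hs, ht, hhi, hlo⟩
    have hst : s ≠ t := by
      rintro rfl; exact (lo_lt_hi (D := D) s).ne (hlo.trans hhi.symm)
    rcases inc_iff.1 hs with rfl | rfl <;> rcases inc_iff.1 ht with rfl | rfl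
    · exact absurd rfl hst
    · rw [e1, max_eq_left_iff] at hhi
      rw [e4, min_eq_right_iff] at hlo
      exact Or.inr ⟨lt_of_le_of_ne hhi h1, lt_of_le_of_ne hlo h2⟩
    · rw [e3, max_eq_right_iff] at hhi
      rw [e2, min_eq_left_iff] at hlo
      exact Or.inl ⟨lt_of_le_of_ne hhi h2.symm, lt_of_le_of_ne hlo h1.symm⟩
    · exact absurd rfl hst
  · rintro (⟨h3, h4⟩ | ⟨h3, h4⟩)
    · exact ⟨D.next.symm v, v, inc_iff.2 (Or.inr rfl), inc_iff.2 (Or.inl rfl),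
        e3.trans (max_eq_right h3.le), e2.trans (min_eq_left h4.le)⟩
    · exact ⟨v, D.next.symm v, inc_iff.2 (Or.inl rfl), inc_iff.2 (Or.inr rfl),
        e1.trans (max_eq_left h3.le), e4.trans (min_eq_right h4.le)⟩

end SegRegion

/-- Among three different numbers exactly one lies between the other two. -/
theorem existsUnique_between {m : ℕ} (hm : m = 3) {h : Fin m → ℝ} (hh : Function.Injective h) :
    ∃! a, h ((finRotate m).symm a) < h a ∧ h a < h (finRotate m a) ∨
      h (finRotate m a) < h a ∧ h a < h ((finRotate m).symm a) := by
  subst hm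
  have e1 : finRotate 3 0 = 1 := rfl
  have e2 : finRotate 3 1 = 2 := rfl
  have e3 : finRotate 3 2 = 0 := rfl
  have f1 : (finRotate 3).symm 0 = 2 := rfl
  have f2 : (finRotate 3).symm 1 = 0 := rfl
  have f3 : (finRotate 3).symm 2 = 1 := rfl
  have h01 : h 0 ≠ h 1 := fun h => absurd (hh h) (by decide)
  have h02 : h 0 ≠ h 2 := fun h => absurd (hh h) (by decide)
  have h12 : h 1 ≠ h 2 := fun h => absurd (hh h) (by decide)
  have key : ∃ a, h ((finRotate 3).symm a) < h a ∧ h a < h (finRotate 3 a) ∨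
      h (finRotate 3 a) < h a ∧ h a < h ((finRotate 3).symm a) := by
    rw [Fin.exists_fin_succ, Fin.exists_fin_succ, Fin.exists_fin_succ]
    change (h 2 < h 0 ∧ h 0 < h 1 ∨ h 1 < h 0 ∧ h 0 < h 2) ∨
      (h 0 < h 1 ∧ h 1 < h 2 ∨ h 2 < h 1 ∧ h 1 < h 0) ∨
      (h 1 < h 2 ∧ h 2 < h 0 ∨ h 0 < h 2 ∧ h 2 < h 1) ∨ _
    grind
  obtain ⟨a, ha⟩ := key
  refine ⟨a, ha, fun c hc => ?_⟩
  fin_cases a <;> fin_cases c <;> simp [e1, e2, e3, f1, f2, f3] at ha hc ⊢ <;> grind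

namespace PolygonalRegion

variable {n : ℕ} {P : PolygonalRegion n} (hP : P.InGeneralPosition)

/-- If all boundary curves are triangles, each of them has one regular vertex. -/
theorem existsUnique_reg (h3 : ∀ i, P.size i = 3) (i : Fin n) :
    ∃! a, (P.toSeg hP).Reg (⟨i, a⟩ : Σ i, Fin (P.size i)) := by
  have := existsUnique_between (h3 i) (h := fun a => (P.toSeg hP).η ⟨i, a⟩) fun a c h => by
    have := SegRegion.η_injective (D := P.toSeg hP) h
    simpa using this
  simp only [SegRegion.reg_iff]
  exact this

theorem ncard_reg (h3 : ∀ i, P.size i = 3) : {v | (P.toSeg hP).Reg v}.ncard = n := by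
  choose a ha ha' using existsUnique_reg hP h3
  have : {v | (P.toSeg hP).Reg v} = range fun i => (⟨i, a i⟩ : Σ i, Fin (P.size i)) := by
    ext ⟨i, c⟩
    constructor
    · intro h
      exact ⟨i, by rw [ha' i c h]⟩
    · rintro ⟨j, h⟩
      exact h ▸ ha j
  rw [this, ← image_univ, ncard_image_of_injective _ fun i j h => congrArg Sigma.fst h, ncard_univ,
    Nat.card_fin]

theorem card_vertices : Nat.card (Σ i, Fin (P.size i)) = ∑ i, P.size i := by
  rw [Nat.card_eq_fintype_card, Fintype.card_sigma]; simp

theorem ncard_not_reg (h3 : ∀ i, P.size i = 3) : {v | ¬ (P.toSeg hP).Reg v}.ncard = 2 * n := by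
  have h1 := ncard_add_ncard_compl {v | (P.toSeg hP).Reg v}
  have h2 : {v | (P.toSeg hP).Reg v}ᶜ = {v | ¬ (P.toSeg hP).Reg v} := rfl
  rw [h2, ncard_reg hP h3, card_vertices] at h1
  simp only [h3, Finset.sum_const, Finset.card_univ, Fintype.card_fin, smul_eq_mul] at h1
  omega

/-- The first Betti number of the Reeb graph is less than the number of boundary curves. -/
theorem card_trap_add_two_le : Nat.card (P.toSeg hP).Trap + 2 ≤
    Nat.card (Σ i, Fin (P.size i)) + n :=
  have := nonempty_vertices hP
  SegRegion.card_trap_add_two_le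
    (fun i => ⟨i, ⟨0, lt_of_lt_of_le (by norm_num) (P.isSimple i).1⟩⟩)
    (exists_iterate_next P hP)

end PolygonalRegion

/-! ### The Reeb graph of a triangle with triangular holes -/

namespace HoledTriangle

variable {b : ℕ}

theorem reg_middle (i : Fin (b + 1)) :
    ((region b).toSeg inGeneralPosition).Reg (⟨i, (1 : Fin 3)⟩ : Σ _ : Fin (b + 1), Fin 3) := by
  refine SegRegion.reg_iff.2 (Or.inl ?_)
  change ((tri b i).polygon.vertices 0).2 < ((tri b i).polygon.vertices 1).2 ∧
    ((tri b i).polygon.vertices 1).2 < ((tri b i).polygon.vertices 2).2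
  have := (tri b i).r_pos
  rw [vertex_snd, vertex_snd, vertex_snd]
  constructor <;> norm_num <;> linarith

/-- The fibers through the lowest and the highest vertex of a hole extend to the left. -/
theorem lft_hole (j : Fin b) {a : Fin 3} (ha : a ≠ 1) :
    ((region b).toSeg inGeneralPosition).Lft (⟨j.succ, a⟩ : Σ _ : Fin (b + 1), Fin 3) := by
  have hv : (hole b j).polygon.vertices a = (0, (hole b j).y + ((a : ℕ) - 1) * (hole b j).r) := by
    refine Prod.ext ?_ (vertex_snd j.succ a)
    fin_cases a
    · rfl
    · exact absurd rfl ha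
    · rfl
  have hm : (0, (hole b j).y + ((a : ℕ) - 1) * (hole b j).r) ∈ carrier b := by
    rw [← hv]
    exact SegRegion.pt_mem (D := (region b).toSeg inGeneralPosition)
      (⟨j.succ, a⟩ : Σ _ : Fin (b + 1), Fin 3)
  change ∃ x < ((hole b j).polygon.vertices a).1, ∀ z ∈ uIcc x ((hole b j).polygon.vertices a).1,
    (z, ((hole b j).polygon.vertices a).2) ∈ carrier b
  rw [hv]
  refine ⟨-1, by norm_num, fun z hz => ?_⟩
  rw [uIcc_of_le (by norm_num)] at hz
  obtain ⟨h1, h2⟩ := outer_nonneg_iff.1 hm.1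
  exact ⟨outer_nonneg_iff.2 ⟨hz.1, h2.trans (by simpa using hz.2)⟩,
    fun k => hole_nonpos_iff.2 (Or.inl hz.2)⟩

theorem ncard_not_lft_le : {v | ¬ ((region b).toSeg inGeneralPosition).Reg v ∧
    ¬ ((region b).toSeg inGeneralPosition).Lft v}.ncard ≤ 2 := by
  have hsub : {v | ¬ ((region b).toSeg inGeneralPosition).Reg v ∧
      ¬ ((region b).toSeg inGeneralPosition).Lft v} ⊆
      ({⟨0, (0 : Fin 3)⟩, ⟨0, (2 : Fin 3)⟩} : Set (Σ _ : Fin (b + 1), Fin 3)) := by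
    rintro ⟨i, a⟩ ⟨h1, h2⟩
    replace h1 : a ≠ (1 : Fin 3) := by rintro rfl; exact h1 (reg_middle i)
    induction i using Fin.cases with
    | zero =>
      change Fin 3 at a
      fin_cases a
      · exact Or.inl rfl
      · exact absurd rfl h1
      · exact Or.inr rfl
    | succ j => exact absurd (lft_hole j h1) h2
  have hcard : ∀ u v : Σ _ : Fin (b + 1), Fin 3, ({u, v} : Set _).ncard ≤ 2 := fun u v =>
    (ncard_insert_le u {v}).trans (by rw [ncard_singleton])
  exact (ncard_le_ncard hsub (toFinite _)).trans (hcard _ _)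

theorem card_vertices_region : Nat.card (Σ i, Fin ((region b).size i)) = 3 * (b + 1) := by
  rw [PolygonalRegion.card_vertices]
  simp [region, mul_comm]

/-- The Reeb graph of a triangle with `b` triangular holes has first Betti number `b`. -/
theorem card_trap_region : Nat.card ((region b).toSeg inGeneralPosition).Trap = 4 * b + 2 := by
  have h1 := PolygonalRegion.card_trap_add_two_le (P := region b) inGeneralPosition
  have h2 := SegRegion.two_mul_card_trap (D := (region b).toSeg inGeneralPosition)
  rw [PolygonalRegion.ncard_reg inGeneralPosition fun _ => rfl,
    PolygonalRegion.ncard_not_reg inGeneralPosition fun _ => rfl] at h2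
  have h3 := PolygonalRegion.ncard_not_reg (P := region b) inGeneralPosition fun _ => rfl
  have h4 := ncard_inter_add_ncard_sdiff_eq_ncard
    {v | ¬ ((region b).toSeg inGeneralPosition).Reg v}
    {v | ((region b).toSeg inGeneralPosition).Lft v} (toFinite _)
  have h5 := ncard_not_lft_le (b := b)
  rw [card_vertices_region] at h1
  rw [h3] at h4
  change {v | ¬ ((region b).toSeg inGeneralPosition).Reg v ∧
    ((region b).toSeg inGeneralPosition).Lft v}.ncard +
    {v | ¬ ((region b).toSeg inGeneralPosition).Reg v ∧
    ¬ ((region b).toSeg inGeneralPosition).Lft v}.ncard = _ at h4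
  omega

end HoledTriangle

/-! ### Optimal Reeb graphs -/

namespace PolygonalRegion

variable {n : ℕ} {P : PolygonalRegion n} (hP : P.InGeneralPosition)

/-- If the Reeb graph of a polygon is optimal, all boundary curves are triangles, and the first
Betti number is as large as it can be. -/
theorem ReebIsOptimal.size_eq_three (hopt : P.ReebIsOptimal) :
    (∀ i, P.size i = 3) ∧ Nat.card (P.toSeg hP).Trap + 2 = 4 * n := by
  have hne := nonempty_vertices hP
  have : Finite (P.toSeg hP).graph.V := inferInstanceAs (Finite (Σ i, Fin (P.size i)))
  have : Finite (P.toSeg hP).graph.E := inferInstanceAs (Finite (P.toSeg hP).Trap)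
  have : Nonempty (P.toSeg hP).graph.V := hne
  have h1 : Nat.card (Σ i, Fin (P.size i)) ≤ Nat.card (P.toSeg hP).Trap + 1 :=
    (isConn_graph hP).card_le
  obtain ⟨b, hb⟩ := Nat.exists_eq_add_of_le h1
  have h2 := hopt _ (HoledTriangle.region b) HoledTriangle.inGeneralPosition
    (nonempty_homotopyEquiv_reeb hP HoledTriangle.inGeneralPosition (by
      rw [HoledTriangle.card_trap_region, HoledTriangle.card_vertices_region]; omega))
  rw [ncard_reebVertices hP, ncard_reebVertices HoledTriangle.inGeneralPosition,
    HoledTriangle.card_vertices_region] at h2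
  have h3 := card_trap_add_two_le hP
  have h4 := card_vertices (P := P)
  have h5 : ∑ _i : Fin n, 3 ≤ ∑ i, P.size i := Finset.sum_le_sum fun i _ => (P.isSimple i).1
  have h6 : ∑ _i : Fin n, 3 = 3 * n := by simp [mul_comm]
  have h7 : ∑ _i : Fin n, 3 = ∑ i, P.size i := by omega
  refine ⟨fun i => ?_, by omega⟩
  exact ((Finset.sum_eq_sum_iff_of_le fun i _ => (P.isSimple i).1).1 h7 i (Finset.mem_univ i)).symm

theorem degree_of_reg {v : Σ i, Fin (P.size i)} (h : (P.toSeg hP).Reg v) :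
    P.inDegree (reebVertex hP v) = 1 ∧ P.outDegree (reebVertex hP v) = 1 := by
  rw [inDegree_reebVertex, outDegree_reebVertex]
  exact (SegRegion.degrees_reg h).symm

open Classical in
theorem degree_of_not_reg {v : Σ i, Fin (P.size i)} (h : ¬ (P.toSeg hP).Reg v) :
    P.degree (reebVertex hP v) = (if (P.toSeg hP).Lft v then 3 else 1) ∧
      (P.IsSource (reebVertex hP v) ∨ P.IsSink (reebVertex hP v) ↔ ¬ (P.toSeg hP).Lft v) := by
  unfold degree IsSource IsSink
  rw [inDegree_reebVertex, outDegree_reebVertex]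
  rcases SegRegion.degrees_not_reg h with ⟨h1, h2⟩ | ⟨h1, h2⟩ <;> rw [h1, h2] <;>
    by_cases hl : (P.toSeg hP).Lft v <;> simp [hl]

theorem degree_eq_two_iff {v : Σ i, Fin (P.size i)} :
    P.degree (reebVertex hP v) = 2 ↔ (P.toSeg hP).Reg v := by
  by_cases h : (P.toSeg hP).Reg v
  · obtain ⟨h1, h2⟩ := degree_of_reg hP h
    simp [degree, h1, h2, h]
  · rw [(degree_of_not_reg hP h).1]
    split_ifs <;> simp [h]

theorem degree_eq_one_iff {v : Σ i, Fin (P.size i)} :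
    P.degree (reebVertex hP v) = 1 ↔ ¬ (P.toSeg hP).Reg v ∧ ¬ (P.toSeg hP).Lft v := by
  by_cases h : (P.toSeg hP).Reg v
  · obtain ⟨h1, h2⟩ := degree_of_reg hP h
    simp [degree, h1, h2, h]
  · rw [(degree_of_not_reg hP h).1]
    split_ifs with hl <;> simp [h, hl]

theorem isSource_or_isSink_iff (v : Σ i, Fin (P.size i)) :
    P.IsSource (reebVertex hP v) ∨ P.IsSink (reebVertex hP v) ↔
      P.degree (reebVertex hP v) = 1 := by
  rw [degree_eq_one_iff]
  by_cases h : (P.toSeg hP).Reg v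
  · obtain ⟨h1, h2⟩ := degree_of_reg hP h
    simp [IsSource, IsSink, h1, h2, h]
  · rw [(degree_of_not_reg hP h).2]
    simp [h]

end PolygonalRegion

open PolygonalRegion in
theorem theorem2 (n : ℕ) (P : PolygonalRegion n) (hP : P.InGeneralPosition)
    (hopt : P.ReebIsOptimal) :
    (P.IsFiniteOrientedGraph ∧ P.ReebIsNConnected n ∧ P.ReebIsPlanar) ∧
    ({v ∈ P.reebVertices | P.degree v = 2}.ncard = n ∧
      {v ∈ P.reebVertices | P.degree v = 1}.ncard = 2 ∧
      ∀ v ∈ P.reebVertices, P.degree v ≠ 2 → P.degree v ≠ 1 → P.degree v = 3) ∧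
    (∀ v ∈ P.reebVertices, P.IsSource v ∨ P.IsSink v ↔ P.degree v = 1) := by
  obtain ⟨h3, hE⟩ := hopt.size_eq_three hP
  have hreg := ncard_reg hP h3
  have hnot := ncard_not_reg hP h3
  have hV : Nat.card (Σ i, Fin (P.size i)) = 3 * n := by
    rw [card_vertices]; simp [h3, mul_comm]
  refine ⟨⟨isFiniteOrientedGraph hP, ⟨connectedSpace_reeb, ?_⟩, reebIsPlanar hP⟩, ⟨?_, ?_, ?_⟩, ?_⟩
  · rw [ncard_reebEdges hP, ncard_reebVertices hP, hV]
    push_cast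
    omega
  · rw [ncard_reebVertices_filter hP]
    simpa only [degree_eq_two_iff] using hreg
  · rw [ncard_reebVertices_filter hP]
    simp only [degree_eq_one_iff]
    have h1 := SegRegion.two_mul_card_trap (D := P.toSeg hP)
    have h2 := ncard_inter_add_ncard_sdiff_eq_ncard {v | ¬ (P.toSeg hP).Reg v}
      {v | (P.toSeg hP).Lft v} (toFinite _)
    change {v | ¬ (P.toSeg hP).Reg v ∧ (P.toSeg hP).Lft v}.ncard +
      {v | ¬ (P.toSeg hP).Reg v ∧ ¬ (P.toSeg hP).Lft v}.ncard = _ at h2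
    omega
  · rw [reebVertices_eq hP]
    rintro _ ⟨v, rfl⟩ h2 h1
    have h := (degree_of_not_reg hP (mt (degree_eq_two_iff hP).2 h2)).1
    split_ifs at h
    · exact h
    · exact absurd h h1
  · rw [reebVertices_eq hP]
    rintro _ ⟨v, rfl⟩
    exact isSource_or_isSink_iff hP v
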